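/- Let $k$ be a commutative ring and let $\mathcal C$ be a small $k$-linear category which is locally bounded (for every $c\in\mathcal C$ there are only finitely many objects $c'$ with $\mathcal C(c,c')\neq 0$ and only finitely many objects $c'$ with $\mathcal C(c',c)\neq 0$) and Hom-finite (every $k$-module $\mathcal C(c,c')$ is finitely generated projective). For a $k$-linear abelian category $\mathcal B$ let $\mathcal B^{\mathcal C}$ be the category of $k$-linear functors $\mathcal C\to\mathcal B$, let $i^*\colon \mathcal B^{\mathcal C}\to\prod_{c\in\mathcal C}\mathcal B$ be the evaluation functor, let $i_!((B_c)_c)=\bigoplus_{c}\mathcal C(c,-)\otimes_k B_c$ be its left adjoint, and put $P_{\mathcal B^{\mathcal C}}=i_!\circ i^*$. With $D=\operatorname{Hom}_k(-,k)$, let $\nu=D(\mathcal C)\otimes_{\mathcal C}-\colon\mathcal B^{\mathcal C}\to\mathcal B^{\mathcal C}$, $\nu(F)(c)=D(\mathcal C(c,-))\otimes_{\mathcal C}F$, be the Nakayama functor relative to $i_!\dashv i^*$, with right adjoint $\nu^-$, $\nu^-(F)(c)=\operatorname{Hom}_{\mathcal C}(D(\mathcal C(-,c)),F)$; so $i_*=\nu\circ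 i_!$ is right adjoint to $i^*$. For $i>0$ let $L_i\nu$ be the left derived functor of $\nu$ computed by resolutions by objects in the image of $i_!$, and $R^i\nu^-$ the right derived functor of $\nu^-$ computed by coresolutions by objects in the image of $i_*$. The functor $P_{\mathcal B^{\mathcal C}}$ is called Iwanaga-Gorenstein if there is an integer $n\ge 0$ with $L_i\nu=0$ and $R^i\nu^-=0$ for all $i>n$, and $n$-Gorenstein if $n$ is the smallest such integer. Write $\mathcal C\text{-Mod}$ for $\mathcal B^{\mathcal C}$ with $\mathcal B$ the category of $k$-modules. If $P_{\mathcal C\text{-Mod}}$ is $n$-Gorenstein, then for every $k$-linear abelian category $\mathcal B$ the functor $P_{\mathcal B^{\mathcal C}}$ is $m$-Gorenstein for some $m\le n$. -/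

import Mathlib

open CategoryTheory CategoryTheory.Limits

universe u v w v₁ v₂ u₁ u₂

noncomputable section

namespace RelGorenstein

/-! ### Nakayama functors relative to an adjunction and their derived functors -/

section General

variable {A : Type u₁} [Category.{v₁} A] [Abelian A]

/-- The canonical resolution of `X` by objects in the image of an endofunctor `P` with
an (epimorphic) augmentation `ε : P ⟶ 𝟭 A`:
`⋯ ⟶ P (K₁) ⟶ P (K₀) ⟶ P X`, with `K₀ = ker (P X ⟶ X)` and each further `Kᵢ` the kernel
of the previous differential. -/
def resolution (P : A ⥤ A) (ε : P ⟶ 𝟭 A) (X : A) : ChainComplex A ℕ :=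
  ChainComplex.mk' (P.obj X) (P.obj (kernel (ε.app X))) (ε.app _ ≫ kernel.ι (ε.app X))
    (fun f => ⟨P.obj (kernel f), ε.app _ ≫ kernel.ι f, by simp⟩)

/-- The canonical coresolution of `X` by objects in the image of an endofunctor `I` with
a (monomorphic) coaugmentation `η : 𝟭 A ⟶ I`:
`I X ⟶ I (C₀) ⟶ I (C₁) ⟶ ⋯`, with `C₀ = coker (X ⟶ I X)` and each further `Cᵢ` the cokernel
of the previous differential. -/
def coresolution (I : A ⥤ A) (η : 𝟭 A ⟶ I) (X : A) : CochainComplex A ℕ :=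
  CochainComplex.mk' (I.obj X) (I.obj (cokernel (η.app X))) (cokernel.π (η.app X) ≫ η.app _)
    (fun f => ⟨I.obj (cokernel f), cokernel.π f ≫ η.app _, by simp⟩)

variable {D : Type u₂} [Category.{v₂} D]

/-- A Nakayama functor relative to an adjunction `fl ⊣ fs` with `fs` faithful
(`fl` is `f_!` and `fs` is `f^*`). -/
structure NakayamaFunctor {fl : D ⥤ A} {fs : A ⥤ D} (adj : fl ⊣ fs) where
  /-- `f^*` is faithful -/
  faithful : fs.Faithful
  /-- the Nakayama functor `ν` -/
  nu : A ⥤ A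
  /-- its right adjoint `ν⁻` -/
  nuMinus : A ⥤ A
  nu_additive : nu.Additive
  nuMinus_additive : nuMinus.Additive
  /-- the adjunction `ν ⊣ ν⁻` -/
  nuAdj : nu ⊣ nuMinus
  /-- `f_* := ν ∘ f_!` is right adjoint to `f^*` -/
  starAdj : fs ⊣ fl ⋙ nu
  /-- the unit of `ν ⊣ ν⁻` is an isomorphism on the objects `f_!(Y)` -/
  isIso_unit : ∀ Y : D, IsIso (nuAdj.unit.app (fl.obj Y))

namespace NakayamaFunctor

variable {fl : D ⥤ A} {fs : A ⥤ D} {adj : fl ⊣ fs} (N : NakayamaFunctor adj)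

/-- The `i`-th left derived functor `L_i ν` (for `i > 0`) on the object `X`, computed by the
canonical resolution of `X` by the objects `P(Y) = f_! f^* Y`, which are adapted to `ν`. -/
def leftDerivedObj (i : ℕ) (X : A) : A :=
  have := N.nu_additive
  ((N.nu.mapHomologicalComplex _).obj (resolution (fs ⋙ fl) adj.counit X)).homology i

/-- The `i`-th right derived functor `R^i ν⁻` (for `i > 0`) on the object `X`, computed by the
canonical coresolution of `X` by the objects `I(Y) = f_* f^* Y`, `f_* = ν ∘ f_!`, which are
adapted to `ν⁻`. -/
def rightDerivedObj (i : ℕ) (X : A) : A :=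
  have := N.nuMinus_additive
  ((N.nuMinus.mapHomologicalComplex _).obj
    (coresolution (fs ⋙ fl ⋙ N.nu) N.starAdj.unit X)).homology i

/-- `L_i ν = 0` and `R^i ν⁻ = 0` for all `i > n`. -/
def VanishesAbove (n : ℕ) : Prop :=
  ∀ i : ℕ, n < i → (∀ X : A, IsZero (N.leftDerivedObj i X)) ∧
    (∀ X : A, IsZero (N.rightDerivedObj i X))

/-- `P = f_! f^*` is Iwanaga-Gorenstein. -/
def IsIwanagaGorenstein : Prop := ∃ n : ℕ, N.VanishesAbove n

/-- `P = f_! f^*` is `n`-Gorenstein: it is Iwanaga-Gorenstein, of Gorenstein dimension `n`. -/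
def IsGorensteinOfDim (n : ℕ) : Prop := IsLeast {r : ℕ | N.VanishesAbove r} n

end NakayamaFunctor

end General

/-! ### The category of `k`-linear functors -/

section LinearFunctors

variable (k : Type u) [CommRing k]
variable (C : Type u₁) [Category.{v₁} C] [Preadditive C] [Linear k C]
variable (B : Type u₂) [Category.{v₂} B]

/-- `k`-linearity of a functor, as a property of objects of the functor category. -/
def linearFunctor [Preadditive B] [Linear k B] : ObjectProperty (C ⥤ B) :=
  fun F => F.Additive ∧ F.Linear k

/-- The category `B^C` of `k`-linear functors from `C` to `B`. -/
abbrev LinFun [Preadditive B] [Linear k B] := (linearFunctor k C B).FullSubcategory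

instance [Preadditive B] [Linear k B] (F : LinFun k C B) : F.obj.Additive := F.property.1
instance [Preadditive B] [Linear k B] (F : LinFun k C B) : F.obj.Linear k := F.property.2

variable [Abelian B] [Linear k B]

instance : (linearFunctor k C B).IsClosedUnderSubobjects where
  prop_of_mono {F G} f _ hG := by
    obtain ⟨h1, h2⟩ := hG
    refine ⟨⟨fun {X Y a b} => ?_⟩, ⟨fun {X Y} a r => ?_⟩⟩
    · rw [← cancel_mono (f.app Y)]
      simp [Preadditive.add_comp]
    · rw [← cancel_mono (f.app Y)]
      simp

instance : (linearFunctor k C B).IsClosedUnderQuotients where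
  prop_of_epi {F G} f _ hG := by
    obtain ⟨h1, h2⟩ := hG
    refine ⟨⟨fun {X Y a b} => ?_⟩, ⟨fun {X Y} a r => ?_⟩⟩
    · rw [← cancel_epi (f.app X)]
      simp [← NatTrans.naturality]
    · rw [← cancel_epi (f.app X)]
      simp [← NatTrans.naturality]

instance : (linearFunctor k C B).IsClosedUnderFiniteProducts where
  isClosedUnderLimitsOfShape J _ := ⟨by
    rintro F ⟨p⟩
    have h1 := fun j => (p.prop_diag_obj j).1
    have h2 := fun j => (p.prop_diag_obj j).2
    have key : ∀ (Y : C) {Z : B} (a b : Z ⟶ F.obj Y),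
        (∀ j, a ≫ (p.π.app j).app Y = b ≫ (p.π.app j).app Y) → a = b := fun Y Z a b h =>
      (isLimitOfPreserves ((evaluation C B).obj Y) p.isLimit).hom_ext h
    refine ⟨⟨fun {X Y a b} => ?_⟩, ⟨fun {X Y} a r => ?_⟩⟩
    · refine key _ _ _ fun j => ?_
      have := h1 j
      simp [Preadditive.add_comp]
    · refine key _ _ _ fun j => ?_
      have := h2 j
      simp⟩

instance : (linearFunctor k C B).ContainsZero where
  exists_zero := by
    obtain ⟨Z, hZ⟩ := HasZeroObject.zero (C := C ⥤ B)
    have h : ∀ X : C, IsZero (Z.obj X) := fun X => ((evaluation C B).obj X).map_isZero hZ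
    exact ⟨Z, hZ, ⟨fun {X Y a b} => (h X).eq_of_src _ _⟩, ⟨fun {X Y} a r => (h X).eq_of_src _ _⟩⟩

instance : Abelian (LinFun k C B) := inferInstance

end LinearFunctors

/-! ### Dual bases -/

section DualBasis

variable (k : Type u) [CommRing k] (M : Type v) [AddCommGroup M] [Module k M]

/-- A finite dual basis of a module. -/
structure FinDualBasis where
  n : ℕ
  x : Fin n → M
  ξ : Fin n → Module.Dual k M
  sum_eq : ∀ m, ∑ a, ξ a m • x a = m

variable {k M} in
lemma FinDualBasis.dual_sum_eq (b : FinDualBasis k M) (φ : Module.Dual k M) :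
    ∑ a, φ (b.x a) • b.ξ a = φ := by
  ext m
  conv_rhs => rw [← b.sum_eq m]
  simp [mul_comm]

lemma nonempty_finDualBasis [Module.Finite k M] [Module.Projective k M] :
    Nonempty (FinDualBasis k M) := by
  obtain ⟨n, f, hf⟩ := Module.Finite.exists_fin' k M
  obtain ⟨g, hg⟩ := Module.projective_lifting_property f LinearMap.id hf
  refine ⟨⟨n, fun a => f (Pi.single a 1), fun a => LinearMap.proj a ∘ₗ g, fun m => ?_⟩⟩
  have h1 : ∀ w : Fin n → k, ∑ a, w a • f (Pi.single a 1) = f w := fun w => by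
    conv_rhs => rw [pi_eq_sum_univ' w]
    simp [map_sum]
  have h2 := LinearMap.congr_fun hg m
  simpa using (h1 (g m)).trans h2

/-- A chosen finite dual basis of a finitely generated projective module. -/
def finDualBasis [Module.Finite k M] [Module.Projective k M] : FinDualBasis k M :=
  (nonempty_finDualBasis k M).some

end DualBasis

/-! ### Tensors and cotensors of families -/

section Tensor

attribute [local instance] Abelian.hasFiniteBiproducts

variable {k : Type u} [CommRing k] {B : Type u₂} [Category.{v₂} B] [Abelian B] [Linear k B]

variable {I : Type u₁} (M : I → Type v₁) [∀ i, AddCommGroup (M i)] [∀ i, Module k (M i)]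
  (Y : I → B)

variable (k) in
/-- The object `⨁ᵢ Mᵢ ⊗ₖ Yᵢ`: linear families `Mᵢ → B(Yᵢ, X)` correspond to maps to `X`. -/
structure FamTensor where
  pt : B
  ι : ∀ i, M i →ₗ[k] (Y i ⟶ pt)
  desc : ∀ {X : B} (_ : ∀ i, M i →ₗ[k] (Y i ⟶ X)), pt ⟶ X
  fac : ∀ {X : B} (h : ∀ i, M i →ₗ[k] (Y i ⟶ X)) (i : I) (m : M i), ι i m ≫ desc h = h i m
  hom_ext : ∀ {X : B} (f g : pt ⟶ X), (∀ i m, ι i m ≫ f = ι i m ≫ g) → f = g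

variable (k) in
/-- The object `∏ᵢ Hom(Mᵢ, Yᵢ)`: linear families `Mᵢ → B(X, Yᵢ)` correspond to maps from `X`. -/
structure FamCotensor where
  pt : B
  π : ∀ i, M i →ₗ[k] (pt ⟶ Y i)
  lift : ∀ {X : B} (_ : ∀ i, M i →ₗ[k] (X ⟶ Y i)), X ⟶ pt
  fac : ∀ {X : B} (h : ∀ i, M i →ₗ[k] (X ⟶ Y i)) (i : I) (m : M i), lift h ≫ π i m = h i m
  hom_ext : ∀ {X : B} (f g : X ⟶ pt), (∀ i m, f ≫ π i m = g ≫ π i m) → f = g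

variable [∀ i, Module.Finite k (M i)] [∀ i, Module.Projective k (M i)]

variable [Finite {i // Nontrivial (M i)}]

variable (k) in
/-- Index type of a finite biproduct which has `⨁ᵢ Mᵢ ⊗ₖ Yᵢ` as a direct summand. -/
abbrev FamIdx : Type u₁ :=
  Σ i : {i // Nontrivial (M i)}, Fin (finDualBasis k (M i.1)).n

/-- The idempotent given by the chosen dual bases. -/
def famIdem :
    (⨁ fun j : FamIdx k M => Y j.1.1) ⟶ ⨁ fun j : FamIdx k M => Y j.1.1 :=
  biproduct.desc fun j => ∑ b : Fin (finDualBasis k (M j.1.1)).n,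
    (finDualBasis k (M j.1.1)).ξ b ((finDualBasis k (M j.1.1)).x j.2) •
      biproduct.ι (fun j : FamIdx k M => Y j.1.1) ⟨j.1, b⟩

lemma ι_famIdem (j : FamIdx k M) :
    biproduct.ι (fun j : FamIdx k M => Y j.1.1) j ≫ famIdem M Y =
      ∑ b : Fin (finDualBasis k (M j.1.1)).n,
        (finDualBasis k (M j.1.1)).ξ b ((finDualBasis k (M j.1.1)).x j.2) •
          biproduct.ι (fun j : FamIdx k M => Y j.1.1) ⟨j.1, b⟩ := by
  simp [famIdem]

variable (k) in
open Classical in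
/-- Existence of `⨁ᵢ Mᵢ ⊗ₖ Yᵢ` for finitely generated projective modules `Mᵢ`, only finitely
many of them nonzero. -/
def famTensor : FamTensor k M Y where
  pt := cokernel (𝟙 _ - famIdem (k := k) M Y)
  ι i := if hi : Nontrivial (M i) then
      ∑ a, ((finDualBasis k (M i)).ξ a).smulRight
        (biproduct.ι (fun j : FamIdx k M => Y j.1.1) ⟨⟨i, hi⟩, a⟩ ≫ cokernel.π _)
    else 0
  desc h := cokernel.desc _ (biproduct.desc fun j => h j.1.1 ((finDualBasis k (M j.1.1)).x j.2))
    (by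
      ext j
      have := congrArg (h j.1.1) ((finDualBasis k (M j.1.1)).sum_eq
        ((finDualBasis k (M j.1.1)).x j.2))
      simp only [map_sum, map_smul] at this
      simp [famIdem, Preadditive.sub_comp, Preadditive.comp_sub, Preadditive.sum_comp, this])
  fac h i m := by
    by_cases hi : Nontrivial (M i)
    · conv_rhs => rw [← (finDualBasis k (M i)).sum_eq m]
      simp [hi, Preadditive.sum_comp]
    · have := not_nontrivial_iff_subsingleton.1 hi
      rw [Subsingleton.elim m 0]; simp
  hom_ext f g h := by
    rw [← cancel_epi (cokernel.π _)]
    ext j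
    have e : biproduct.ι _ j ≫ cokernel.π (𝟙 _ - famIdem (k := k) M Y) =
        ∑ a, (finDualBasis k (M j.1.1)).ξ a ((finDualBasis k (M j.1.1)).x j.2) •
        (biproduct.ι (fun j : FamIdx k M => Y j.1.1) ⟨j.1, a⟩ ≫
          cokernel.π (𝟙 _ - famIdem (k := k) M Y)) := by
      have := cokernel.condition (𝟙 _ - famIdem (k := k) M Y)
      rw [Preadditive.sub_comp, sub_eq_zero, Category.id_comp] at this
      conv_lhs => rw [this, ← Category.assoc, ι_famIdem, Preadditive.sum_comp]
      simp only [Linear.smul_comp]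
    have := h j.1.1 ((finDualBasis k (M j.1.1)).x j.2)
    have hj := j.1.2
    simp only [hj, dif_pos, LinearMap.sum_apply, LinearMap.smulRight_apply] at this
    rw [← Category.assoc, ← Category.assoc, e]
    exact this

/-- The idempotent given by the chosen dual bases, for cotensors. -/
def famCoidem :
    (⨁ fun j : FamIdx k M => Y j.1.1) ⟶ ⨁ fun j : FamIdx k M => Y j.1.1 :=
  biproduct.lift fun j => ∑ b : Fin (finDualBasis k (M j.1.1)).n,
    (finDualBasis k (M j.1.1)).ξ b ((finDualBasis k (M j.1.1)).x j.2) •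
      biproduct.π (fun j : FamIdx k M => Y j.1.1) ⟨j.1, b⟩

lemma famCoidem_π (j : FamIdx k M) :
    famCoidem M Y ≫ biproduct.π (fun j : FamIdx k M => Y j.1.1) j =
      ∑ b : Fin (finDualBasis k (M j.1.1)).n,
        (finDualBasis k (M j.1.1)).ξ b ((finDualBasis k (M j.1.1)).x j.2) •
          biproduct.π (fun j : FamIdx k M => Y j.1.1) ⟨j.1, b⟩ := by
  simp [famCoidem]

variable (k) in
open Classical in
/-- Existence of `∏ᵢ Hom(Mᵢ, Yᵢ)` for finitely generated projective modules `Mᵢ`, only finitely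
many of them nonzero. -/
def famCotensor : FamCotensor k M Y where
  pt := kernel (𝟙 _ - famCoidem (k := k) M Y)
  π i := if hi : Nontrivial (M i) then
      ∑ a, ((finDualBasis k (M i)).ξ a).smulRight
        (kernel.ι _ ≫ biproduct.π (fun j : FamIdx k M => Y j.1.1) ⟨⟨i, hi⟩, a⟩)
    else 0
  lift h := kernel.lift _ (biproduct.lift fun j => h j.1.1 ((finDualBasis k (M j.1.1)).x j.2))
    (by
      ext j
      have := congrArg (h j.1.1) ((finDualBasis k (M j.1.1)).sum_eq
        ((finDualBasis k (M j.1.1)).x j.2))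
      simp only [map_sum, map_smul] at this
      simp [famCoidem_π, Preadditive.sub_comp, Preadditive.comp_sub, Preadditive.comp_sum, this])
  fac h i m := by
    by_cases hi : Nontrivial (M i)
    · conv_rhs => rw [← (finDualBasis k (M i)).sum_eq m]
      simp [hi, Preadditive.comp_sum]
    · have := not_nontrivial_iff_subsingleton.1 hi
      rw [Subsingleton.elim m 0]; simp
  hom_ext f g h := by
    rw [← cancel_mono (kernel.ι _)]
    ext j
    have e : kernel.ι (𝟙 _ - famCoidem (k := k) M Y) ≫ biproduct.π _ j =
        ∑ a, (finDualBasis k (M j.1.1)).ξ a ((finDualBasis k (M j.1.1)).x j.2) •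
        (kernel.ι (𝟙 _ - famCoidem (k := k) M Y) ≫
          biproduct.π (fun j : FamIdx k M => Y j.1.1) ⟨j.1, a⟩) := by
      have := kernel.condition (𝟙 _ - famCoidem (k := k) M Y)
      rw [Preadditive.comp_sub, sub_eq_zero, Category.comp_id] at this
      conv_lhs => rw [this, Category.assoc, famCoidem_π, Preadditive.comp_sum]
      simp only [Linear.comp_smul]
    have := h j.1.1 ((finDualBasis k (M j.1.1)).x j.2)
    have hj := j.1.2
    simp only [hj, dif_pos, LinearMap.sum_apply, LinearMap.smulRight_apply] at this
    rw [Category.assoc, Category.assoc, e]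
    exact this

attribute [irreducible] famTensor famCotensor

end Tensor

/-! ### Locally bounded and Hom-finite categories -/

section Categories

variable (k : Type u) [CommRing k] (C : Type u₁) [Category.{v₁} C] [Preadditive C] [Linear k C]

/-- For each object `c` there are only finitely many objects mapping nontrivially in or out
of `c`. -/
class IsLocallyBounded (C : Type u₁) [Category.{v₁} C] [Preadditive C] : Prop where
  finite_out : ∀ c : C, {c' : C | Nontrivial (c ⟶ c')}.Finite
  finite_in : ∀ c : C, {c' : C | Nontrivial (c' ⟶ c)}.Finite

/-- All morphism modules are finitely generated projective over `k`. -/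
class IsHomFinite : Prop where
  finite : ∀ c c' : C, Module.Finite k (c ⟶ c')
  projective : ∀ c c' : C, Module.Projective k (c ⟶ c')

variable [IsLocallyBounded C] [IsHomFinite k C]
variable {C}

instance (c c' : C) : Module.Finite k (c ⟶ c') := IsHomFinite.finite c c'
instance (c c' : C) : Module.Projective k (c ⟶ c') := IsHomFinite.projective c c'

end Categories

section FunctorCategory

variable (k : Type u) [CommRing k]
variable {C : Type u₁} [Category.{v₁} C] [Preadditive C] [Linear k C]
variable {B : Type u₂} [Category.{v₂} B] [Abelian B] [Linear k B]

instance [IsLocallyBounded C] (c : C) : Finite {c' : C // Nontrivial (c' ⟶ c)} :=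
  IsLocallyBounded.finite_in c

instance [IsLocallyBounded C] (c : C) :
    Finite {c' : C // Nontrivial (Module.Dual k (c ⟶ c'))} :=
  ((IsLocallyBounded.finite_out c).subset fun c' (h : Nontrivial _) => by
    by_contra h'
    have := not_nontrivial_iff_subsingleton.1 h'
    exact not_subsingleton (Module.Dual k (c ⟶ c')) inferInstance :
      {c' : C | Nontrivial (Module.Dual k (c ⟶ c'))}.Finite)

instance [IsLocallyBounded C] (c : C) :
    Finite {c' : C // Nontrivial (Module.Dual k (c' ⟶ c))} :=
  ((IsLocallyBounded.finite_in c).subset fun c' (h : Nontrivial _) => by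
    by_contra h'
    have := not_nontrivial_iff_subsingleton.1 h'
    exact not_subsingleton (Module.Dual k (c' ⟶ c)) inferInstance :
      {c' : C | Nontrivial (Module.Dual k (c' ⟶ c))}.Finite)

open TensorProduct in
instance [IsLocallyBounded C] (c : C) :
    Finite {p : C × C // Nontrivial (Module.Dual k (c ⟶ p.2) ⊗[k] (p.1 ⟶ p.2))} := by
  have h : {p : C × C | Nontrivial (Module.Dual k (c ⟶ p.2) ⊗[k] (p.1 ⟶ p.2))} ⊆
      ⋃ c' ∈ {c' : C | Nontrivial (c ⟶ c')}, (fun d => (d, c')) ''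
        {d : C | Nontrivial (d ⟶ c')} := by
    rintro ⟨d, c'⟩ (h : Nontrivial _)
    simp only [Set.mem_iUnion]
    refine ⟨c', ?_, d, ?_, rfl⟩ <;>
    · by_contra h'
      have := not_nontrivial_iff_subsingleton.1 h'
      exact not_subsingleton (Module.Dual k (c ⟶ c') ⊗[k] (d ⟶ c')) inferInstance
  exact ((IsLocallyBounded.finite_out c).biUnion fun c' _ =>
    (IsLocallyBounded.finite_in c').image _).subset h

open TensorProduct in
instance [IsLocallyBounded C] (c : C) :
    Finite {p : C × C // Nontrivial (Module.Dual k (p.1 ⟶ c) ⊗[k] (p.1 ⟶ p.2))} := by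
  have h : {p : C × C | Nontrivial (Module.Dual k (p.1 ⟶ c) ⊗[k] (p.1 ⟶ p.2))} ⊆
      ⋃ c' ∈ {c' : C | Nontrivial (c' ⟶ c)}, (fun d => (c', d)) ''
        {d : C | Nontrivial (c' ⟶ d)} := by
    rintro ⟨c', d⟩ (h : Nontrivial _)
    simp only [Set.mem_iUnion]
    refine ⟨c', ?_, d, ?_, rfl⟩ <;>
    · by_contra h'
      have := not_nontrivial_iff_subsingleton.1 h'
      exact not_subsingleton (Module.Dual k (c' ⟶ c) ⊗[k] (c' ⟶ d)) inferInstance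
  exact ((IsLocallyBounded.finite_in c).biUnion fun c' _ =>
    (IsLocallyBounded.finite_out c').image _).subset h

/-! ### Dualized Hom-modules -/

section

variable {c d e c' c'' : C}

/-- The map `D(C(c, c')) ⟶ D(C(d, c'))`, `ξ ↦ ξ(f ≫ -)`, induced by `f : c ⟶ d`. -/
def dualPre (f : c ⟶ d) (c' : C) : Module.Dual k (c ⟶ c') →ₗ[k] Module.Dual k (d ⟶ c') :=
  (Linear.leftComp k c' f).dualMap

/-- The map `D(C(c', d)) ⟶ D(C(c', c))`, `ξ ↦ ξ(- ≫ f)`, induced by `f : c ⟶ d`. -/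
def dualPost (f : c ⟶ d) (c' : C) : Module.Dual k (c' ⟶ d) →ₗ[k] Module.Dual k (c' ⟶ c) :=
  (Linear.rightComp k c' f).dualMap

@[simp]
lemma dualPre_apply (f : c ⟶ d) (ξ : Module.Dual k (c ⟶ c')) (m : d ⟶ c') :
    dualPre k f c' ξ m = ξ (f ≫ m) := rfl

@[simp]
lemma dualPost_apply (f : c ⟶ d) (ξ : Module.Dual k (c' ⟶ d)) (m : c' ⟶ c) :
    dualPost k f c' ξ m = ξ (m ≫ f) := rfl

lemma dualPre_id (ξ : Module.Dual k (c ⟶ c')) : dualPre k (𝟙 c) c' ξ = ξ := by ext m; simp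

lemma dualPre_comp (f : c ⟶ d) (g : d ⟶ e) (ξ : Module.Dual k (c ⟶ c')) :
    dualPre k (f ≫ g) c' ξ = dualPre k g c' (dualPre k f c' ξ) := by ext m; simp

lemma dualPre_add (f g : c ⟶ d) (ξ : Module.Dual k (c ⟶ c')) :
    dualPre k (f + g) c' ξ = dualPre k f c' ξ + dualPre k g c' ξ := by
  ext m; simp [Preadditive.add_comp]

lemma dualPre_smul (r : k) (f : c ⟶ d) (ξ : Module.Dual k (c ⟶ c')) :
    dualPre k (r • f) c' ξ = r • dualPre k f c' ξ := by ext m; simp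

lemma dualPost_id (ξ : Module.Dual k (c' ⟶ c)) : dualPost k (𝟙 c) c' ξ = ξ := by ext m; simp

lemma dualPost_comp (f : c ⟶ d) (g : d ⟶ e) (ξ : Module.Dual k (c' ⟶ e)) :
    dualPost k (f ≫ g) c' ξ = dualPost k f c' (dualPost k g c' ξ) := by ext m; simp

lemma dualPost_add (f g : c ⟶ d) (ξ : Module.Dual k (c' ⟶ d)) :
    dualPost k (f + g) c' ξ = dualPost k f c' ξ + dualPost k g c' ξ := by
  ext m; simp

lemma dualPost_smul (r : k) (f : c ⟶ d) (ξ : Module.Dual k (c' ⟶ d)) :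
    dualPost k (r • f) c' ξ = r • dualPost k f c' ξ := by ext m; simp

lemma dualPre_dualPost (f : c ⟶ d) (g : c' ⟶ c'') (ξ : Module.Dual k (c ⟶ c'')) :
    dualPre k f c' (dualPost k g c ξ) = dualPost k g d (dualPre k f c'' ξ) := by ext m; simp

end

/-! ### Colimits and limits weighted by the dualized Hom-modules -/

/-- The colimit `D(C(c, -)) ⊗_C F` of `F : C ⥤ B` weighted by the right module
`D(C(c, -)) = Hom_k(C(c, -), k)`: maps to `X` correspond to morphisms of right modules
`D(C(c, -)) ⟶ B(F -, X)`. -/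
structure DualTensor (F : LinFun k C B) (c : C) where
  pt : B
  ι : ∀ c' : C, Module.Dual k (c ⟶ c') →ₗ[k] (F.obj.obj c' ⟶ pt)
  w : ∀ {c' c'' : C} (f : c' ⟶ c'') (ξ : Module.Dual k (c ⟶ c'')),
    ι c' (dualPost k f c ξ) = F.obj.map f ≫ ι c'' ξ
  desc : ∀ {X : B} (h : ∀ c' : C, Module.Dual k (c ⟶ c') →ₗ[k] (F.obj.obj c' ⟶ X))
    (_ : ∀ (c' c'' : C) (f : c' ⟶ c'') (ξ : Module.Dual k (c ⟶ c'')),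
      h c' (dualPost k f c ξ) = F.obj.map f ≫ h c'' ξ), pt ⟶ X
  fac : ∀ {X : B} (h : ∀ c' : C, Module.Dual k (c ⟶ c') →ₗ[k] (F.obj.obj c' ⟶ X))
    (hw : ∀ (c' c'' : C) (f : c' ⟶ c'') (ξ : Module.Dual k (c ⟶ c'')),
      h c' (dualPost k f c ξ) = F.obj.map f ≫ h c'' ξ) (c' : C)
    (ξ : Module.Dual k (c ⟶ c')), ι c' ξ ≫ desc h hw = h c' ξ
  hom_ext : ∀ {X : B} (f g : pt ⟶ X), (∀ c' ξ, ι c' ξ ≫ f = ι c' ξ ≫ g) → f = g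

/-- The limit `Hom_C(D(C(-, c)), F)` of `F : C ⥤ B` weighted by the left module
`D(C(-, c)) = Hom_k(C(-, c), k)`: maps from `X` correspond to morphisms of left modules
`D(C(-, c)) ⟶ B(X, F -)`. -/
structure DualHom (F : LinFun k C B) (c : C) where
  pt : B
  π : ∀ c' : C, Module.Dual k (c' ⟶ c) →ₗ[k] (pt ⟶ F.obj.obj c')
  w : ∀ {c' c'' : C} (f : c' ⟶ c'') (ξ : Module.Dual k (c' ⟶ c)),
    π c'' (dualPre k f c ξ) = π c' ξ ≫ F.obj.map f
  lift : ∀ {X : B} (h : ∀ c' : C, Module.Dual k (c' ⟶ c) →ₗ[k] (X ⟶ F.obj.obj c'))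
    (_ : ∀ (c' c'' : C) (f : c' ⟶ c'') (ξ : Module.Dual k (c' ⟶ c)),
      h c'' (dualPre k f c ξ) = h c' ξ ≫ F.obj.map f), X ⟶ pt
  fac : ∀ {X : B} (h : ∀ c' : C, Module.Dual k (c' ⟶ c) →ₗ[k] (X ⟶ F.obj.obj c'))
    (hw : ∀ (c' c'' : C) (f : c' ⟶ c'') (ξ : Module.Dual k (c' ⟶ c)),
      h c'' (dualPre k f c ξ) = h c' ξ ≫ F.obj.map f) (c' : C)
    (ξ : Module.Dual k (c' ⟶ c)), lift h hw ≫ π c' ξ = h c' ξ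
  hom_ext : ∀ {X : B} (f g : X ⟶ pt), (∀ c' ξ, f ≫ π c' ξ = g ≫ π c' ξ) → f = g

section

variable {k}
variable {F : LinFun k C B} {c : C} (W : DualTensor k F c) (V : DualHom k F c)

lemma DualTensor.fac_assoc {X Z : B}
    (h : ∀ c' : C, Module.Dual k (c ⟶ c') →ₗ[k] (F.obj.obj c' ⟶ X))
    (hw : ∀ (c' c'' : C) (f : c' ⟶ c'') (ξ : Module.Dual k (c ⟶ c'')),
      h c' (dualPost k f c ξ) = F.obj.map f ≫ h c'' ξ) (c' : C)
    (ξ : Module.Dual k (c ⟶ c')) (g : X ⟶ Z) : W.ι c' ξ ≫ W.desc h hw ≫ g = h c' ξ ≫ g := by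
  rw [← Category.assoc, W.fac]

lemma DualHom.fac_assoc {X : B} (h : ∀ c' : C, Module.Dual k (c' ⟶ c) →ₗ[k] (X ⟶ F.obj.obj c'))
    (hw : ∀ (c' c'' : C) (f : c' ⟶ c'') (ξ : Module.Dual k (c' ⟶ c)),
      h c'' (dualPre k f c ξ) = h c' ξ ≫ F.obj.map f) (c' : C)
    (ξ : Module.Dual k (c' ⟶ c)) {Z : B} (g : F.obj.obj c' ⟶ Z) :
    V.lift h hw ≫ V.π c' ξ ≫ g = h c' ξ ≫ g := by
  rw [← Category.assoc, V.fac]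

end

variable [IsLocallyBounded C] [IsHomFinite k C]

section

variable (F : LinFun k C B) (c : C)

open TensorProduct in
/-- The relations which present the coend `D(C(c, -)) ⊗_C F`. -/
def dualTensorRel :
    (famTensor k (fun p : C × C => Module.Dual k (c ⟶ p.2) ⊗[k] (p.1 ⟶ p.2))
      (fun p => F.obj.obj p.1)).pt ⟶
    (famTensor k (fun c' : C => Module.Dual k (c ⟶ c')) F.obj.obj).pt :=
  FamTensor.desc _ fun p => TensorProduct.lift (LinearMap.mk₂ k
    (fun ξ f => (famTensor k (fun c' : C => Module.Dual k (c ⟶ c')) F.obj.obj).ι p.1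
        (dualPost k f c ξ) -
      F.obj.map f ≫ (famTensor k (fun c' : C => Module.Dual k (c ⟶ c')) F.obj.obj).ι p.2 ξ)
    (fun ξ ξ' f => by simp; abel)
    (fun r ξ f => by simp [smul_sub])
    (fun ξ f f' => by rw [dualPost_add]; simp [Preadditive.add_comp]; abel)
    (fun r ξ f => by rw [dualPost_smul]; simp [smul_sub]))

lemma dualTensorRel_fac {c' c'' : C} (f : c' ⟶ c'') (ξ : Module.Dual k (c ⟶ c'')) :
    (famTensor k (fun p : C × C => TensorProduct k (Module.Dual k (c ⟶ p.2)) (p.1 ⟶ p.2))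
      (fun p => F.obj.obj p.1)).ι (c', c'') (ξ ⊗ₜ f) ≫ dualTensorRel k F c =
    (famTensor k (fun c' : C => Module.Dual k (c ⟶ c')) F.obj.obj).ι c'
        (dualPost k f c ξ) -
      F.obj.map f ≫ (famTensor k (fun c' : C => Module.Dual k (c ⟶ c')) F.obj.obj).ι c'' ξ := by
  rw [dualTensorRel, FamTensor.fac]; simp

/-- Existence of `D(C(c, -)) ⊗_C F`. -/
def dualTensor : DualTensor k F c where
  pt := cokernel (dualTensorRel k F c)
  ι c' := Linear.rightComp k _ (cokernel.π (dualTensorRel k F c)) ∘ₗ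
    (famTensor k (fun c' : C => Module.Dual k (c ⟶ c')) F.obj.obj).ι c'
  w {c' c''} f ξ := by
    have := (famTensor k (fun p : C × C => TensorProduct k (Module.Dual k (c ⟶ p.2)) (p.1 ⟶ p.2))
      (fun p => F.obj.obj p.1)).ι (c', c'') (ξ ⊗ₜ f) ≫= cokernel.condition (dualTensorRel k F c)
    rw [comp_zero, ← Category.assoc, dualTensorRel_fac] at this
    simpa [Preadditive.sub_comp, sub_eq_zero] using this
  desc h hw := cokernel.desc _ (FamTensor.desc _ h) (FamTensor.hom_ext _ _ _ fun p m => by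
    rw [dualTensorRel, ← Category.assoc, FamTensor.fac, comp_zero]
    induction m using TensorProduct.induction_on with
    | zero => simp
    | add x y hx hy => simp [Preadditive.add_comp, hx, hy]
    | tmul ξ f => simp [Preadditive.sub_comp, FamTensor.fac, hw])
  fac h hw c' ξ := by simp [FamTensor.fac]
  hom_ext f g hfg := by
    rw [← cancel_epi (cokernel.π _)]
    refine FamTensor.hom_ext _ _ _ fun c' ξ => ?_
    simpa using hfg c' ξ

open TensorProduct in
/-- The relations which present the end `Hom_C(D(C(-, c)), F)`. -/
def dualHomRel :
    (famCotensor k (fun c' : C => Module.Dual k (c' ⟶ c)) F.obj.obj).pt ⟶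
    (famCotensor k (fun p : C × C => Module.Dual k (p.1 ⟶ c) ⊗[k] (p.1 ⟶ p.2))
      (fun p => F.obj.obj p.2)).pt :=
  FamCotensor.lift _ fun p => TensorProduct.lift (LinearMap.mk₂ k
    (fun ξ f => (famCotensor k (fun c' : C => Module.Dual k (c' ⟶ c)) F.obj.obj).π p.2
        (dualPre k f c ξ) -
      (famCotensor k (fun c' : C => Module.Dual k (c' ⟶ c)) F.obj.obj).π p.1 ξ ≫ F.obj.map f)
    (fun ξ ξ' f => by simp [Preadditive.add_comp]; abel)
    (fun r ξ f => by simp [smul_sub])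
    (fun ξ f f' => by rw [dualPre_add]; simp [Preadditive.comp_add]; abel)
    (fun r ξ f => by rw [dualPre_smul]; simp [smul_sub]))

lemma dualHomRel_fac {c' c'' : C} (f : c' ⟶ c'') (ξ : Module.Dual k (c' ⟶ c)) :
    dualHomRel k F c ≫
      (famCotensor k (fun p : C × C => TensorProduct k (Module.Dual k (p.1 ⟶ c)) (p.1 ⟶ p.2))
        (fun p => F.obj.obj p.2)).π (c', c'') (ξ ⊗ₜ f) =
    (famCotensor k (fun c' : C => Module.Dual k (c' ⟶ c)) F.obj.obj).π c''
        (dualPre k f c ξ) -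
      (famCotensor k (fun c' : C => Module.Dual k (c' ⟶ c)) F.obj.obj).π c' ξ ≫ F.obj.map f := by
  rw [dualHomRel, FamCotensor.fac]; simp

/-- Existence of `Hom_C(D(C(-, c)), F)`. -/
def dualHom : DualHom k F c where
  pt := kernel (dualHomRel k F c)
  π c' := Linear.leftComp k _ (kernel.ι (dualHomRel k F c)) ∘ₗ
    (famCotensor k (fun c' : C => Module.Dual k (c' ⟶ c)) F.obj.obj).π c'
  w {c' c''} f ξ := by
    have := kernel.condition (dualHomRel k F c) =≫
      (famCotensor k (fun p : C × C => TensorProduct k (Module.Dual k (p.1 ⟶ c)) (p.1 ⟶ p.2))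
      (fun p => F.obj.obj p.2)).π (c', c'') (ξ ⊗ₜ f)
    rw [zero_comp, Category.assoc, dualHomRel_fac] at this
    simpa [Preadditive.comp_sub, sub_eq_zero] using this
  lift h hw := kernel.lift _ (FamCotensor.lift _ h) (FamCotensor.hom_ext _ _ _ fun p m => by
    rw [dualHomRel, Category.assoc, FamCotensor.fac, zero_comp]
    induction m using TensorProduct.induction_on with
    | zero => simp
    | add x y hx hy => simp [Preadditive.comp_add, hx, hy]
    | tmul ξ f =>
      simp only [TensorProduct.lift.tmul, LinearMap.mk₂_apply, Preadditive.comp_sub,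
        FamCotensor.fac, hw, ← Category.assoc, sub_self])
  fac h hw c' ξ := by simp [FamCotensor.fac]
  hom_ext f g hfg := by
    rw [← cancel_mono (kernel.ι _)]
    refine FamCotensor.hom_ext _ _ _ fun c' ξ => ?_
    simpa using hfg c' ξ

attribute [irreducible] dualTensor dualHom

end

/-! ### The functors `i^*`, `i_!`, `ν` and `ν⁻` -/

variable (C B) in
/-- The evaluation functor `i^* : B^C ⥤ ∏_c B`. -/
@[simps]
def evalAll : LinFun k C B ⥤ (C → B) where
  obj F := fun c => F.obj.obj c
  map α := fun c => α.hom.app c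

/-- The object `i_!(Y) = ⨁_c C(c, -) ⊗ₖ Y c`. -/
def freeFunObj (Y : C → B) : LinFun k C B where
  obj :=
    { obj := fun c => (famTensor k (fun c' : C => (c' ⟶ c)) Y).pt
      map := fun {c d} f => (famTensor k (fun c' : C => (c' ⟶ c)) Y).desc fun c' =>
        (famTensor k (fun c' : C => (c' ⟶ d)) Y).ι c' ∘ₗ Linear.rightComp k c' f
      map_id := fun c => FamTensor.hom_ext _ _ _ fun c' m => by simp [FamTensor.fac]
      map_comp := fun f g => FamTensor.hom_ext _ _ _ fun c' m => by
        rw [← Category.assoc]; simp [FamTensor.fac] }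
  property :=
    ⟨⟨fun {c d f g} => FamTensor.hom_ext _ _ _ fun c' m => by
        simp [FamTensor.fac]⟩,
     ⟨fun {c d} f r => FamTensor.hom_ext _ _ _ fun c' m => by simp [FamTensor.fac]⟩⟩

/-- The universal family `C(c', c) ⟶ B(Y c', i_!(Y) c)`. -/
def freeι (Y : C → B) (c' c : C) : (c' ⟶ c) →ₗ[k] (Y c' ⟶ (freeFunObj k Y).obj.obj c) :=
  (famTensor k (fun c' : C => (c' ⟶ c)) Y).ι c'

lemma freeι_map (Y : C → B) {c' c d : C} (m : c' ⟶ c) (f : c ⟶ d) :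
    freeι k Y c' c m ≫ (freeFunObj k Y).obj.map f = freeι k Y c' d (m ≫ f) :=
  FamTensor.fac _ _ _ _

lemma free_hom_ext (Y : C → B) {c : C} {X : B} (f g : (freeFunObj k Y).obj.obj c ⟶ X)
    (h : ∀ c' m, freeι k Y c' c m ≫ f = freeι k Y c' c m ≫ g) : f = g :=
  FamTensor.hom_ext _ _ _ h

/-- The map out of `i_!(Y) c` given by a linear family. -/
def freeDesc (Y : C → B) {c : C} {X : B} (h : ∀ c', (c' ⟶ c) →ₗ[k] (Y c' ⟶ X)) :
    (freeFunObj k Y).obj.obj c ⟶ X := FamTensor.desc _ h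

lemma freeι_desc (Y : C → B) {c : C} {X : B} (h : ∀ c', (c' ⟶ c) →ₗ[k] (Y c' ⟶ X))
    (c' : C) (m : c' ⟶ c) : freeι k Y c' c m ≫ freeDesc k Y h = h c' m := FamTensor.fac _ h _ _

lemma freeι_map_assoc (Y : C → B) {c' c d : C} (m : c' ⟶ c) (f : c ⟶ d) {X : B}
    (g : (freeFunObj k Y).obj.obj d ⟶ X) :
    freeι k Y c' c m ≫ (freeFunObj k Y).obj.map f ≫ g = freeι k Y c' d (m ≫ f) ≫ g := by
  rw [← Category.assoc, freeι_map]

lemma freeι_desc_assoc (Y : C → B) {c : C} {X Z : B} (h : ∀ c', (c' ⟶ c) →ₗ[k] (Y c' ⟶ X))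
    (c' : C) (m : c' ⟶ c) (g : X ⟶ Z) :
    freeι k Y c' c m ≫ freeDesc k Y h ≫ g = h c' m ≫ g := by
  rw [← Category.assoc, freeι_desc]

variable (C B) in
/-- The functor `i_! : ∏_c B ⥤ B^C`. -/
def freeFun : (C → B) ⥤ LinFun k C B where
  obj Y := freeFunObj k Y
  map {Y Y'} α := ObjectProperty.homMk
    { app := fun c => freeDesc k Y fun c' =>
        Linear.leftComp k _ (α c') ∘ₗ freeι k Y' c' c
      naturality := fun c d f => free_hom_ext k _ _ _ fun c' m => by
        simp [freeι_desc, freeι_map_assoc, freeι_desc_assoc, freeι_map] }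
  map_id Y := by
    ext c
    exact free_hom_ext k _ _ _ fun c' m => by simp [freeι_desc]
  map_comp α β := by
    ext c
    exact free_hom_ext k _ _ _ fun c' m => by simp [freeι_desc, freeι_desc_assoc]

lemma freeι_freeFun_map {Y Y' : C → B} (α : Y ⟶ Y') {c' c : C} (m : c' ⟶ c) :
    freeι k Y c' c m ≫ ((freeFun k C B).map α).hom.app c = α c' ≫ freeι k Y' c' c m := by
  simp [freeFun, freeι_desc]

/-- The bijection `B^C(i_!(Y), F) ≃ ∏_c B(Y c, F c)`. -/
def freeEquiv (Y : C → B) (F : LinFun k C B) :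
    (freeFunObj k Y ⟶ F) ≃ (∀ c, Y c ⟶ F.obj.obj c) where
  toFun α c := freeι k Y c c (𝟙 c) ≫ α.hom.app c
  invFun β := ObjectProperty.homMk
    { app := fun c => freeDesc k Y fun c' => Linear.leftComp k _ (β c') ∘ₗ F.obj.mapLinearMap k
      naturality := fun c d f => free_hom_ext k _ _ _ fun c' m => by
        simp [freeι_desc, freeι_map_assoc, freeι_desc_assoc] }
  left_inv α := by
    ext c
    refine free_hom_ext k _ _ _ fun c' m => ?_
    simp only [ObjectProperty.homMk_hom, freeι_desc, LinearMap.comp_apply,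
      Functor.coe_mapLinearMap, Linear.leftComp_apply, Category.assoc, ← α.hom.naturality,
      freeι_map_assoc, Category.id_comp]
  right_inv β := by
    funext c
    simp [freeι_desc]

lemma freeι_freeEquiv_symm (Y : C → B) (F : LinFun k C B) (β : ∀ c, Y c ⟶ F.obj.obj c)
    {c' c : C} (m : c' ⟶ c) :
    freeι k Y c' c m ≫ ((freeEquiv k Y F).symm β).hom.app c = β c' ≫ F.obj.map m := by
  simp [freeEquiv, freeι_desc]

variable (C B) in
/-- The adjunction `i_! ⊣ i^*`. -/
def freeAdj : freeFun k C B ⊣ evalAll k C B :=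
  Adjunction.mkOfHomEquiv
    { homEquiv := fun Y F => freeEquiv k Y F
      homEquiv_naturality_left_symm := fun {Y' Y F} f g => by
        ext c
        refine free_hom_ext k _ _ _ fun c' m => ?_
        refine (freeι_freeEquiv_symm k Y' F (fun c => f c ≫ g c) m).trans ?_
        refine Eq.trans ?_ (Category.assoc _ _ _)
        refine Eq.trans ?_ (congrArg (fun t => t ≫ ((freeEquiv k Y F).symm g).hom.app c)
          (freeι_freeFun_map k f m).symm)
        refine Eq.trans ?_ (Category.assoc _ _ _).symm
        refine Eq.trans (Category.assoc _ _ _) ?_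
        exact congrArg (fun t => f c' ≫ t) (freeι_freeEquiv_symm k Y F g m).symm
      homEquiv_naturality_right := fun f g => by
        funext c
        exact (Category.assoc _ _ _).symm }

/-- The structure maps of `ν(F)`. -/
def nuObjMap (F : LinFun k C B) {c d : C} (f : c ⟶ d) :
    (dualTensor k F c).pt ⟶ (dualTensor k F d).pt :=
  (dualTensor k F c).desc (fun c' => (dualTensor k F d).ι c' ∘ₗ dualPre k f c')
    (fun c' c'' g ξ => (congrArg ((dualTensor k F d).ι c') (dualPre_dualPost k f g ξ)).trans
      ((dualTensor k F d).w g (dualPre k f c'' ξ)))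

lemma ι_nuObjMap (F : LinFun k C B) {c d : C} (f : c ⟶ d) (c' : C) (ξ : Module.Dual k (c ⟶ c')) :
    (dualTensor k F c).ι c' ξ ≫ nuObjMap k F f = (dualTensor k F d).ι c' (dualPre k f c' ξ) :=
  by rw [nuObjMap, DualTensor.fac]; rfl

lemma nuObjMap_smul (F : LinFun k C B) {c d : C} (f : c ⟶ d) (r : k) :
    nuObjMap k F (r • f) = r • nuObjMap k F f :=
  DualTensor.hom_ext _ _ _ fun c' ξ => by
    rw [ι_nuObjMap, Linear.comp_smul, ι_nuObjMap, dualPre_smul]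
    exact LinearMap.map_smul _ _ _

lemma nuObjMap_add (F : LinFun k C B) {c d : C} (f g : c ⟶ d) :
    nuObjMap k F (f + g) = nuObjMap k F f + nuObjMap k F g :=
  DualTensor.hom_ext _ _ _ fun c' ξ => by
    rw [ι_nuObjMap, Preadditive.comp_add, ι_nuObjMap, ι_nuObjMap, dualPre_add, map_add]

/-- The object `ν(F) = D(C) ⊗_C F`, `ν(F)(c) = D(C(c, -)) ⊗_C F`. -/
def nuObj (F : LinFun k C B) : LinFun k C B where
  obj :=
    { obj := fun c => (dualTensor k F c).pt
      map := fun {c d} f => nuObjMap k F f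
      map_id := fun c => DualTensor.hom_ext _ _ _ fun c' ξ => by
        rw [ι_nuObjMap, Category.comp_id, dualPre_id]
      map_comp := fun f g => DualTensor.hom_ext _ _ _ fun c' ξ => by
        rw [ι_nuObjMap, ← Category.assoc, ι_nuObjMap, ι_nuObjMap, dualPre_comp] }
  property := ⟨⟨nuObjMap_add k F _ _⟩, ⟨nuObjMap_smul k F⟩⟩

/-- The universal family `D(C(c, c')) ⟶ B(F c', ν(F) c)`. -/
def nuι (F : LinFun k C B) (c' c : C) :
    Module.Dual k (c ⟶ c') →ₗ[k] (F.obj.obj c' ⟶ (nuObj k F).obj.obj c) :=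
  (dualTensor k F c).ι c'

lemma nuι_w (F : LinFun k C B) (c : C) {c' c'' : C} (f : c' ⟶ c'') (ξ : Module.Dual k (c ⟶ c'')) :
    F.obj.map f ≫ nuι k F c'' c ξ = nuι k F c' c (dualPost k f c ξ) :=
  ((dualTensor k F c).w f ξ).symm

lemma nuι_map (F : LinFun k C B) (c' : C) {c d : C} (f : c ⟶ d) (ξ : Module.Dual k (c ⟶ c')) :
    nuι k F c' c ξ ≫ (nuObj k F).obj.map f = nuι k F c' d (dualPre k f c' ξ) :=
  ι_nuObjMap k F f c' ξ

lemma nu_hom_ext (F : LinFun k C B) {c : C} {X : B} (f g : (nuObj k F).obj.obj c ⟶ X)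
    (h : ∀ c' ξ, nuι k F c' c ξ ≫ f = nuι k F c' c ξ ≫ g) : f = g :=
  DualTensor.hom_ext _ _ _ h

/-- The map out of `ν(F) c` given by a natural family. -/
def nuDesc (F : LinFun k C B) {c : C} {X : B}
    (h : ∀ c' : C, Module.Dual k (c ⟶ c') →ₗ[k] (F.obj.obj c' ⟶ X))
    (hw : ∀ (c' c'' : C) (f : c' ⟶ c'') (ξ : Module.Dual k (c ⟶ c'')),
      h c' (dualPost k f c ξ) = F.obj.map f ≫ h c'' ξ) :
    (nuObj k F).obj.obj c ⟶ X := (dualTensor k F c).desc h hw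

lemma nuι_desc (F : LinFun k C B) {c : C} {X : B}
    (h : ∀ c' : C, Module.Dual k (c ⟶ c') →ₗ[k] (F.obj.obj c' ⟶ X))
    (hw : ∀ (c' c'' : C) (f : c' ⟶ c'') (ξ : Module.Dual k (c ⟶ c'')),
      h c' (dualPost k f c ξ) = F.obj.map f ≫ h c'' ξ) (c' : C) (ξ : Module.Dual k (c ⟶ c')) :
    nuι k F c' c ξ ≫ nuDesc k F h hw = h c' ξ := (dualTensor k F c).fac h hw c' ξ

lemma nuι_map_assoc (F : LinFun k C B) (c' : C) {c d : C} (f : c ⟶ d)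
    (ξ : Module.Dual k (c ⟶ c')) {X : B} (g : (nuObj k F).obj.obj d ⟶ X) :
    nuι k F c' c ξ ≫ (nuObj k F).obj.map f ≫ g = nuι k F c' d (dualPre k f c' ξ) ≫ g := by
  rw [← Category.assoc, nuι_map]

lemma nuι_desc_assoc (F : LinFun k C B) {c : C} {X Z : B}
    (h : ∀ c' : C, Module.Dual k (c ⟶ c') →ₗ[k] (F.obj.obj c' ⟶ X))
    (hw : ∀ (c' c'' : C) (f : c' ⟶ c'') (ξ : Module.Dual k (c ⟶ c'')),
      h c' (dualPost k f c ξ) = F.obj.map f ≫ h c'' ξ) (c' : C) (ξ : Module.Dual k (c ⟶ c'))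
    (g : X ⟶ Z) :
    nuι k F c' c ξ ≫ nuDesc k F h hw ≫ g = h c' ξ ≫ g := by
  rw [← Category.assoc, nuι_desc]

/-- `ν` on morphisms. -/
def nuMap {F G : LinFun k C B} (α : F ⟶ G) : nuObj k F ⟶ nuObj k G :=
  ObjectProperty.homMk
    { app := fun c => nuDesc k F
        (fun c' => Linear.leftComp k _ (α.hom.app c') ∘ₗ nuι k G c' c)
        (fun c' c'' f ξ => by
          simp only [LinearMap.comp_apply, Linear.leftComp_apply]
          rw [← nuι_w, ← Category.assoc, ← Category.assoc, α.hom.naturality])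
      naturality := fun c d f => nu_hom_ext k _ _ _ fun c' ξ => by
        rw [nuι_map_assoc, nuι_desc, nuι_desc_assoc]
        simp only [LinearMap.comp_apply, Linear.leftComp_apply, Category.assoc, nuι_map] }

lemma nuι_nuMap {F G : LinFun k C B} (α : F ⟶ G) {c' c : C} (ξ : Module.Dual k (c ⟶ c')) :
    nuι k F c' c ξ ≫ (nuMap k α).hom.app c = α.hom.app c' ≫ nuι k G c' c ξ := by
  rw [nuMap, ObjectProperty.homMk_hom, nuι_desc]; rfl

lemma nuι_nuMap_assoc {F G : LinFun k C B} (α : F ⟶ G) {c' c : C} (ξ : Module.Dual k (c ⟶ c'))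
    {X : B} (g : (nuObj k G).obj.obj c ⟶ X) :
    nuι k F c' c ξ ≫ (nuMap k α).hom.app c ≫ g = α.hom.app c' ≫ nuι k G c' c ξ ≫ g := by
  rw [← Category.assoc, nuι_nuMap, Category.assoc]

variable (C B) in
/-- The functor `ν = D(C) ⊗_C - : B^C ⥤ B^C`. -/
def nuFunctor : LinFun k C B ⥤ LinFun k C B where
  obj F := nuObj k F
  map α := nuMap k α
  map_id F := by
    ext c
    refine nu_hom_ext k _ _ _ fun c' ξ => ?_
    rw [nuι_nuMap]; simp
  map_comp α β := by
    ext c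
    refine nu_hom_ext k _ _ _ fun c' ξ => ?_
    rw [nuι_nuMap, ObjectProperty.FullSubcategory.comp_hom, ObjectProperty.FullSubcategory.comp_hom,
      NatTrans.comp_app, NatTrans.comp_app, nuι_nuMap_assoc, nuι_nuMap, Category.assoc]

/-- The structure maps of `ν⁻(F)`. -/
def nuMinusObjMap (F : LinFun k C B) {c d : C} (f : c ⟶ d) :
    (dualHom k F c).pt ⟶ (dualHom k F d).pt :=
  (dualHom k F d).lift (fun c' => (dualHom k F c).π c' ∘ₗ dualPost k f c')
    (fun c' c'' g ξ => (congrArg ((dualHom k F c).π c'') (dualPre_dualPost k g f ξ).symm).trans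
      ((dualHom k F c).w g (dualPost k f c' ξ)))

lemma nuMinusObjMap_π (F : LinFun k C B) {c d : C} (f : c ⟶ d) (c' : C)
    (ξ : Module.Dual k (c' ⟶ d)) :
    nuMinusObjMap k F f ≫ (dualHom k F d).π c' ξ = (dualHom k F c).π c' (dualPost k f c' ξ) :=
  by rw [nuMinusObjMap, DualHom.fac]; rfl

lemma nuMinusObjMap_smul (F : LinFun k C B) {c d : C} (f : c ⟶ d) (r : k) :
    nuMinusObjMap k F (r • f) = r • nuMinusObjMap k F f :=
  DualHom.hom_ext _ _ _ fun c' ξ => by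
    rw [nuMinusObjMap_π, Linear.smul_comp, nuMinusObjMap_π, dualPost_smul]
    exact LinearMap.map_smul _ _ _

lemma nuMinusObjMap_add (F : LinFun k C B) {c d : C} (f g : c ⟶ d) :
    nuMinusObjMap k F (f + g) = nuMinusObjMap k F f + nuMinusObjMap k F g :=
  DualHom.hom_ext _ _ _ fun c' ξ => by
    rw [nuMinusObjMap_π, Preadditive.add_comp, nuMinusObjMap_π, nuMinusObjMap_π, dualPost_add,
      map_add]

/-- The object `ν⁻(F) = Hom_C(D(C), F)`, `ν⁻(F)(c) = Hom_C(D(C(-, c)), F)`. -/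
def nuMinusObj (F : LinFun k C B) : LinFun k C B where
  obj :=
    { obj := fun c => (dualHom k F c).pt
      map := fun {c d} f => nuMinusObjMap k F f
      map_id := fun c => DualHom.hom_ext _ _ _ fun c' ξ => by
        rw [nuMinusObjMap_π, Category.id_comp, dualPost_id]
      map_comp := fun f g => DualHom.hom_ext _ _ _ fun c' ξ => by
        rw [nuMinusObjMap_π, Category.assoc, nuMinusObjMap_π, nuMinusObjMap_π, dualPost_comp] }
  property := ⟨⟨nuMinusObjMap_add k F _ _⟩, ⟨nuMinusObjMap_smul k F⟩⟩

/-- The universal family `D(C(c', c)) ⟶ B(ν⁻(F) c, F c')`. -/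
def nuMinusπ (F : LinFun k C B) (c c' : C) :
    Module.Dual k (c' ⟶ c) →ₗ[k] ((nuMinusObj k F).obj.obj c ⟶ F.obj.obj c') :=
  (dualHom k F c).π c'

lemma nuMinusπ_w (F : LinFun k C B) (c : C) {c' c'' : C} (f : c' ⟶ c'')
    (ξ : Module.Dual k (c' ⟶ c)) :
    nuMinusπ k F c c' ξ ≫ F.obj.map f = nuMinusπ k F c c'' (dualPre k f c ξ) :=
  ((dualHom k F c).w f ξ).symm

lemma map_nuMinusπ (F : LinFun k C B) (c' : C) {c d : C} (f : c ⟶ d)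
    (ξ : Module.Dual k (c' ⟶ d)) :
    (nuMinusObj k F).obj.map f ≫ nuMinusπ k F d c' ξ = nuMinusπ k F c c' (dualPost k f c' ξ) :=
  nuMinusObjMap_π k F f c' ξ

lemma nuMinus_hom_ext (F : LinFun k C B) {c : C} {X : B} (f g : X ⟶ (nuMinusObj k F).obj.obj c)
    (h : ∀ c' ξ, f ≫ nuMinusπ k F c c' ξ = g ≫ nuMinusπ k F c c' ξ) : f = g :=
  DualHom.hom_ext _ _ _ h

/-- The map to `ν⁻(F) c` given by a natural family. -/
def nuMinusLift (F : LinFun k C B) {c : C} {X : B}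
    (h : ∀ c' : C, Module.Dual k (c' ⟶ c) →ₗ[k] (X ⟶ F.obj.obj c'))
    (hw : ∀ (c' c'' : C) (f : c' ⟶ c'') (ξ : Module.Dual k (c' ⟶ c)),
      h c'' (dualPre k f c ξ) = h c' ξ ≫ F.obj.map f) :
    X ⟶ (nuMinusObj k F).obj.obj c := (dualHom k F c).lift h hw

lemma nuMinusLift_π (F : LinFun k C B) {c : C} {X : B}
    (h : ∀ c' : C, Module.Dual k (c' ⟶ c) →ₗ[k] (X ⟶ F.obj.obj c'))
    (hw : ∀ (c' c'' : C) (f : c' ⟶ c'') (ξ : Module.Dual k (c' ⟶ c)),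
      h c'' (dualPre k f c ξ) = h c' ξ ≫ F.obj.map f) (c' : C) (ξ : Module.Dual k (c' ⟶ c)) :
    nuMinusLift k F h hw ≫ nuMinusπ k F c c' ξ = h c' ξ := (dualHom k F c).fac h hw c' ξ

lemma nuMinusLift_π_assoc (F : LinFun k C B) {c : C} {X : B}
    (h : ∀ c' : C, Module.Dual k (c' ⟶ c) →ₗ[k] (X ⟶ F.obj.obj c'))
    (hw : ∀ (c' c'' : C) (f : c' ⟶ c'') (ξ : Module.Dual k (c' ⟶ c)),
      h c'' (dualPre k f c ξ) = h c' ξ ≫ F.obj.map f) (c' : C) (ξ : Module.Dual k (c' ⟶ c))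
    {Z : B} (g : F.obj.obj c' ⟶ Z) :
    nuMinusLift k F h hw ≫ nuMinusπ k F c c' ξ ≫ g = h c' ξ ≫ g := by
  rw [← Category.assoc, nuMinusLift_π]

lemma map_nuMinusπ_assoc (F : LinFun k C B) (c' : C) {c d : C} (f : c ⟶ d)
    (ξ : Module.Dual k (c' ⟶ d)) {X : B} (g : F.obj.obj c' ⟶ X) :
    (nuMinusObj k F).obj.map f ≫ nuMinusπ k F d c' ξ ≫ g =
      nuMinusπ k F c c' (dualPost k f c' ξ) ≫ g := by
  rw [← Category.assoc, map_nuMinusπ]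

/-- `ν⁻` on morphisms. -/
def nuMinusMap {F G : LinFun k C B} (α : F ⟶ G) : nuMinusObj k F ⟶ nuMinusObj k G :=
  ObjectProperty.homMk
    { app := fun c => nuMinusLift k G
        (fun c' => Linear.rightComp k _ (α.hom.app c') ∘ₗ nuMinusπ k F c c')
        (fun c' c'' f ξ => by
          simp only [LinearMap.comp_apply, Linear.rightComp_apply]
          rw [← nuMinusπ_w, Category.assoc, Category.assoc, α.hom.naturality])
      naturality := fun c d f => nuMinus_hom_ext k _ _ _ fun c' ξ => by
        rw [Category.assoc, Category.assoc, nuMinusLift_π, map_nuMinusπ, nuMinusLift_π]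
        simp only [LinearMap.comp_apply, Linear.rightComp_apply, map_nuMinusπ_assoc] }

lemma nuMinusMap_π {F G : LinFun k C B} (α : F ⟶ G) {c' c : C} (ξ : Module.Dual k (c' ⟶ c)) :
    (nuMinusMap k α).hom.app c ≫ nuMinusπ k G c c' ξ = nuMinusπ k F c c' ξ ≫ α.hom.app c' := by
  rw [nuMinusMap, ObjectProperty.homMk_hom, nuMinusLift_π]; rfl

lemma nuMinusMap_π_assoc {F G : LinFun k C B} (α : F ⟶ G) {c' c : C}
    (ξ : Module.Dual k (c' ⟶ c)) {X : B} (g : G.obj.obj c' ⟶ X) :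
    (nuMinusMap k α).hom.app c ≫ nuMinusπ k G c c' ξ ≫ g =
      nuMinusπ k F c c' ξ ≫ α.hom.app c' ≫ g := by
  rw [← Category.assoc, nuMinusMap_π, Category.assoc]

variable (C B) in
/-- The functor `ν⁻ = Hom_C(D(C), -) : B^C ⥤ B^C`. -/
def nuMinusFunctor : LinFun k C B ⥤ LinFun k C B where
  obj F := nuMinusObj k F
  map α := nuMinusMap k α
  map_id F := by
    ext c
    refine nuMinus_hom_ext k _ _ _ fun c' ξ => ?_
    rw [nuMinusMap_π]; simp
  map_comp α β := by
    ext c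
    refine nuMinus_hom_ext k _ _ _ fun c' ξ => ?_
    rw [nuMinusMap_π, ObjectProperty.FullSubcategory.comp_hom, ObjectProperty.FullSubcategory.comp_hom,
      NatTrans.comp_app, NatTrans.comp_app, Category.assoc, nuMinusMap_π, nuMinusMap_π_assoc]

instance : (nuFunctor k C B).Additive where
  map_add {F G α β} := by
    ext c
    refine nu_hom_ext k _ _ _ fun c' ξ => ?_
    change _ ≫ (nuMap k (α + β)).hom.app c =
      _ ≫ ((nuMap k α).hom.app c + (nuMap k β).hom.app c)
    rw [Preadditive.comp_add, nuι_nuMap, nuι_nuMap, nuι_nuMap]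
    exact Preadditive.add_comp _ _ _ _ _ _

instance : (nuMinusFunctor k C B).Additive where
  map_add {F G α β} := by
    ext c
    refine nuMinus_hom_ext k _ _ _ fun c' ξ => ?_
    change (nuMinusMap k (α + β)).hom.app c ≫ _ =
      ((nuMinusMap k α).hom.app c + (nuMinusMap k β).hom.app c) ≫ _
    rw [Preadditive.add_comp, nuMinusMap_π, nuMinusMap_π, nuMinusMap_π]
    exact Preadditive.comp_add _ _ _ _ _ _

/-- The bijection `B^C(ν F, G) ≃ B^C(F, ν⁻ G)`. -/
def nuEquiv (F G : LinFun k C B) : (nuObj k F ⟶ G) ≃ (F ⟶ nuMinusObj k G) where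
  toFun α := ObjectProperty.homMk
    { app := fun c => nuMinusLift k G
        (fun c' => Linear.rightComp k _ (α.hom.app c') ∘ₗ nuι k F c c')
        (fun c' c'' f ξ => by
          simp only [LinearMap.comp_apply, Linear.rightComp_apply]
          rw [Category.assoc, ← α.hom.naturality, nuι_map_assoc])
      naturality := fun c d f => nuMinus_hom_ext k _ _ _ fun c' ξ => by
        rw [Category.assoc, Category.assoc, nuMinusLift_π, map_nuMinusπ, nuMinusLift_π]
        simp only [LinearMap.comp_apply, Linear.rightComp_apply]
        rw [← Category.assoc, nuι_w] }
  invFun β := ObjectProperty.homMk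
    { app := fun c => nuDesc k F
        (fun c' => Linear.leftComp k _ (β.hom.app c') ∘ₗ nuMinusπ k G c' c)
        (fun c' c'' f ξ => by
          simp only [LinearMap.comp_apply, Linear.leftComp_apply]
          rw [← Category.assoc, β.hom.naturality, Category.assoc, map_nuMinusπ])
      naturality := fun c d f => nu_hom_ext k _ _ _ fun c' ξ => by
        rw [nuι_map_assoc, nuι_desc, nuι_desc_assoc]
        simp only [LinearMap.comp_apply, Linear.leftComp_apply]
        rw [Category.assoc, nuMinusπ_w] }
  left_inv α := by
    ext c
    refine nu_hom_ext k _ _ _ fun c' ξ => ?_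
    rw [ObjectProperty.homMk_hom, nuι_desc]
    simp only [LinearMap.comp_apply, Linear.leftComp_apply, ObjectProperty.homMk_hom]
    rw [nuMinusLift_π]
    rfl
  right_inv β := by
    ext c
    refine nuMinus_hom_ext k _ _ _ fun c' ξ => ?_
    rw [ObjectProperty.homMk_hom, nuMinusLift_π]
    simp only [LinearMap.comp_apply, Linear.rightComp_apply, ObjectProperty.homMk_hom]
    rw [nuι_desc]
    rfl

lemma nuEquiv_π {F G : LinFun k C B} (α : nuObj k F ⟶ G) {c c' : C}
    (ξ : Module.Dual k (c' ⟶ c)) :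
    (nuEquiv k F G α).hom.app c ≫ nuMinusπ k G c c' ξ = nuι k F c c' ξ ≫ α.hom.app c' := by
  rw [nuEquiv, Equiv.coe_fn_mk, ObjectProperty.homMk_hom, nuMinusLift_π]; rfl

lemma nuι_nuEquiv_symm {F G : LinFun k C B} (β : F ⟶ nuMinusObj k G) {c c' : C}
    (ξ : Module.Dual k (c' ⟶ c)) :
    nuι k F c c' ξ ≫ ((nuEquiv k F G).symm β).hom.app c' =
      β.hom.app c ≫ nuMinusπ k G c c' ξ := by
  rw [nuEquiv, Equiv.coe_fn_symm_mk, ObjectProperty.homMk_hom, nuι_desc]; rfl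

lemma nuEquiv_symm_comp {F' F G : LinFun k C B} (f : F' ⟶ F) (g : F ⟶ nuMinusObj k G) :
    (nuEquiv k F' G).symm (f ≫ g) = nuMap k f ≫ (nuEquiv k F G).symm g := by
  ext c
  refine nu_hom_ext k _ _ _ fun c' ξ => ?_
  rw [nuι_nuEquiv_symm, ObjectProperty.FullSubcategory.comp_hom, NatTrans.comp_app,
    ObjectProperty.FullSubcategory.comp_hom, NatTrans.comp_app, nuι_nuMap_assoc,
    nuι_nuEquiv_symm, Category.assoc]

lemma nuEquiv_comp {F G G' : LinFun k C B} (f : nuObj k F ⟶ G) (g : G ⟶ G') :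
    nuEquiv k F G' (f ≫ g) = nuEquiv k F G f ≫ nuMinusMap k g := by
  ext c
  refine nuMinus_hom_ext k _ _ _ fun c' ξ => ?_
  rw [nuEquiv_π, ObjectProperty.FullSubcategory.comp_hom, NatTrans.comp_app,
    ObjectProperty.FullSubcategory.comp_hom, NatTrans.comp_app, Category.assoc, nuMinusMap_π,
    ← Category.assoc, ← Category.assoc, nuEquiv_π]

variable (C B) in
/-- The adjunction `ν ⊣ ν⁻`. -/
def nuAdjunction : nuFunctor k C B ⊣ nuMinusFunctor k C B :=
  Adjunction.mkOfHomEquiv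
    { homEquiv := fun F G => nuEquiv k F G
      homEquiv_naturality_left_symm := fun f g => nuEquiv_symm_comp k f g
      homEquiv_naturality_right := fun f g => nuEquiv_comp k f g }

/-! ### `ν ∘ i_!` is right adjoint to `i^*` -/

section

variable (Y : C → B)

open Classical in
/-- The map `i_!(Y) c' ⟶ Y c` induced by a functional on `C(c, c')`. -/
def freeProj (c c' : C) : Module.Dual k (c ⟶ c') →ₗ[k] ((freeFunObj k Y).obj.obj c' ⟶ Y c) where
  toFun φ := freeDesc k Y fun c₀ =>
    if h : c₀ = c then (φ ∘ₗ Linear.leftComp k c' (eqToHom h.symm)).smulRight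
      (eqToHom (congrArg Y h)) else 0
  map_add' φ ψ := free_hom_ext k _ _ _ fun c₀ m => by
    rw [Preadditive.comp_add, freeι_desc, freeι_desc, freeι_desc]
    split_ifs <;> simp [add_smul]
  map_smul' r φ := free_hom_ext k _ _ _ fun c₀ m => by
    rw [RingHom.id_apply, Linear.comp_smul, freeι_desc, freeι_desc]
    split_ifs <;> simp [mul_smul]

lemma freeι_proj (c c' : C) (φ : Module.Dual k (c ⟶ c')) (m : c ⟶ c') :
    freeι k Y c c' m ≫ freeProj k Y c c' φ = φ m • 𝟙 (Y c) := by
  change freeι k Y c c' m ≫ freeDesc k Y _ = _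
  rw [freeι_desc, dif_pos rfl]
  simp

lemma freeι_proj_ne {c₀ c : C} (h : c₀ ≠ c) (c' : C) (φ : Module.Dual k (c ⟶ c')) (m : c₀ ⟶ c') :
    freeι k Y c₀ c' m ≫ freeProj k Y c c' φ = 0 := by
  change freeι k Y c₀ c' m ≫ freeDesc k Y _ = _
  rw [freeι_desc, dif_neg h]
  simp

lemma map_freeProj (c : C) {c' c'' : C} (f : c' ⟶ c'') (φ : Module.Dual k (c ⟶ c'')) :
    (freeFunObj k Y).obj.map f ≫ freeProj k Y c c'' φ = freeProj k Y c c' (dualPost k f c φ) :=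
  free_hom_ext k _ _ _ fun c₀ m => by
    rw [freeι_map_assoc]
    by_cases h : c₀ = c
    · subst h
      rw [freeι_proj, freeι_proj, dualPost_apply]
    · rw [freeι_proj_ne k Y h, freeι_proj_ne k Y h]

lemma freeProj_natural {Y Y' : C → B} (α : Y ⟶ Y') (c c' : C) (φ : Module.Dual k (c ⟶ c')) :
    ((freeFun k C B).map α).hom.app c' ≫ freeProj k Y' c c' φ = freeProj k Y c c' φ ≫ α c :=
  free_hom_ext k _ _ _ fun c₀ m => by
    refine Eq.trans (Category.assoc _ _ _).symm ?_
    refine (congrArg (fun t => t ≫ freeProj k Y' c c' φ) (freeι_freeFun_map k α m)).trans ?_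
    refine (Category.assoc _ _ _).trans ?_
    refine Eq.trans ?_ (Category.assoc _ _ _)
    by_cases h : c₀ = c
    · subst h
      refine (congrArg (fun t => α c₀ ≫ t) (freeι_proj k Y' c₀ c' φ m)).trans ?_
      refine Eq.trans ?_ (congrArg (fun t => t ≫ α c₀) (freeι_proj k Y c₀ c' φ m).symm)
      exact (Linear.comp_smul _ _ _ _ _ _).trans (((congrArg (fun t => φ m • t)
        ((Category.comp_id _).trans (Category.id_comp _).symm))).trans
          (Linear.smul_comp _ _ _ _ _ _).symm)
    · refine (congrArg (fun t => α c₀ ≫ t) (freeι_proj_ne k Y' h c' φ m)).trans ?_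
      refine Eq.trans ?_ (congrArg (fun t => t ≫ α c) (freeι_proj_ne k Y h c' φ m).symm)
      exact comp_zero.trans zero_comp.symm

/-- The universal family `C(c, c') ⟶ B(ν(i_!(Y)) c, Y c')`. -/
def starEv (c c' : C) : (c ⟶ c') →ₗ[k] ((nuObj k (freeFunObj k Y)).obj.obj c ⟶ Y c') where
  toFun m := nuDesc k _ (fun c'' => freeProj k Y c' c'' ∘ₗ dualPre k m c'')
    (fun c₁ c₂ f ξ => by
      rw [LinearMap.comp_apply, LinearMap.comp_apply, map_freeProj, dualPre_dualPost])
  map_add' m m' := nu_hom_ext k _ _ _ fun c'' ξ => by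
    rw [Preadditive.comp_add, nuι_desc, nuι_desc, nuι_desc, LinearMap.comp_apply,
      LinearMap.comp_apply, LinearMap.comp_apply, dualPre_add, map_add]
  map_smul' r m := nu_hom_ext k _ _ _ fun c'' ξ => by
    rw [RingHom.id_apply, Linear.comp_smul, nuι_desc, nuι_desc, LinearMap.comp_apply,
      LinearMap.comp_apply, dualPre_smul, LinearMap.map_smul]

lemma nuι_starEv {c c' : C} (m : c ⟶ c') (c'' : C) (ξ : Module.Dual k (c ⟶ c'')) :
    nuι k (freeFunObj k Y) c'' c ξ ≫ starEv k Y c c' m =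
      freeProj k Y c' c'' (dualPre k m c'' ξ) :=
  nuι_desc k _ _ _ _ _

lemma map_starEv {c d c' : C} (f : c ⟶ d) (m : d ⟶ c') :
    (nuObj k (freeFunObj k Y)).obj.map f ≫ starEv k Y d c' m = starEv k Y c c' (f ≫ m) :=
  nu_hom_ext k _ _ _ fun c'' ξ => by
    rw [nuι_map_assoc, nuι_starEv, nuι_starEv, dualPre_comp]

/-- The family `D(C(c, c')) ⟶ B(Y c', ν(i_!(Y)) c)`. -/
def starCoev (c c' : C) :
    Module.Dual k (c ⟶ c') →ₗ[k] (Y c' ⟶ (nuObj k (freeFunObj k Y)).obj.obj c) :=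
  Linear.leftComp k _ (freeι k Y c' c' (𝟙 c')) ∘ₗ nuι k (freeFunObj k Y) c' c

lemma freeι_nuι {c₀ c' : C} (m : c₀ ⟶ c') (c : C) (ξ : Module.Dual k (c ⟶ c')) :
    freeι k Y c₀ c' m ≫ nuι k (freeFunObj k Y) c' c ξ = starCoev k Y c c₀ (dualPost k m c ξ) := by
  rw [starCoev, LinearMap.comp_apply, Linear.leftComp_apply, ← nuι_w, freeι_map_assoc,
    Category.id_comp]

lemma star_hom_ext {c : C} {X : B} (f g : (nuObj k (freeFunObj k Y)).obj.obj c ⟶ X)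
    (h : ∀ c' ξ, starCoev k Y c c' ξ ≫ f = starCoev k Y c c' ξ ≫ g) : f = g :=
  nu_hom_ext k _ _ _ fun c' ξ => free_hom_ext k _ _ _ fun c₀ m => by
    rw [← Category.assoc, ← Category.assoc, freeι_nuι, h]

lemma starCoev_ev {c c' : C} (ξ : Module.Dual k (c ⟶ c')) (m : c ⟶ c') :
    starCoev k Y c c' ξ ≫ starEv k Y c c' m = ξ m • 𝟙 _ := by
  rw [starCoev, LinearMap.comp_apply, Linear.leftComp_apply, Category.assoc, nuι_starEv,
    freeι_proj, dualPre_apply, Category.comp_id]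

lemma starCoev_ev_ne {c c₀ c' : C} (h : c₀ ≠ c') (ξ : Module.Dual k (c ⟶ c₀)) (m : c ⟶ c') :
    starCoev k Y c c₀ ξ ≫ starEv k Y c c' m = 0 := by
  rw [starCoev, LinearMap.comp_apply, Linear.leftComp_apply, Category.assoc, nuι_starEv,
    freeι_proj_ne k Y h]

instance finite_out' (c : C) : Finite {c' : C // Nontrivial (c ⟶ c')} :=
  IsLocallyBounded.finite_out c

instance fintype_out (c : C) : Fintype {c' : C // Nontrivial (c ⟶ c')} := Fintype.ofFinite _
instance fintype_in (c : C) : Fintype {c' : C // Nontrivial (c' ⟶ c)} := Fintype.ofFinite _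

/-- The map `X ⟶ ν(i_!(Y)) c` given by a family `C(c, c') ⟶ B(X, Y c')`. -/
def starLift {c : C} {X : B} (h : ∀ c', (c ⟶ c') →ₗ[k] (X ⟶ Y c')) :
    X ⟶ (nuObj k (freeFunObj k Y)).obj.obj c :=
  ∑ c' : {c' : C // Nontrivial (c ⟶ c')}, ∑ a : Fin (finDualBasis k (c ⟶ c'.1)).n,
    h c'.1 ((finDualBasis k (c ⟶ c'.1)).x a) ≫
      starCoev k Y c c'.1 ((finDualBasis k (c ⟶ c'.1)).ξ a)

lemma starLift_ev {c : C} {X : B} (h : ∀ c', (c ⟶ c') →ₗ[k] (X ⟶ Y c')) {c' : C} (m : c ⟶ c') :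
    starLift k Y h ≫ starEv k Y c c' m = h c' m := by
  by_cases hc : Nontrivial (c ⟶ c')
  · rw [starLift, Preadditive.sum_comp, Finset.sum_eq_single ⟨c', hc⟩]
    · rw [Preadditive.sum_comp]
      conv_rhs => rw [← (finDualBasis k (c ⟶ c')).sum_eq m]
      simp only [Category.assoc, starCoev_ev, Linear.comp_smul, Category.comp_id, map_sum,
        map_smul]
    · rintro ⟨b, hb⟩ - hne
      rw [Preadditive.sum_comp]
      refine Finset.sum_eq_zero fun a _ => ?_
      rw [Category.assoc, starCoev_ev_ne k Y (fun h => hne (Subtype.ext h)), comp_zero]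
    · intro h; exact absurd (Finset.mem_univ _) h
  · have := not_nontrivial_iff_subsingleton.1 hc
    rw [Subsingleton.elim m 0]; simp

lemma starLift_starEv (c : C) : starLift k Y (starEv k Y c) = 𝟙 _ :=
  star_hom_ext k Y _ _ fun c' ξ => by
    rw [Category.comp_id]
    by_cases hc : Nontrivial (c ⟶ c')
    · rw [starLift, Preadditive.comp_sum, Finset.sum_eq_single ⟨c', hc⟩]
      · rw [Preadditive.comp_sum]
        conv_rhs => rw [← (finDualBasis k (c ⟶ c')).dual_sum_eq ξ, map_sum]
        refine Finset.sum_congr rfl fun a _ => ?_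
        rw [← Category.assoc, starCoev_ev, Linear.smul_comp, Category.id_comp,
          LinearMap.map_smul]
      · rintro ⟨b, hb⟩ - hne
        rw [Preadditive.comp_sum]
        refine Finset.sum_eq_zero fun a _ => ?_
        rw [← Category.assoc, starCoev_ev_ne k Y (fun h => hne (Subtype.ext h.symm)), zero_comp]
      · intro h; exact absurd (Finset.mem_univ _) h
    · have := not_nontrivial_iff_subsingleton.1 hc
      rw [Subsingleton.elim ξ 0]; simp

lemma star_hom_ext' {c : C} {X : B} (f g : X ⟶ (nuObj k (freeFunObj k Y)).obj.obj c)
    (h : ∀ c' m, f ≫ starEv k Y c c' m = g ≫ starEv k Y c c' m) : f = g := by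
  rw [← Category.comp_id f, ← Category.comp_id g, ← starLift_starEv, starLift]
  simp only [Preadditive.comp_sum, ← Category.assoc, h]

end

/-- The bijection `∏_c B(G c, Y c) ≃ B^C(G, ν(i_!(Y)))`. -/
def starEquiv (G : LinFun k C B) (Y : C → B) :
    (∀ c, G.obj.obj c ⟶ Y c) ≃ (G ⟶ nuObj k (freeFunObj k Y)) where
  toFun β := ObjectProperty.homMk
    { app := fun c => starLift k Y fun c' => Linear.rightComp k _ (β c') ∘ₗ G.obj.mapLinearMap k
      naturality := fun c d f => star_hom_ext' k Y _ _ fun c' m => by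
        rw [Category.assoc, Category.assoc, map_starEv, starLift_ev, starLift_ev]
        simp }
  invFun α c := α.hom.app c ≫ starEv k Y c c (𝟙 c)
  left_inv β := by
    funext c
    change starLift k Y (fun c' => Linear.rightComp k _ (β c') ∘ₗ G.obj.mapLinearMap k) ≫
      starEv k Y c c (𝟙 c) = β c
    rw [starLift_ev]
    simp
  right_inv α := by
    ext c
    refine star_hom_ext' k Y _ _ fun c' m => ?_
    rw [ObjectProperty.homMk_hom, starLift_ev]
    have := α.hom.naturality m
    simp only [LinearMap.comp_apply, Linear.rightComp_apply, Functor.coe_mapLinearMap]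
    rw [← Category.assoc, this, Category.assoc, map_starEv, Category.comp_id]

lemma starEquiv_ev {G : LinFun k C B} {Y : C → B} (β : ∀ c, G.obj.obj c ⟶ Y c) {c c' : C}
    (m : c ⟶ c') :
    (starEquiv k G Y β).hom.app c ≫ starEv k Y c c' m = G.obj.map m ≫ β c' := by
  rw [starEquiv, Equiv.coe_fn_mk, ObjectProperty.homMk_hom, starLift_ev]
  simp

lemma starEv_natural {Y Y' : C → B} (α : Y ⟶ Y') (c c' : C) (m : c ⟶ c') :
    (nuMap k ((freeFun k C B).map α)).hom.app c ≫ starEv k Y' c c' m = starEv k Y c c' m ≫ α c' :=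
  nu_hom_ext k (freeFunObj k Y) _ _ fun c'' ξ => by
    refine (nuι_nuMap_assoc k ((freeFun k C B).map α) ξ _).trans ?_
    refine (congrArg (fun t => ((freeFun k C B).map α).hom.app c'' ≫ t)
      (nuι_starEv k Y' m c'' ξ)).trans ?_
    refine (freeProj_natural k α _ _ _).trans ?_
    rw [← nuι_starEv, Category.assoc]

variable (C B) in
/-- The adjunction `i^* ⊣ ν ∘ i_!`. -/
def starAdjunction : evalAll k C B ⊣ freeFun k C B ⋙ nuFunctor k C B :=
  Adjunction.mkOfHomEquiv
    { homEquiv := fun G Y => starEquiv k G Y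
      homEquiv_naturality_left_symm := fun f g => by
        funext c
        exact Category.assoc _ _ _
      homEquiv_naturality_right := fun {G Y Y'} f g => by
        ext c
        refine star_hom_ext' k Y' _ _ fun c' m => ?_
        refine (starEquiv_ev k (fun c => f c ≫ g c) m).trans ?_
        refine Eq.trans ?_ (Category.assoc _ _ _).symm
        refine Eq.trans ?_ (congrArg (fun t => (starEquiv k G Y f).hom.app c ≫ t)
          (starEv_natural k g c c' m).symm)
        refine Eq.trans ?_ (Category.assoc _ _ _)
        refine Eq.trans ?_ (congrArg (fun t => t ≫ g c') (starEquiv_ev k f m).symm)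
        exact (Category.assoc _ _ _).symm }

/-! ### The unit of `ν ⊣ ν⁻` on the image of `i_!` -/

section

variable (Y : C → B)

/-- The inverse of the unit `i_!(Y) ⟶ ν⁻ν i_!(Y)` at `c`. -/
def unitInv (c : C) :
    (nuMinusObj k (nuObj k (freeFunObj k Y))).obj.obj c ⟶ (freeFunObj k Y).obj.obj c :=
  ∑ c' : {c' : C // Nontrivial (c' ⟶ c)}, ∑ a : Fin (finDualBasis k (c'.1 ⟶ c)).n,
    nuMinusπ k (nuObj k (freeFunObj k Y)) c c'.1 ((finDualBasis k (c'.1 ⟶ c)).ξ a) ≫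
      starEv k Y c'.1 c'.1 (𝟙 _) ≫ freeι k Y c'.1 c ((finDualBasis k (c'.1 ⟶ c)).x a)

/-- The unit `F ⟶ ν⁻ν F`. -/
def nuUnit (F : LinFun k C B) : F ⟶ nuMinusObj k (nuObj k F) := nuEquiv k F _ (𝟙 _)

lemma nuUnit_π (F : LinFun k C B) (c c' : C) (ξ : Module.Dual k (c' ⟶ c)) :
    (nuUnit k F).hom.app c ≫ nuMinusπ k (nuObj k F) c c' ξ = nuι k F c c' ξ := by
  rw [nuUnit, nuEquiv_π]; simp

lemma nuUnit_unitInv (c : C) : (nuUnit k (freeFunObj k Y)).hom.app c ≫ unitInv k Y c = 𝟙 _ := by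
  have e : (nuUnit k (freeFunObj k Y)).hom.app c ≫ unitInv k Y c =
      ∑ c' : {c' : C // Nontrivial (c' ⟶ c)}, ∑ a : Fin (finDualBasis k (c'.1 ⟶ c)).n,
        freeProj k Y c'.1 c ((finDualBasis k (c'.1 ⟶ c)).ξ a) ≫
          freeι k Y c'.1 c ((finDualBasis k (c'.1 ⟶ c)).x a) := by
    rw [unitInv, Preadditive.comp_sum]
    refine Finset.sum_congr rfl fun c' _ => ?_
    rw [Preadditive.comp_sum]
    refine Finset.sum_congr rfl fun a _ => ?_
    rw [← Category.assoc, nuUnit_π, ← Category.assoc, nuι_starEv, dualPre_id]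
  rw [e]
  refine free_hom_ext k _ _ _ fun c₀ m => ?_
  rw [Category.comp_id]
  by_cases hc : Nontrivial (c₀ ⟶ c)
  · rw [Preadditive.comp_sum, Finset.sum_eq_single ⟨c₀, hc⟩]
    · rw [Preadditive.comp_sum]
      conv_rhs => rw [← (finDualBasis k (c₀ ⟶ c)).sum_eq m, map_sum]
      refine Finset.sum_congr rfl fun a _ => ?_
      rw [← Category.assoc, freeι_proj, Linear.smul_comp, Category.id_comp, LinearMap.map_smul]
    · rintro ⟨b, hb⟩ - hne
      rw [Preadditive.comp_sum]
      refine Finset.sum_eq_zero fun a _ => ?_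
      rw [← Category.assoc, freeι_proj_ne k Y (fun h => hne (Subtype.ext h.symm)), zero_comp]
    · intro h; exact absurd (Finset.mem_univ _) h
  · have := not_nontrivial_iff_subsingleton.1 hc
    rw [Subsingleton.elim m 0]; simp

lemma nuMinusπ_ev {c c' c₀ : C} (m : c' ⟶ c₀) (ξ : Module.Dual k (c' ⟶ c)) :
    nuMinusπ k (nuObj k (freeFunObj k Y)) c c' ξ ≫ starEv k Y c' c₀ m =
      nuMinusπ k (nuObj k (freeFunObj k Y)) c c₀ (dualPre k m c ξ) ≫ starEv k Y c₀ c₀ (𝟙 c₀) := by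
  rw [← nuMinusπ_w, Category.assoc, map_starEv, Category.comp_id]

lemma unitInv_nuUnit (c : C) : unitInv k Y c ≫ (nuUnit k (freeFunObj k Y)).hom.app c = 𝟙 _ := by
  refine nuMinus_hom_ext k _ _ _ fun c' ξ => star_hom_ext' k Y _ _ fun c₀ m => ?_
  have e : (unitInv k Y c ≫ (nuUnit k (freeFunObj k Y)).hom.app c) ≫
      nuMinusπ k (nuObj k (freeFunObj k Y)) c c' ξ =
      unitInv k Y c ≫ nuι k (freeFunObj k Y) c c' ξ := by
    rw [Category.assoc, nuUnit_π]
  refine (congrArg (fun t => t ≫ starEv k Y c' c₀ m) e).trans ?_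
  refine Eq.trans ?_ (congrArg (fun t => t ≫ starEv k Y c' c₀ m) (Category.id_comp _).symm)
  rw [Category.assoc, nuι_starEv, nuMinusπ_ev]
  by_cases hc : Nontrivial (c₀ ⟶ c)
  · rw [unitInv, Preadditive.sum_comp, Finset.sum_eq_single ⟨c₀, hc⟩]
    · rw [Preadditive.sum_comp]
      conv_rhs => rw [← (finDualBasis k (c₀ ⟶ c)).dual_sum_eq (dualPre k m c ξ), map_sum,
        Preadditive.sum_comp]
      refine Finset.sum_congr rfl fun a _ => ?_
      rw [Category.assoc, Category.assoc, freeι_proj, Linear.comp_smul, Linear.comp_smul,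
        Category.comp_id, LinearMap.map_smul, Linear.smul_comp]
    · rintro ⟨b, hb⟩ - hne
      rw [Preadditive.sum_comp]
      refine Finset.sum_eq_zero fun a _ => ?_
      rw [Category.assoc, Category.assoc, freeι_proj_ne k Y (fun h => hne (Subtype.ext h)),
        comp_zero, comp_zero]
    · intro h; exact absurd (Finset.mem_univ _) h
  · have := not_nontrivial_iff_subsingleton.1 hc
    rw [Subsingleton.elim (dualPre k m c ξ) 0]; simp

end

variable (C B) in
/-- The Nakayama functor `ν = D(C) ⊗_C -` on `B^C`, relative to `i_! ⊣ i^*`. -/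
def nakayama : NakayamaFunctor (freeAdj k C B) where
  faithful := ⟨fun {F G} f g h => by
    ext c
    exact congrFun h c⟩
  nu := nuFunctor k C B
  nuMinus := nuMinusFunctor k C B
  nu_additive := inferInstance
  nuMinus_additive := inferInstance
  nuAdj := nuAdjunction k C B
  starAdj := starAdjunction k C B
  isIso_unit Y := by
    have h : ∀ c, IsIso ((nuUnit k (freeFunObj k Y)).hom.app c) := fun c =>
      ⟨unitInv k Y c, nuUnit_unitInv k Y c, unitInv_nuUnit k Y c⟩
    have : IsIso (nuUnit k (freeFunObj k Y)).hom := NatIso.isIso_of_isIso_app _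
    have : IsIso ((linearFunctor k C B).ι.map (nuUnit k (freeFunObj k Y))) := this
    have h2 : IsIso (nuUnit k (freeFunObj k Y)) :=
      isIso_of_reflects_iso _ (linearFunctor k C B).ι
    exact h2

end FunctorCategory

end RelGorenstein
end

noncomputable section

namespace RelGorenstein

/-! ### Exactness of the canonical resolutions -/

section Resolutions

variable {A : Type u₁} [Category.{v₁} A] [Abelian A]

/-! Vanishing of the derived Nakayama functors above `n` turns out to be a property of the modules
`D(C(c, -))` and `D(C(-, c))` over `C` alone, in which the coefficient category `B` does not appear.

Exactness of a complex of functors is tested objectwise, and at `c` the functor `ν` is `D(C(c, -))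
⊗_C -`. So `L_i ν` vanishes exactly when all relative Tor objects `Tor_i(D(C(c, -)), F)`, computed
from the canonical free resolution of `F`, vanish. It is therefore enough to show, for every right
module `N` that is finitely generated projective over `k` and has finite support, that vanishing of
`Tor_i(N, -)` for `i > n` over `k`-modules implies the same over every `B`
(`RightMod.TorVanishesAbove.of_moduleCat`).

This goes by induction on `n`. The cover of `N` by a finite free module splits over `k`, so its
kernel `syz N` is a module of the same kind, and the sequence stays exact after tensoring with free
functors. Tensoring with the cover is exact, whence the dimension shift `torVanishesAbove_succ_iff`,
valid over every `B`.

For `n = 0` the hypothesis says that `N` is flat. Since `N` is finitely presented it is then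
projective: vanishing of `Tor_1` against the transpose of a presentation matrix yields a retraction
of `syz N ⟶ cover N` (`RightMod.exists_retraction`), hence a finite dual basis of `N`. A dual basis
consists of morphisms of `C` and elements of `N`, and over any `B` it makes `N ⊗_C -` a direct
summand of a finite sum of evaluation functors, which are exact.

The argument for `ν⁻` is dual, with `Hom_C(N, -)` for left modules and coresolutions by cofree
functors. There the base case is simpler: vanishing of `Ext^1(N, syz N)` extends the identity of
`syz N` to a retraction. -/

lemma exact_of_epi_kernel {X Y Z : A} {f : X ⟶ Y} {g : Y ⟶ Z} (w : f ≫ g = 0)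
    (φ : X ⟶ kernel g) (hφ : Epi φ) (h : f = φ ≫ kernel.ι g) : (ShortComplex.mk f g w).Exact := by
  rw [ShortComplex.exact_iff_epi_kernel_lift]
  have : kernel.lift g f w = φ := by
    rw [← cancel_mono (kernel.ι g), kernel.lift_ι, h]
  exact this ▸ inferInstance

lemma exact_of_mono_cokernel {X Y Z : A} {f : X ⟶ Y} {g : Y ⟶ Z} (w : f ≫ g = 0)
    (φ : cokernel f ⟶ Z) (hφ : Mono φ) (h : g = cokernel.π f ≫ φ) :
    (ShortComplex.mk f g w).Exact := by
  rw [ShortComplex.exact_iff_mono_cokernel_desc]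
  have : cokernel.desc f g w = φ := by
    rw [← cancel_epi (cokernel.π f), cokernel.π_desc, h]
  exact this ▸ inferInstance

/-- By construction each new term is `P` of the kernel of the previous differential, and `ε` maps it
epimorphically onto that kernel. -/
lemma resolution_exactAt_succ {P : A ⥤ A} (ε : P ⟶ 𝟭 A) (hε : ∀ X, Epi (ε.app X)) (X : A) (n : ℕ) :
    (resolution P ε X).ExactAt (n + 1) := by
  rw [HomologicalComplex.exactAt_iff' _ (n + 1 + 1) (n + 1) n (by simp) (by simp)]
  have : Epi (ε.app (kernel ((resolution P ε X).d (n + 1) n))) := inferInstance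
  -- The recursive construction gives the terms from degree two on only up to isomorphism.
  let e : (resolution P ε X).X (n + 2) ≅ P.obj (kernel ((resolution P ε X).d (n + 1) n)) :=
    ChainComplex.mk'XIso _ _ _ _ n
  refine exact_of_epi_kernel ((resolution P ε X).d_comp_d _ _ _)
    (e.hom ≫ ε.app (kernel ((resolution P ε X).d (n + 1) n))) (epi_comp _ _) ?_
  exact (ChainComplex.mk'_d _ _ _ _ n).trans (Category.assoc _ _ _).symm

/-- This is what makes the terms of the resolution free functors, on which tensoring preserves
`k`-split sequences. -/
lemma resolution_X (P : A ⥤ A) (ε : P ⟶ 𝟭 A) (X : A) (n : ℕ) :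
    ∃ Y, Nonempty ((resolution P ε X).X n ≅ P.obj Y) := by
  obtain _ | _ | n := n
  · exact ⟨_, ⟨Iso.refl _⟩⟩
  · exact ⟨_, ⟨Iso.refl _⟩⟩
  · exact ⟨_, ⟨ChainComplex.mk'XIso _ _ _ _ n⟩⟩

lemma resolution_d_one_zero (P : A ⥤ A) (ε : P ⟶ 𝟭 A) (X : A) :
    (resolution P ε X).d 1 0 = ε.app (kernel (ε.app X)) ≫ kernel.ι (ε.app X) :=
  ChainComplex.mk'_d_1_0 _ _ _ _

/-- The augmentation of the canonical resolution. -/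
def resolutionAugmentation (P : A ⥤ A) (ε : P ⟶ 𝟭 A) (X : A) : (resolution P ε X).X 0 ⟶ X :=
  ε.app X

lemma resolution_d_comp_augmentation (P : A ⥤ A) (ε : P ⟶ 𝟭 A) (X : A) :
    (resolution P ε X).d 1 0 ≫ resolutionAugmentation P ε X = 0 := by
  refine (congrArg (· ≫ ε.app X) (resolution_d_one_zero P ε X)).trans ?_
  refine (Category.assoc _ _ _).trans ?_
  exact (congrArg (ε.app (kernel (ε.app X)) ≫ ·) (kernel.condition (ε.app X))).trans comp_zero

lemma resolution_exact_augmentation {P : A ⥤ A} (ε : P ⟶ 𝟭 A) (hε : ∀ X, Epi (ε.app X)) (X : A) :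
    (ShortComplex.mk _ _ (resolution_d_comp_augmentation P ε X)).Exact :=
  exact_of_epi_kernel _ (ε.app (kernel (ε.app X))) (hε _) (resolution_d_one_zero P ε X)

lemma cochainComplexOf_exactAt_succ {X : ℕ → A} {d : ∀ n, X n ⟶ X (n + 1)}
    (sq : ∀ n, d n ≫ d (n + 1) = 0) (h : ∀ n, (ShortComplex.mk (d n) (d (n + 1)) (sq n)).Exact)
    (n : ℕ) : (CochainComplex.of X d sq).ExactAt (n + 1) := by
  rw [HomologicalComplex.exactAt_iff' _ n (n + 1) (n + 1 + 1) (by simp) (by simp)]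
  -- The differentials of `CochainComplex.of` agree with the given `d` only propositionally, so
  -- exactness is carried over by substitution.
  have key : ∀ {U V W : A} {f f' : U ⟶ V} {g g' : V ⟶ W} (_ : f' = f) (_ : g' = g)
      (w : f ≫ g = 0) (w' : f' ≫ g' = 0) (_ : (ShortComplex.mk f g w).Exact),
      (ShortComplex.mk f' g' w').Exact := by
    rintro U V W f _ g _ rfl rfl w _ h
    exact h
  exact key (CochainComplex.of_d X d n) (CochainComplex.of_d X d (n + 1)) (sq n) _ (h n)

lemma coresolution_exactAt_succ {I : A ⥤ A} (η : 𝟭 A ⟶ I) (hη : ∀ X, Mono (η.app X)) (X : A)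
    (n : ℕ) : (coresolution I η X).ExactAt (n + 1) := by
  refine cochainComplexOf_exactAt_succ
    (fun n => (CochainComplex.mkAux _ _ _ _ _ _ _ n).zero) (fun n => ?_) n
  -- The first pair of differentials is initial data of the recursion and later pairs come from its
  -- successor step; only after this case split do the factorizations hold by `rfl`.
  obtain _ | n := n
  · exact exact_of_mono_cokernel _ (η.app (cokernel (cokernel.π (η.app X) ≫ η.app _))) (hη _) rfl
  · exact exact_of_mono_cokernel _ (η.app (cokernel (CochainComplex.mkAux _ _ _ _ _ _ _ n).g))
      (hη _) rfl

lemma coresolution_X (I : A ⥤ A) (η : 𝟭 A ⟶ I) (X : A) (n : ℕ) :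
    ∃ Y, Nonempty ((coresolution I η X).X n ≅ I.obj Y) := by
  obtain _ | _ | _ | n := n
  · exact ⟨_, ⟨Iso.refl _⟩⟩
  · exact ⟨_, ⟨Iso.refl _⟩⟩
  · exact ⟨_, ⟨Iso.refl _⟩⟩
  · exact ⟨_, ⟨Iso.refl _⟩⟩

lemma coresolution_d_zero_one (I : A ⥤ A) (η : 𝟭 A ⟶ I) (X : A) :
    (coresolution I η X).d 0 1 = cokernel.π (η.app X) ≫ η.app (cokernel (η.app X)) :=
  CochainComplex.mk'_d_1_0 _ _ _ _

/-- The coaugmentation of the canonical coresolution. -/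
def coresolutionCoaugmentation (I : A ⥤ A) (η : 𝟭 A ⟶ I) (X : A) :
    X ⟶ (coresolution I η X).X 0 :=
  η.app X

lemma coaugmentation_comp_coresolution_d (I : A ⥤ A) (η : 𝟭 A ⟶ I) (X : A) :
    coresolutionCoaugmentation I η X ≫ (coresolution I η X).d 0 1 = 0 := by
  refine (congrArg (η.app X ≫ ·) (coresolution_d_zero_one I η X)).trans ?_
  refine (Category.assoc _ _ _).symm.trans ?_
  exact (congrArg (· ≫ η.app (cokernel (η.app X))) (cokernel.condition (η.app X))).trans zero_comp

lemma coresolution_exact_coaugmentation {I : A ⥤ A} (η : 𝟭 A ⟶ I) (hη : ∀ X, Mono (η.app X))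
    (X : A) :
    (ShortComplex.mk _ _ (coaugmentation_comp_coresolution_d I η X)).Exact :=
  exact_of_mono_cokernel _ (η.app (cokernel (η.app X))) (hη _) (coresolution_d_zero_one I η X)

end Resolutions

/-! ### Auxiliary facts on modules -/

section Modules

variable {k : Type u} [CommRing k]

lemma projective_pi {ι : Type w} [Finite ι] (M : ι → Type v) [∀ i, AddCommGroup (M i)]
    [∀ i, Module k (M i)] [∀ i, Module.Projective k (M i)] : Module.Projective k (∀ i, M i) := by
  classical
  have := Fintype.ofFinite ι
  exact Module.Projective.of_equiv (DFinsupp.linearEquivFunOnFintype (R := k) (M := M))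

lemma finite_support_of_surjective {C : Type w} {M N : C → Type u} [∀ c, AddCommGroup (M c)]
    [∀ c, Module k (M c)] [∀ c, AddCommGroup (N c)] [∀ c, Module k (N c)]
    [hM : Finite {c // Nontrivial (M c)}] (f : ∀ c, M c →ₗ[k] N c)
    (hf : ∀ c, Function.Surjective (f c)) : Finite {c // Nontrivial (N c)} :=
  Set.Finite.subset (s := {c | Nontrivial (M c)}) hM fun c (_ : Nontrivial (N c)) =>
    (hf c).nontrivial

lemma finite_support_pi {C : Type w} {ι : Type v} [Finite ι] (M : ι → C → Type u)
    (h : ∀ i, {c | Nontrivial (M i c)}.Finite) : Finite {c // Nontrivial (∀ i, M i c)} := by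
  refine Set.Finite.subset (s := ⋃ i, {c | Nontrivial (M i c)}) (Set.finite_iUnion h) ?_
  rintro d (hd : Nontrivial _)
  by_contra h'
  simp only [Set.mem_iUnion, Set.mem_ofPred_eq, not_exists,
    not_nontrivial_iff_subsingleton] at h'
  exact not_subsingleton (∀ i, M i d) inferInstance

end Modules

/-! ### Right modules over a linear category -/

/-- A right module over `C` (a linear functor `Cᵒᵖ ⥤ Mod k`) which is finitely generated projective
over `k` and nonzero at only finitely many objects. -/
structure RightMod (k : Type u) [CommRing k] (C : Type w) [Category.{u} C] [Preadditive C]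
    [Linear k C] where
  /-- the underlying family of modules -/
  carrier : C → Type u
  [addCommGroup : ∀ c, AddCommGroup (carrier c)]
  [module : ∀ c, Module k (carrier c)]
  [finite : ∀ c, Module.Finite k (carrier c)]
  [projective : ∀ c, Module.Projective k (carrier c)]
  [finite_support : Finite {c // Nontrivial (carrier c)}]
  /-- the action `x, f ↦ x · f` -/
  act : ∀ {c d : C}, (c ⟶ d) →ₗ[k] carrier d →ₗ[k] carrier c
  act_id : ∀ {c : C} (x : carrier c), act (𝟙 c) x = x
  act_comp : ∀ {c d e : C} (f : c ⟶ d) (g : d ⟶ e) (x : carrier e),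
    act (f ≫ g) x = act f (act g x)

namespace RightMod

variable {k : Type u} [CommRing k] {C : Type w} [Category.{u} C] [Preadditive C] [Linear k C]

instance : CoeFun (RightMod k C) fun _ => C → Type u := ⟨carrier⟩

attribute [instance] addCommGroup module finite projective finite_support

/-- Morphisms of right modules. -/
structure Hom (M N : RightMod k C) where
  /-- the components -/
  app : ∀ c, M c →ₗ[k] N c
  map_act : ∀ {c d : C} (f : c ⟶ d) (x : M d), app c (M.act f x) = N.act f (app d x)

/-- A finite family of generators of a right module. -/
structure Generators (N : RightMod k C) where
  /-- the number of generators -/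
  m : ℕ
  /-- the objects at which the generators live -/
  pt : Fin m → C
  /-- the generators -/
  gen : ∀ i, N (pt i)
  surj : ∀ (d : C) (x : N d), ∃ h : ∀ i, d ⟶ pt i, ∑ i, N.act (h i) (gen i) = x

/-- Dual bases over `k` of the finitely many nonzero `N c`, taken together, already generate `N`
with scalar multiples of identities as coefficients. -/
lemma nonempty_generators (N : RightMod k C) : Nonempty N.Generators := by
  obtain ⟨m, ⟨e⟩⟩ := Finite.exists_equiv_fin
    (Σ c : {c // Nontrivial (N c)}, Fin (finDualBasis k (N c.1)).n)
  refine ⟨⟨m, fun i => (e.symm i).1.1, fun i => (finDualBasis k (N (e.symm i).1.1)).x (e.symm i).2,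
    fun d x => ?_⟩⟩
  by_cases hd : Nontrivial (N d)
  · classical
    have := Fintype.ofFinite {c // Nontrivial (N c)}
    -- Only generators living at `d` itself receive a nonzero coefficient.
    let h : ∀ j : Σ c : {c // Nontrivial (N c)}, Fin (finDualBasis k (N c.1)).n, d ⟶ j.1.1 :=
      fun j => if hj : j.1.1 = d then
        (finDualBasis k (N j.1.1)).ξ j.2 (N.act (eqToHom hj) x) • eqToHom hj.symm else 0
    refine ⟨fun i => h (e.symm i), ?_⟩
    rw [e.symm.sum_comp fun j => N.act (h j) ((finDualBasis k (N j.1.1)).x j.2),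
      Fintype.sum_sigma, Finset.sum_eq_single ⟨d, hd⟩]
    · simpa [h, act_id] using (finDualBasis k (N d)).sum_eq x
    · rintro ⟨c, hc⟩ - hne
      refine Finset.sum_eq_zero fun a _ => ?_
      simp [h, show c ≠ d from fun hcd => hne (Subtype.ext hcd)]
    · intro h'; exact absurd (Finset.mem_univ _) h'
  · have := not_nontrivial_iff_subsingleton.1 hd
    exact ⟨0, Subsingleton.elim _ _⟩

/-- A chosen finite family of generators. -/
def generators (N : RightMod k C) : N.Generators := N.nonempty_generators.some

variable [IsLocallyBounded C] [IsHomFinite k C]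

/-- The right module `D(C(c, -))`. -/
@[simps]
def dual (k : Type u) [CommRing k] {C : Type w} [Category.{u} C] [Preadditive C] [Linear k C]
    [IsLocallyBounded C] [IsHomFinite k C] (c : C) : RightMod k C where
  carrier d := Module.Dual k (c ⟶ d)
  act := LinearMap.mk₂ k (fun f ξ => dualPost k f c ξ) (dualPost_add k) (dualPost_smul k)
    (fun _ _ _ => map_add _ _ _) (fun _ _ _ => LinearMap.map_smul _ _ _)
  act_id := dualPost_id k
  act_comp := dualPost_comp k

/-- The right module `⨁ᵢ C(-, cᵢ)`. -/
def free {m : ℕ} (pt : Fin m → C) : RightMod k C where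
  carrier d := ∀ i, d ⟶ pt i
  projective d := projective_pi fun i => (d ⟶ pt i)
  finite_support := finite_support_pi _ fun i => IsLocallyBounded.finite_in (pt i)
  act := LinearMap.mk₂ k (fun f h i => f ≫ h i)
    (fun _ _ _ => funext fun _ => Preadditive.add_comp _ _ _ _ _ _)
    (fun _ _ _ => funext fun _ => Linear.smul_comp _ _ _ _ _ _)
    (fun _ _ _ => funext fun _ => Preadditive.comp_add _ _ _ _ _ _)
    (fun _ _ _ => funext fun _ => Linear.comp_smul _ _ _ _ _ _)
  act_id _ := funext fun _ => Category.id_comp _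
  act_comp _ _ _ := funext fun _ => Category.assoc _ _ _

/-- The free right module on the chosen generators. -/
abbrev cover (N : RightMod k C) : RightMod k C := free N.generators.pt

/-- The morphism from a free right module given by the images of the generators. -/
def freeHom {m : ℕ} (pt : Fin m → C) (N : RightMod k C) (g : ∀ i, N (pt i)) :
    Hom (free pt) N where
  app d := ∑ i, (N.act.flip (g i)) ∘ₗ (LinearMap.proj i : (∀ i, d ⟶ pt i) →ₗ[k] (d ⟶ pt i))
  map_act f h := by
    rw [LinearMap.sum_apply, LinearMap.sum_apply, map_sum]
    exact Finset.sum_congr rfl fun i _ => N.act_comp _ _ _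

lemma freeHom_apply {m : ℕ} (pt : Fin m → C) (N : RightMod k C) (g : ∀ i, N (pt i)) {d : C}
    (h : free (k := k) pt d) : (freeHom pt N g).app d h = ∑ i, N.act (h i) (g i) :=
  LinearMap.sum_apply _ _ _

/-- The projection from the free right module on the chosen generators. -/
def coverHom (N : RightMod k C) : Hom N.cover N := freeHom _ N N.generators.gen

lemma coverHom_apply (N : RightMod k C) {d : C} (h : N.cover d) :
    N.coverHom.app d h = ∑ i, N.act (h i) (N.generators.gen i) := freeHom_apply _ _ _ h

lemma coverHom_surjective (N : RightMod k C) (d : C) : Function.Surjective (N.coverHom.app d) :=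
  fun x => by
    obtain ⟨h, hh⟩ := N.generators.surj d x
    exact ⟨h, (N.coverHom_apply h).trans hh⟩

/-- Projectivity of `N d` over `k` gives a section at each object separately; it need not respect
the action of `C`. -/
lemma exists_coverSection (N : RightMod k C) (d : C) :
    ∃ σ : N d →ₗ[k] N.cover d, N.coverHom.app d ∘ₗ σ = LinearMap.id :=
  Module.projective_lifting_property _ _ (N.coverHom_surjective d)

/-- A `k`-linear section of the cover. -/
def coverSection (N : RightMod k C) (d : C) : N d →ₗ[k] N.cover d :=
  (N.exists_coverSection d).choose

lemma coverHom_coverSection (N : RightMod k C) (d : C) (x : N d) :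
    N.coverHom.app d (N.coverSection d x) = x :=
  LinearMap.congr_fun (N.exists_coverSection d).choose_spec x

/-- The `k`-linear projection onto the kernel of the cover. -/
def kerProj (N : RightMod k C) (d : C) : N.cover d →ₗ[k] LinearMap.ker (N.coverHom.app d) :=
  LinearMap.codRestrict _ (LinearMap.id - N.coverSection d ∘ₗ N.coverHom.app d) fun x => by
    simp only [LinearMap.mem_ker, LinearMap.sub_apply, LinearMap.comp_apply, map_sub,
      coverHom_coverSection, LinearMap.id_apply, sub_self]

lemma kerProj_subtype (N : RightMod k C) (d : C) (x : LinearMap.ker (N.coverHom.app d)) :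
    N.kerProj d x = x :=
  Subtype.ext (by
    have := LinearMap.mem_ker.1 x.2
    simp [kerProj, this])

lemma kerProj_surjective (N : RightMod k C) (d : C) : Function.Surjective (N.kerProj d) :=
  fun x => ⟨x, N.kerProj_subtype d x⟩

/-- The kernel of the cover. -/
def syz (N : RightMod k C) : RightMod k C where
  carrier d := LinearMap.ker (N.coverHom.app d)
  -- Through `kerProj` the kernel is a direct summand of the cover over `k`, which supplies all
  -- three finiteness conditions and lets syzygies be iterated.
  finite d := Module.Finite.of_surjective (N.kerProj d) (N.kerProj_surjective d)
  projective d := Module.Projective.of_split (Submodule.subtype _) (N.kerProj d)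
    (LinearMap.ext (N.kerProj_subtype d))
  finite_support := finite_support_of_surjective N.kerProj N.kerProj_surjective
  act {c d} := LinearMap.mk₂ k (fun f x => ⟨N.cover.act f x.1, by
      have := LinearMap.mem_ker.1 x.2
      rw [LinearMap.mem_ker, Hom.map_act, this, map_zero]⟩)
    (fun _ _ _ => Subtype.ext (LinearMap.map_add₂ _ _ _ _))
    (fun _ _ _ => Subtype.ext (LinearMap.map_smul₂ _ _ _ _))
    (fun _ _ _ => Subtype.ext (map_add _ _ _))
    (fun _ _ _ => Subtype.ext (LinearMap.map_smul _ _ _))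
  act_id _ := Subtype.ext (act_id _ _)
  act_comp _ _ _ := Subtype.ext (act_comp _ _ _ _)

/-- The inclusion of the kernel of the cover. -/
def syzHom (N : RightMod k C) : Hom N.syz N.cover where
  app _ := Submodule.subtype _
  map_act _ _ := rfl

/-- The `k`-linear projection onto `syz N`. -/
def syzProj (N : RightMod k C) (d : C) : N.cover d →ₗ[k] N.syz d := N.kerProj d

lemma syzProj_syzHom (N : RightMod k C) {d : C} (x : N.syz d) :
    N.syzProj d (N.syzHom.app d x) = x := N.kerProj_subtype d x

lemma syzHom_syzProj (N : RightMod k C) {d : C} (x : N.cover d) :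
    N.syzHom.app d (N.syzProj d x) = x - N.coverSection d (N.coverHom.app d x) := rfl

lemma coverHom_syzHom (N : RightMod k C) {d : C} (x : N.syz d) :
    N.coverHom.app d (N.syzHom.app d x) = 0 := x.2

lemma exists_syzHom_eq (N : RightMod k C) {d : C} {x : N.cover d} (hx : N.coverHom.app d x = 0) :
    ∃ y, N.syzHom.app d y = x := ⟨⟨x, hx⟩, rfl⟩

end RightMod

/-! ### Tensor products of right modules with functors -/

namespace RightMod

variable {k : Type u} [CommRing k] {C : Type w} [Category.{u} C] [Preadditive C] [Linear k C]
variable {B : Type u₂} [Category.{v₂} B] [Abelian B] [Linear k B]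

/-- The tensor product `N ⊗_C F`: maps to `X` correspond to morphisms of right modules
`N ⟶ B(F -, X)`. -/
structure Tensor (N : RightMod k C) (F : LinFun k C B) where
  pt : B
  ι : ∀ c : C, N c →ₗ[k] (F.obj.obj c ⟶ pt)
  w : ∀ {c d : C} (f : c ⟶ d) (x : N d), ι c (N.act f x) = F.obj.map f ≫ ι d x
  desc : ∀ {X : B} (h : ∀ c : C, N c →ₗ[k] (F.obj.obj c ⟶ X))
    (_ : ∀ (c d : C) (f : c ⟶ d) (x : N d), h c (N.act f x) = F.obj.map f ≫ h d x), pt ⟶ X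
  fac : ∀ {X : B} (h : ∀ c : C, N c →ₗ[k] (F.obj.obj c ⟶ X))
    (hw : ∀ (c d : C) (f : c ⟶ d) (x : N d), h c (N.act f x) = F.obj.map f ≫ h d x)
    (c : C) (x : N c), ι c x ≫ desc h hw = h c x
  hom_ext : ∀ {X : B} (f g : pt ⟶ X), (∀ c x, ι c x ≫ f = ι c x ≫ g) → f = g

variable [IsLocallyBounded C] [IsHomFinite k C]

section

variable (N : RightMod k C) (F : LinFun k C B)

open TensorProduct in
-- A nonzero term needs `d` in the finite support of `N` and a nonzero `C(c, d)`; local boundedness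
-- leaves finitely many such `c`.
instance : Finite {p : C × C // Nontrivial (N p.2 ⊗[k] (p.1 ⟶ p.2))} := by
  have h : {p : C × C | Nontrivial (N p.2 ⊗[k] (p.1 ⟶ p.2))} ⊆
      ⋃ d ∈ {d : C | Nontrivial (N d)}, (fun c => (c, d)) '' {c : C | Nontrivial (c ⟶ d)} := by
    rintro ⟨c, d⟩ (h : Nontrivial _)
    simp only [Set.mem_iUnion]
    refine ⟨d, ?_, c, ?_, rfl⟩ <;>
    · by_contra h'
      have := not_nontrivial_iff_subsingleton.1 h'
      exact not_subsingleton (N d ⊗[k] (c ⟶ d)) inferInstance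
  exact (Set.Finite.biUnion (s := {d | Nontrivial (N d)}) N.finite_support fun d _ =>
    (IsLocallyBounded.finite_in d).image _).subset h

open TensorProduct in
/-- The relations which present `N ⊗_C F`. -/
def tensorRel :
    (famTensor k (fun p : C × C => N p.2 ⊗[k] (p.1 ⟶ p.2)) (fun p => F.obj.obj p.1)).pt ⟶
    (famTensor k N.carrier F.obj.obj).pt :=
  FamTensor.desc _ fun p => TensorProduct.lift (LinearMap.mk₂ k
    (fun x f => (famTensor k N.carrier F.obj.obj).ι p.1 (N.act f x) -
      F.obj.map f ≫ (famTensor k N.carrier F.obj.obj).ι p.2 x)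
    (fun x x' f => by simp; abel)
    (fun r x f => by simp [smul_sub])
    (fun x f f' => by simp [Preadditive.add_comp]; abel)
    (fun r x f => by simp [smul_sub]))

lemma tensorRel_fac {c d : C} (f : c ⟶ d) (x : N d) :
    (famTensor k (fun p : C × C => TensorProduct k (N p.2) (p.1 ⟶ p.2))
      (fun p => F.obj.obj p.1)).ι (c, d) (x ⊗ₜ f) ≫ tensorRel N F =
    (famTensor k N.carrier F.obj.obj).ι c (N.act f x) -
      F.obj.map f ≫ (famTensor k N.carrier F.obj.obj).ι d x := by
  rw [tensorRel, FamTensor.fac]; simp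

/-- Existence of `N ⊗_C F`. -/
def tensor : Tensor N F where
  pt := cokernel (tensorRel N F)
  ι c := Linear.rightComp k _ (cokernel.π (tensorRel N F)) ∘ₗ
    (famTensor k N.carrier F.obj.obj).ι c
  w {c d} f x := by
    have := (famTensor k (fun p : C × C => TensorProduct k (N p.2) (p.1 ⟶ p.2))
      (fun p => F.obj.obj p.1)).ι (c, d) (x ⊗ₜ f) ≫= cokernel.condition (tensorRel N F)
    rw [comp_zero, ← Category.assoc, tensorRel_fac] at this
    simpa [Preadditive.sub_comp, sub_eq_zero] using this
  desc h hw := cokernel.desc _ (FamTensor.desc _ h) (FamTensor.hom_ext _ _ _ fun p m => by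
    rw [tensorRel, ← Category.assoc, FamTensor.fac, comp_zero]
    induction m using TensorProduct.induction_on with
    | zero => simp
    | add x y hx hy => simp [Preadditive.add_comp, hx, hy]
    | tmul x f => simp [Preadditive.sub_comp, FamTensor.fac, hw])
  fac h hw c x := by simp [FamTensor.fac]
  hom_ext f g hfg := by
    rw [← cancel_epi (cokernel.π _)]
    refine FamTensor.hom_ext _ _ _ fun c x => ?_
    simpa using hfg c x

attribute [irreducible] tensor

end

variable (B) in
/-- The functor `N ⊗_C -`. -/
def tensorFunctor (N : RightMod k C) : LinFun k C B ⥤ B where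
  obj F := (N.tensor F).pt
  map {F G} α := (N.tensor F).desc (fun c => Linear.leftComp k _ (α.hom.app c) ∘ₗ (N.tensor G).ι c)
    (fun c d f x => by
      simp only [LinearMap.comp_apply, Linear.leftComp_apply, Tensor.w]
      rw [← Category.assoc, ← Category.assoc, α.hom.naturality])
  map_id F := (N.tensor F).hom_ext _ _ fun c x => by
    rw [Tensor.fac]
    simp
  map_comp α β := (N.tensor _).hom_ext _ _ fun c x => by
    rw [Tensor.fac, ← Category.assoc, Tensor.fac]
    simp only [LinearMap.comp_apply, Linear.leftComp_apply, Category.assoc]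
    rw [Tensor.fac]
    simp

section

variable (N : RightMod k C) (F : LinFun k C B)

/-- The universal family `N c ⟶ B(F c, N ⊗_C F)`. -/
def tι (c : C) : N c →ₗ[k] (F.obj.obj c ⟶ (N.tensorFunctor B).obj F) := (N.tensor F).ι c

lemma tι_act {c d : C} (f : c ⟶ d) (x : N d) :
    N.tι F c (N.act f x) = F.obj.map f ≫ N.tι F d x := (N.tensor F).w f x

variable {N F} in
lemma tensor_hom_ext {X : B} {f g : (N.tensorFunctor B).obj F ⟶ X}
    (h : ∀ c x, N.tι F c x ≫ f = N.tι F c x ≫ g) : f = g := (N.tensor F).hom_ext f g h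

/-- The map out of `N ⊗_C F` given by a balanced family. -/
def tDesc {X : B} (h : ∀ c : C, N c →ₗ[k] (F.obj.obj c ⟶ X))
    (hw : ∀ (c d : C) (f : c ⟶ d) (x : N d), h c (N.act f x) = F.obj.map f ≫ h d x) :
    (N.tensorFunctor B).obj F ⟶ X := (N.tensor F).desc h hw

@[simp]
lemma tι_desc {X : B} (h : ∀ c : C, N c →ₗ[k] (F.obj.obj c ⟶ X))
    (hw : ∀ (c d : C) (f : c ⟶ d) (x : N d), h c (N.act f x) = F.obj.map f ≫ h d x)
    (c : C) (x : N c) : N.tι F c x ≫ N.tDesc F h hw = h c x := (N.tensor F).fac h hw c x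

lemma tι_desc_assoc {X Z : B} (h : ∀ c : C, N c →ₗ[k] (F.obj.obj c ⟶ X))
    (hw : ∀ (c d : C) (f : c ⟶ d) (x : N d), h c (N.act f x) = F.obj.map f ≫ h d x)
    (c : C) (x : N c) (g : X ⟶ Z) : N.tι F c x ≫ N.tDesc F h hw ≫ g = h c x ≫ g := by
  rw [← Category.assoc, tι_desc]

end

lemma tι_map (N : RightMod k C) {F G : LinFun k C B} (α : F ⟶ G) {c : C} (x : N c) :
    N.tι F c x ≫ (N.tensorFunctor B).map α = α.hom.app c ≫ N.tι G c x :=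
  (N.tensor F).fac _ _ _ _

instance (N : RightMod k C) : (N.tensorFunctor B).Additive where
  map_add {F G α β} := tensor_hom_ext fun c x => by
    rw [Preadditive.comp_add, tι_map, tι_map, tι_map]
    exact Preadditive.add_comp _ _ _ _ _ _

/-- Functoriality of `N ⊗_C -` in `N`. -/
@[simps]
def Hom.tensor {M N : RightMod k C} (φ : Hom M N) : M.tensorFunctor B ⟶ N.tensorFunctor B where
  app F := M.tDesc F (fun c => N.tι F c ∘ₗ φ.app c) (fun c d f x => by
    simp only [LinearMap.comp_apply, φ.map_act, tι_act])
  naturality F G α := tensor_hom_ext fun c x => by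
    rw [← Category.assoc, tι_map, Category.assoc, tι_desc, tι_desc_assoc]
    simp [tι_map]

lemma tι_homTensor {M N : RightMod k C} (φ : Hom M N) (F : LinFun k C B) {c : C} (x : M c) :
    M.tι F c x ≫ φ.tensor.app F = N.tι F c (φ.app c x) := by simp

section

variable (c : C) (F : LinFun k C B)

/-- The comparison map from `ν(F) c` to `D(C(c, -)) ⊗_C F`. -/
def nuToTensor : (nuObj k F).obj.obj c ⟶ ((dual k c).tensorFunctor B).obj F :=
  nuDesc k F ((dual k c).tι F) (fun _ _ f ξ => (dual k c).tι_act F f ξ)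

/-- The comparison map from `D(C(c, -)) ⊗_C F` to `ν(F) c`. -/
def tensorToNu : ((dual k c).tensorFunctor B).obj F ⟶ (nuObj k F).obj.obj c :=
  (dual k c).tDesc F (fun c' => nuι k F c' c) (fun _ _ f ξ => (nuι_w k F c f ξ).symm)

lemma nuι_nuToTensor {c' : C} (ξ : Module.Dual k (c ⟶ c')) :
    nuι k F c' c ξ ≫ nuToTensor c F = (dual k c).tι F c' ξ :=
  nuι_desc k F _ _ c' ξ

lemma tι_tensorToNu {c' : C} (ξ : Module.Dual k (c ⟶ c')) :
    (dual k c).tι F c' ξ ≫ tensorToNu c F = nuι k F c' c ξ :=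
  (dual k c).tι_desc F _ _ c' ξ

end

/-- The functor `ν`, evaluated at `c`, is `D(C(c, -)) ⊗_C -`. -/
def nuEvIso (c : C) : nuFunctor k C B ⋙ (linearFunctor k C B).ι ⋙ (evaluation C B).obj c ≅
    (dual k c).tensorFunctor B :=
  NatIso.ofComponents (fun F =>
    { hom := nuToTensor c F
      inv := tensorToNu c F
      hom_inv_id := nu_hom_ext k F _ _ fun _ ξ =>
        (Category.assoc _ _ _).symm.trans ((congrArg (· ≫ tensorToNu c F)
          (nuι_nuToTensor c F ξ)).trans ((tι_tensorToNu c F ξ).trans (Category.comp_id _).symm))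
      inv_hom_id := tensor_hom_ext fun _ ξ =>
        (Category.assoc _ _ _).symm.trans ((congrArg (· ≫ nuToTensor c F)
          (tι_tensorToNu c F ξ)).trans ((nuι_nuToTensor c F ξ).trans (Category.comp_id _).symm)) })
    fun {F G} α => nu_hom_ext k F _ _ fun c' ξ =>
      (nuι_nuMap_assoc k α ξ _).trans ((congrArg (α.hom.app c' ≫ ·)
        (nuι_nuToTensor c G ξ)).trans (((dual k c).tι_map α ξ).symm.trans
          ((congrArg (· ≫ ((dual k c).tensorFunctor B).map α)
            (nuι_nuToTensor c F ξ).symm).trans (Category.assoc _ _ _))))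

end RightMod

/-! ### Dimension shifting for complexes -/

section Shift

variable {A : Type u₁} [Category.{v₁} A] [Abelian A] {B : Type u₂} [Category.{v₂} B] [Abelian B]
variable {F G H : A ⥤ B} [F.Additive] [G.Additive] [H.Additive] (α : F ⟶ G) (β : G ⟶ H)

/-- In the long exact homology sequence the middle complex contributes nothing at `i` and `j`, so
the connecting morphism is an isomorphism. Short exactness is required only on the terms of `K`, not
on all objects. -/
lemma exactAt_iff_of_shortExact {ι : Type*} {c : ComplexShape ι} (K : HomologicalComplex A c)
    (w : ∀ i, α.app (K.X i) ≫ β.app (K.X i) = 0)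
    (hS : ∀ i, (ShortComplex.mk _ _ (w i)).ShortExact) (i j : ι) (hij : c.Rel i j)
    (hi : ((G.mapHomologicalComplex c).obj K).ExactAt i)
    (hj : ((G.mapHomologicalComplex c).obj K).ExactAt j) :
    ((H.mapHomologicalComplex c).obj K).ExactAt i ↔
      ((F.mapHomologicalComplex c).obj K).ExactAt j := by
  let S : ShortComplex (HomologicalComplex B c) :=
    { X₁ := (F.mapHomologicalComplex c).obj K
      X₂ := (G.mapHomologicalComplex c).obj K
      X₃ := (H.mapHomologicalComplex c).obj K
      f := (NatTrans.mapHomologicalComplex α c).app K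
      g := (NatTrans.mapHomologicalComplex β c).app K
      zero := by ext i; exact w i }
  have hS' : S.ShortExact := HomologicalComplex.shortExact_of_degreewise_shortExact S hS
  rw [HomologicalComplex.exactAt_iff_isZero_homology] at hi hj ⊢
  rw [HomologicalComplex.exactAt_iff_isZero_homology]
  have := hS'.isIso_δ i j hij hi hj
  exact (asIso (hS'.δ i j hij)).isZero_iff

lemma exactAt_of_natIso {ι : Type*} {c : ComplexShape ι} (e : F ≅ G) (K : HomologicalComplex A c)
    (i : ι) : ((F.mapHomologicalComplex c).obj K).ExactAt i ↔
      ((G.mapHomologicalComplex c).obj K).ExactAt i := by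
  rw [HomologicalComplex.exactAt_iff_isZero_homology,
    HomologicalComplex.exactAt_iff_isZero_homology]
  exact ((HomologicalComplex.homologyFunctor B c i).mapIso
    ((NatIso.mapHomologicalComplex e c).app K)).isZero_iff

/-- `F` is a direct summand of the sum of the `E j`: the identity of its homology at `i` is a sum of
morphisms factoring through zero objects. -/
lemma exactAt_of_sum_factors {ι : Type*} {c : ComplexShape ι} (K : HomologicalComplex A c) (i : ι)
    {J : Type} [Fintype J] (E : J → A ⥤ B) [∀ j, (E j).Additive] (p : ∀ j, F ⟶ E j)
    (q : ∀ j, E j ⟶ F) (h : ∀ X, ∑ j, (p j).app X ≫ (q j).app X = 𝟙 (F.obj X))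
    (hE : ∀ j, (((E j).mapHomologicalComplex c).obj K).ExactAt i) :
    ((F.mapHomologicalComplex c).obj K).ExactAt i := by
  simp only [HomologicalComplex.exactAt_iff_isZero_homology] at hE ⊢
  rw [IsZero.iff_id_eq_zero]
  have : 𝟙 ((F.mapHomologicalComplex c).obj K) =
      ∑ j, (NatTrans.mapHomologicalComplex (p j) c).app K ≫
        (NatTrans.mapHomologicalComplex (q j) c).app K := by
    ext n
    refine (h (K.X n)).symm.trans ?_
    exact (map_sum (HomologicalComplex.Hom.fAddMonoidHom
      (C₁ := (F.mapHomologicalComplex c).obj K) (C₂ := (F.mapHomologicalComplex c).obj K) n)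
      (fun j => (NatTrans.mapHomologicalComplex (p j) c).app K ≫
        (NatTrans.mapHomologicalComplex (q j) c).app K) Finset.univ).symm
  have h2 := congrArg (HomologicalComplex.homologyFunctor B c i).map this
  rw [CategoryTheory.Functor.map_id, Functor.map_sum] at h2
  refine h2.trans (Finset.sum_eq_zero fun j _ => ?_)
  rw [Functor.map_comp, (hE j).eq_of_tgt ((HomologicalComplex.homologyFunctor B c i).map _) 0]
  exact zero_comp

end Shift

/-! ### Exactness of complexes of functors is objectwise -/

section Evaluation

variable {k : Type u} [CommRing k] {C : Type w} [Category.{u} C] [Preadditive C] [Linear k C]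
variable {B : Type u₂} [Category.{v₂} B] [Abelian B] [Linear k B]

variable (k B) in
/-- Evaluation of linear functors at an object. -/
abbrev ev (c : C) : LinFun k C B ⥤ B := (linearFunctor k C B).ι ⋙ (evaluation C B).obj c

/-- Kernels and cokernels of linear functors are those of the ambient functor category, where they
are computed objectwise. -/
instance (c : C) : (ev k B c).PreservesHomology where
  preservesKernels _ _ f :=
    have := (linearFunctor k C B).preservesKernels_ι f
    inferInstance
  preservesCokernels _ _ f :=
    have := (linearFunctor k C B).preservesCokernels_ι f
    inferInstance

lemma exactAt_ev {ι : Type*} {s : ComplexShape ι} {K : HomologicalComplex (LinFun k C B) s} {i : ι}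
    (h : K.ExactAt i) (c : C) : (((ev k B c).mapHomologicalComplex s).obj K).ExactAt i :=
  h.map (ev k B c)

/-- Evaluation commutes with homology, and a morphism of functors is determined by its components;
so the identity of the homology object is zero once every component is. -/
lemma exactAt_iff_ev {ι : Type*} {s : ComplexShape ι} (K : HomologicalComplex (LinFun k C B) s)
    (i : ι) : K.ExactAt i ↔ ∀ c, (((ev k B c).mapHomologicalComplex s).obj K).ExactAt i := by
  refine ⟨exactAt_ev, fun h => ?_⟩
  rw [HomologicalComplex.exactAt_iff, ShortComplex.exact_iff_isZero_homology,
    IsZero.iff_id_eq_zero]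
  ext c
  have h' : ((K.sc i).map (ev k B c)).Exact := h c
  rw [ShortComplex.exact_iff_isZero_homology] at h'
  exact (h'.of_iso ((K.sc i).mapHomologyIso (ev k B c)).symm).eq_of_tgt _ _

end Evaluation

/-! ### Tensoring right modules with free functors -/

namespace RightMod

variable {k : Type u} [CommRing k] {C : Type w} [Category.{u} C] [Preadditive C] [Linear k C]
variable {B : Type u₂} [Category.{v₂} B] [Abelian B] [Linear k B]
variable [IsLocallyBounded C] [IsHomFinite k C]

section

variable (N : RightMod k C) (Y : C → B)

/-- The universal family `N c ⟶ B(Y c, N ⊗_C i_!(Y))`. -/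
def tFreeι (c : C) : N c →ₗ[k] (Y c ⟶ (N.tensorFunctor B).obj (freeFunObj k Y)) :=
  Linear.leftComp k _ (freeι k Y c c (𝟙 c)) ∘ₗ N.tι (freeFunObj k Y) c

lemma freeι_tι {c d : C} (f : c ⟶ d) (x : N d) :
    freeι k Y c d f ≫ N.tι (freeFunObj k Y) d x = N.tFreeι Y c (N.act f x) := by
  simp [tFreeι, tι_act, freeι_map_assoc]

variable {N Y} in
-- Together with `tFreeDesc` this identifies `N ⊗_C i_!(Y)` with `⨁_c N c ⊗_k Y c`. Thus `k`-linear
-- maps between modules that ignore the action of `C` still induce morphisms between tensor products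
-- with free functors.
lemma tensor_free_hom_ext {X : B} {f g : (N.tensorFunctor B).obj (freeFunObj k Y) ⟶ X}
    (h : ∀ c x, N.tFreeι Y c x ≫ f = N.tFreeι Y c x ≫ g) : f = g :=
  tensor_hom_ext fun c x => free_hom_ext k _ _ _ fun c' m => by
    rw [← Category.assoc, ← Category.assoc, freeι_tι, h]

/-- The map out of `N ⊗_C i_!(Y)` given by a linear family. -/
def tFreeDesc {X : B} (h : ∀ c, N c →ₗ[k] (Y c ⟶ X)) :
    (N.tensorFunctor B).obj (freeFunObj k Y) ⟶ X :=
  N.tDesc _ (fun c =>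
    -- Balancedness forces the value: the component of `i_!(Y) c` indexed by `m : c' ⟶ c` must be
    -- sent by `h c' (x · m)`.
    { toFun := fun x => freeDesc k Y fun c' => h c' ∘ₗ N.act.flip x
      map_add' := fun x y => free_hom_ext k _ _ _ fun c' m => by
        rw [Preadditive.comp_add, freeι_desc, freeι_desc, freeι_desc]
        simp
      map_smul' := fun r x => free_hom_ext k _ _ _ fun c' m => by
        rw [RingHom.id_apply, Linear.comp_smul, freeι_desc, freeι_desc]
        simp })
    (fun c d f x => free_hom_ext k _ _ _ fun c' m => by
      rw [freeι_map_assoc]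
      simp [freeι_desc, act_comp])

lemma tFreeι_desc {X : B} (h : ∀ c, N c →ₗ[k] (Y c ⟶ X)) (c : C) (x : N c) :
    N.tFreeι Y c x ≫ N.tFreeDesc Y h = h c x := by
  simp [tFreeι, tFreeDesc, freeι_desc, act_id]

lemma tFreeι_homTensor {M : RightMod k C} (φ : Hom M N) (c : C) (x : M c) :
    M.tFreeι Y c x ≫ φ.tensor.app (freeFunObj k Y) = N.tFreeι Y c (φ.app c x) := by
  simp [tFreeι]

end

section

variable (N : RightMod k C)

lemma syzHom_coverHom (F : LinFun k C B) :
    N.syzHom.tensor.app F ≫ N.coverHom.tensor.app F = 0 :=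
  tensor_hom_ext fun c x => by
    rw [← Category.assoc, tι_homTensor, tι_homTensor, comp_zero]
    rw [coverHom_syzHom, map_zero]

/-- The sequence `syz N ⊗ F ⟶ cover N ⊗ F ⟶ N ⊗ F`. -/
abbrev tensorSeq (F : LinFun k C B) : ShortComplex B :=
  ShortComplex.mk _ _ (N.syzHom_coverHom F)

/-- The sequence `syz N ⊗ F ⟶ cover N ⊗ F ⟶ N ⊗ F` splits for free `F`. -/
def tensorSeqSplitting (Y : C → B) : (N.tensorSeq (freeFunObj k Y)).Splitting where
  -- The maps `syzProj` and `coverSection` split the sequence over `k` only, which suffices because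
  -- `F` is free.
  r := tFreeDesc _ _ fun c => N.syz.tFreeι Y c ∘ₗ N.syzProj c
  s := tFreeDesc _ _ fun c => N.cover.tFreeι Y c ∘ₗ N.coverSection c
  f_r := tensor_free_hom_ext fun c x => by
    rw [← Category.assoc, tFreeι_homTensor, tFreeι_desc, Category.comp_id, LinearMap.comp_apply,
      syzProj_syzHom]
  s_g := tensor_free_hom_ext fun c x => by
    rw [← Category.assoc, tFreeι_desc, LinearMap.comp_apply, tFreeι_homTensor,
      coverHom_coverSection, Category.comp_id]
  id := tensor_free_hom_ext fun c x => by
    rw [Preadditive.comp_add, ← Category.assoc, ← Category.assoc, tFreeι_homTensor, tFreeι_desc,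
      tFreeι_desc, LinearMap.comp_apply, LinearMap.comp_apply, tFreeι_homTensor, ← map_add,
      Category.comp_id, syzHom_syzProj, sub_add_cancel]

lemma tensorSeq_shortExact {F : LinFun k C B} {Y : C → B} (e : F ≅ freeFunObj k Y) :
    (N.tensorSeq F).ShortExact :=
  (ShortComplex.shortExact_iff_of_iso (ShortComplex.isoMk ((N.syz.tensorFunctor B).mapIso e)
    ((N.cover.tensorFunctor B).mapIso e) ((N.tensorFunctor B).mapIso e)
    (N.syzHom.tensor.naturality _) (N.coverHom.tensor.naturality _))).2
    (N.tensorSeqSplitting Y).shortExact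

end

end RightMod

/-! ### Dual bases of right modules and exactness of their tensor functors -/

namespace RightMod

variable {k : Type u} [CommRing k] {C : Type w} [Category.{u} C] [Preadditive C] [Linear k C]
variable {B : Type u₂} [Category.{v₂} B] [Abelian B] [Linear k B]

/-- A finite dual basis of a right module. -/
structure DualBasis (N : RightMod k C) where
  m : ℕ
  pt : Fin m → C
  gen : ∀ i, N (pt i)
  coord : ∀ i c, N c →ₗ[k] (c ⟶ pt i)
  coord_act : ∀ (i : Fin m) {c d : C} (f : c ⟶ d) (x : N d),
    coord i c (N.act f x) = f ≫ coord i d x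
  sum_eq : ∀ {c : C} (x : N c), ∑ i, N.act (coord i c x) (gen i) = x

variable [IsLocallyBounded C] [IsHomFinite k C]

/-- The dual basis of a free right module. -/
def freeDualBasis {m : ℕ} (pt : Fin m → C) : (free (k := k) pt).DualBasis where
  m := m
  pt := pt
  gen i := Function.update (0 : ∀ j, pt i ⟶ pt j) i (𝟙 (pt i))
  coord i c := (LinearMap.proj i : (∀ i, c ⟶ pt i) →ₗ[k] (c ⟶ pt i))
  coord_act _ _ _ _ _ := rfl
  sum_eq {c} x := funext fun j => by
    refine (Finset.sum_apply j Finset.univ _).trans ?_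
    rw [Finset.sum_eq_single j]
    · exact (congrArg (x j ≫ ·) (Function.update_self j (𝟙 (pt j))
        (0 : ∀ l, pt j ⟶ pt l))).trans (Category.comp_id _)
    · intro i _ hij
      exact (congrArg (x i ≫ ·) (Function.update_of_ne hij.symm (𝟙 (pt i))
        (0 : ∀ l, pt i ⟶ pt l))).trans comp_zero
    · intro h; exact absurd (Finset.mem_univ _) h

namespace DualBasis

variable {N : RightMod k C} (b : N.DualBasis)

variable (B) in
/-- The map from `N ⊗_C F` to `F (pt i)` given by a coordinate of a dual basis. -/
def tensorToEv (i : Fin b.m) : N.tensorFunctor B ⟶ ev k B (b.pt i) where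
  app F := N.tDesc F (fun c => F.obj.mapLinearMap k ∘ₗ b.coord i c) (fun c d f x => by
    simp [b.coord_act])
  naturality F G α := tensor_hom_ext fun c x => by
    rw [← Category.assoc, tι_map, Category.assoc, tι_desc, tι_desc_assoc]
    exact (α.hom.naturality _).symm

variable (B) in
/-- The map from `F (pt i)` to `N ⊗_C F` given by an element of a dual basis. -/
def evToTensor (i : Fin b.m) : ev k B (b.pt i) ⟶ N.tensorFunctor B where
  app F := N.tι F (b.pt i) (b.gen i)
  naturality _ _ α := (N.tι_map α _).symm

/-- The identity `x = ∑ᵢ gᵢ · coordᵢ(x)`, moved across the tensor product, exhibits `N ⊗_C -` as a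
direct summand of a finite sum of evaluations. The dual basis is independent of `B`, and this is how
information passes from `k`-modules to a general `B`. -/
lemma sum_tensorToEv (F : LinFun k C B) :
    ∑ i, (b.tensorToEv B i).app F ≫ (b.evToTensor B i).app F = 𝟙 _ :=
  tensor_hom_ext fun c x => by
    rw [Preadditive.comp_sum, Category.comp_id]
    conv_rhs => rw [← b.sum_eq x, map_sum]
    refine Finset.sum_congr rfl fun i _ => ?_
    rw [tι_act, ← Category.assoc]
    exact congrArg (· ≫ N.tι F (b.pt i) (b.gen i)) (N.tι_desc F _ _ c x)

lemma exactAt_tensor (b : N.DualBasis) {ι : Type*} {s : ComplexShape ι}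
    {K : HomologicalComplex (LinFun k C B) s} {i : ι} (h : K.ExactAt i) :
    (((N.tensorFunctor B).mapHomologicalComplex s).obj K).ExactAt i :=
  exactAt_of_sum_factors K i (fun i => ev k B (b.pt i)) (b.tensorToEv B) (b.evToTensor B)
    b.sum_tensorToEv fun j => exactAt_ev h (b.pt j)

end DualBasis

end RightMod

/-! ### Free resolutions and relative Tor -/

section

variable (k : Type u) [CommRing k] {C : Type w} [Category.{u} C] [Preadditive C] [Linear k C]
variable {B : Type u₂} [Category.{v₂} B] [Abelian B] [Linear k B]
variable [IsLocallyBounded C] [IsHomFinite k C]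

/-- The canonical resolution of `F` by objects in the image of `i_!`. -/
abbrev freeResolution (F : LinFun k C B) : ChainComplex (LinFun k C B) ℕ :=
  resolution (evalAll k C B ⋙ freeFun k C B) (freeAdj k C B).counit F

/-- The right adjoint `i^*` is faithful, so the counit is epimorphic. -/
lemma epi_freeAdj_counit (F : LinFun k C B) : Epi ((freeAdj k C B).counit.app F) :=
  have := (nakayama k C B).faithful
  inferInstance

lemma freeResolution_exactAt (F : LinFun k C B) {i : ℕ} (hi : 0 < i) :
    (freeResolution k F).ExactAt i := by
  obtain ⟨i, rfl⟩ := Nat.exists_eq_succ_of_ne_zero hi.ne'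
  exact resolution_exactAt_succ _ (epi_freeAdj_counit k) F i

end

namespace RightMod

variable {k : Type u} [CommRing k] {C : Type w} [Category.{u} C] [Preadditive C] [Linear k C]
variable {B : Type u₂} [Category.{v₂} B] [Abelian B] [Linear k B]
variable [IsLocallyBounded C] [IsHomFinite k C]

variable (B) in
/-- The relative `Tor_i(N, F)` vanish for all `F : C ⥤ B` and `i > n`. -/
def TorVanishesAbove (N : RightMod k C) (n : ℕ) : Prop :=
  ∀ (F : LinFun k C B) (i : ℕ), n < i →
    (((N.tensorFunctor B).mapHomologicalComplex _).obj (freeResolution k F)).ExactAt i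

lemma tensorSeq_freeResolution_shortExact (N : RightMod k C) (F : LinFun k C B) (i : ℕ) :
    (N.tensorSeq ((freeResolution k F).X i)).ShortExact := by
  obtain ⟨Y, ⟨e⟩⟩ := resolution_X (evalAll k C B ⋙ freeFun k C B) (freeAdj k C B).counit F i
  exact N.tensorSeq_shortExact (Y := (evalAll k C B).obj Y) e

/-- Dimension shift along `syz N ⟶ cover N ⟶ N`: the sequence is short exact on each free term of
the resolution, and the cover has a dual basis, so its Tor vanishes in positive degrees. -/
lemma torVanishesAbove_succ_iff (N : RightMod k C) (n : ℕ) :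
    N.TorVanishesAbove B (n + 1) ↔ N.syz.TorVanishesAbove B n := by
  -- Degree `0` is excluded, since exactness of the resolution is available in positive degrees
  -- only.
  have key : ∀ (F : LinFun k C B) (i : ℕ), 0 < i →
      ((((N.tensorFunctor B).mapHomologicalComplex _).obj (freeResolution k F)).ExactAt (i + 1) ↔
      (((N.syz.tensorFunctor B).mapHomologicalComplex _).obj (freeResolution k F)).ExactAt i) :=
    fun F i hi => exactAt_iff_of_shortExact N.syzHom.tensor N.coverHom.tensor (freeResolution k F)
      (fun _ => N.syzHom_coverHom _) (N.tensorSeq_freeResolution_shortExact F) (i + 1) i rfl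
      ((freeDualBasis _).exactAt_tensor (freeResolution_exactAt k F i.succ_pos))
      ((freeDualBasis _).exactAt_tensor (freeResolution_exactAt k F hi))
  constructor
  · intro h F i hi
    exact (key F i (by lia)).1 (h F (i + 1) (by lia))
  · intro h F i hi
    obtain ⟨i, rfl⟩ := Nat.exists_eq_succ_of_ne_zero (by lia : i ≠ 0)
    exact (key F i (by lia)).2 (h F i (by lia))

lemma DualBasis.torVanishesAbove {N : RightMod k C} (b : N.DualBasis) (n : ℕ) :
    N.TorVanishesAbove B n :=
  fun F _ hi => b.exactAt_tensor (freeResolution_exactAt k F (Nat.zero_lt_of_lt hi))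

end RightMod

/-- The vanishing of the `L_i ν` in terms of the right modules `D(C(c, -))`. -/
lemma leftDerived_isZero_iff (k : Type u) [CommRing k] {C : Type w} [Category.{u} C]
    [Preadditive C] [Linear k C] {B : Type u₂} [Category.{v₂} B] [Abelian B] [Linear k B]
    [IsLocallyBounded C] [IsHomFinite k C] (F : LinFun k C B) (i : ℕ) :
    IsZero ((nakayama k C B).leftDerivedObj i F) ↔ ∀ c : C,
      ((((RightMod.dual k c).tensorFunctor B).mapHomologicalComplex _).obj
        (freeResolution k F)).ExactAt i := by
  refine (HomologicalComplex.exactAt_iff_isZero_homology _ _).symm.trans ?_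
  refine (exactAt_iff_ev _ _).trans (forall_congr' fun c => ?_)
  exact exactAt_of_natIso (RightMod.nuEvIso c) _ _

namespace RightMod

variable {k : Type u} [CommRing k] {C : Type w} [Category.{u} C] [Preadditive C] [Linear k C]
variable {B : Type u₂} [Category.{v₂} B] [Abelian B] [Linear k B]
variable [IsLocallyBounded C] [IsHomFinite k C]

/-! ### Right exactness -/

section

variable (N : RightMod k C)

lemma epi_tensor_map {F G : LinFun k C B} (α : F ⟶ G) [Epi α] :
    Epi ((N.tensorFunctor B).map α) where
  left_cancellation f g h := tensor_hom_ext fun c x => by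
    have : Epi (α.hom.app c) := inferInstanceAs (Epi ((ev k B c).map α))
    rw [← cancel_epi (α.hom.app c), ← Category.assoc, ← Category.assoc, ← tι_map, Category.assoc,
      Category.assoc, h]

/-- Right exactness is read off from the universal property: a morphism from `N ⊗_C S.X₂` is a
balanced family, and it descends object by object along the cokernels `S.g`. -/
lemma tensor_map_exact {S : ShortComplex (LinFun k C B)} (hS : S.Exact) [Epi S.g] :
    (S.map (N.tensorFunctor B)).Exact := by
  have he : ∀ c, Epi (S.map (ev k B c)).g := fun c => inferInstanceAs (Epi ((ev k B c).map S.g))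
  have hx : ∀ c, (S.map (ev k B c)).Exact := fun c => hS.map (ev k B c)
  have key : ∀ {Z : B} (φ : (N.tensorFunctor B).obj S.X₂ ⟶ Z)
      (_ : (N.tensorFunctor B).map S.f ≫ φ = 0),
      ∃ ψ : (N.tensorFunctor B).obj S.X₃ ⟶ Z, (N.tensorFunctor B).map S.g ≫ ψ = φ := by
    intro Z φ hφ
    have h0 : ∀ c (x : N c), (S.map (ev k B c)).f ≫ N.tι S.X₂ c x ≫ φ = 0 := fun c x => by
      refine (Category.assoc _ _ _).symm.trans ?_
      refine (congrArg (· ≫ φ) (N.tι_map S.f x).symm).trans ?_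
      exact (Category.assoc _ _ _).trans ((congrArg (N.tι S.X₁ c x ≫ ·) hφ).trans comp_zero)
    -- The descended maps are unique because each component of `S.g` is epimorphic; hence they again
    -- form a linear, balanced family.
    let ψ : ∀ c (x : N c), S.X₃.obj.obj c ⟶ Z := fun c x => (hx c).desc _ (h0 c x)
    have hψ : ∀ c (x : N c), S.g.hom.app c ≫ ψ c x = N.tι S.X₂ c x ≫ φ := fun c x =>
      (hx c).g_desc _ (h0 c x)
    have ext : ∀ {c} {f g : S.X₃.obj.obj c ⟶ Z}, S.g.hom.app c ≫ f = S.g.hom.app c ≫ g → f = g :=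
      fun {c f g} h => (he c).left_cancellation f g h
    refine ⟨N.tDesc S.X₃ (fun c =>
      { toFun := ψ c
        map_add' := fun x y => ext (by simp [hψ, Preadditive.add_comp])
        map_smul' := fun r x => ext (by simp [hψ]) }) (fun c d f x => ext ?_),
      tensor_hom_ext fun c x => ?_⟩
    · simp only [LinearMap.coe_mk, AddHom.coe_mk, hψ, tι_act, Category.assoc]
      refine (congrArg (S.X₂.obj.map f ≫ ·) (hψ d x).symm).trans ?_
      exact (Category.assoc _ _ _).symm.trans ((congrArg (· ≫ ψ d x)
        (S.g.hom.naturality f)).trans (Category.assoc _ _ _))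
    · rw [← Category.assoc, tι_map, Category.assoc, tι_desc]
      exact hψ c x
  have := N.epi_tensor_map S.g
  exact ShortComplex.exact_of_g_is_cokernel _ (CokernelCofork.IsColimit.ofπ _ _
    (fun φ hφ => (key φ hφ).choose) (fun φ hφ => (key φ hφ).choose_spec)
    (fun φ hφ _ hψ => (cancel_epi ((N.tensorFunctor B).map S.g)).1
      (hψ.trans (key φ hφ).choose_spec.symm)))

/-- This is the exact sequence `Tor_1(N, F) ⟶ syz N ⊗ F ⟶ cover N ⊗ F`, obtained by a diagram chase
in the rows for `K₂`, `K₁`, `K₀` and `F`. Only the vanishing in degree one is used. -/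
lemma syz_tensor_injective (hN : N.TorVanishesAbove (ModuleCat.{u} k) 0)
    (F : LinFun k C (ModuleCat.{u} k)) (x : (N.syz.tensorFunctor (ModuleCat.{u} k)).obj F)
    (hx : N.syzHom.tensor.app F x = 0) : x = 0 := by
  let K := freeResolution k F
  let ε : K.X 0 ⟶ F := resolutionAugmentation _ _ F
  have hε : Epi ε := epi_freeAdj_counit k F
  have w : K.d 1 0 ≫ ε = 0 := resolution_d_comp_augmentation _ _ F
  have hK : (ShortComplex.mk _ _ w).Exact :=
    resolution_exact_augmentation _ (epi_freeAdj_counit k) F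
  have hS := fun i => N.tensorSeq_freeResolution_shortExact F i
  have hinj := fun i => (ModuleCat.mono_iff_injective _).1 (hS i).mono_f
  have hsurj := fun i => (ModuleCat.epi_iff_surjective _).1 (hS i).epi_g
  have hex : ∀ i (y : (N.cover.tensorFunctor (ModuleCat.{u} k)).obj (K.X i)),
      N.coverHom.tensor.app (K.X i) y = 0 → ∃ v, N.syzHom.tensor.app (K.X i) v = y := fun i =>
    (ShortComplex.moduleCat_exact_iff _).1 (hS i).exact
  have hTor : ∀ y : (N.tensorFunctor (ModuleCat.{u} k)).obj (K.X 1),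
      (N.tensorFunctor _).map (K.d 1 0) y = 0 → ∃ v, (N.tensorFunctor _).map (K.d 2 1) v = y := by
    have h1 := hN F 1 Nat.zero_lt_one
    rw [HomologicalComplex.exactAt_iff' _ 2 1 0 (by simp) (by simp),
      ShortComplex.moduleCat_exact_iff] at h1
    exact h1
  have hcov : ∀ y : (N.cover.tensorFunctor (ModuleCat.{u} k)).obj (K.X 0),
      (N.cover.tensorFunctor _).map ε y = 0 →
        ∃ v, (N.cover.tensorFunctor _).map (K.d 1 0) v = y :=
    (ShortComplex.moduleCat_exact_iff _).1
      (N.cover.tensor_map_exact (S := ShortComplex.mk _ _ w) hK)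
  have nat₁ : ∀ {G H : LinFun k C (ModuleCat.{u} k)} (α : G ⟶ H)
      (y : (N.syz.tensorFunctor (ModuleCat.{u} k)).obj G),
      N.syzHom.tensor.app H ((N.syz.tensorFunctor _).map α y) =
        (N.cover.tensorFunctor _).map α (N.syzHom.tensor.app G y) := fun α y =>
    ConcreteCategory.congr_hom (N.syzHom.tensor.naturality α) y
  have nat₂ : ∀ {G H : LinFun k C (ModuleCat.{u} k)} (α : G ⟶ H)
      (y : (N.cover.tensorFunctor (ModuleCat.{u} k)).obj G),
      N.coverHom.tensor.app H ((N.cover.tensorFunctor _).map α y) =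
        (N.tensorFunctor _).map α (N.coverHom.tensor.app G y) := fun α y =>
    ConcreteCategory.congr_hom (N.coverHom.tensor.naturality α) y
  have comp₁ : ∀ y : (N.syz.tensorFunctor (ModuleCat.{u} k)).obj (K.X 1),
      (N.syz.tensorFunctor _).map ε ((N.syz.tensorFunctor _).map (K.d 1 0) y) = 0 := fun y => by
    have := ConcreteCategory.congr_hom (congrArg (N.syz.tensorFunctor (ModuleCat.{u} k)).map w) y
    rwa [Functor.map_comp, Functor.map_zero] at this
  have comp₂ : ∀ y : (N.cover.tensorFunctor (ModuleCat.{u} k)).obj (K.X 2),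
      (N.cover.tensorFunctor _).map (K.d 1 0) ((N.cover.tensorFunctor _).map (K.d 2 1) y) = 0 :=
    fun y => by
    have := ConcreteCategory.congr_hom (congrArg (N.cover.tensorFunctor (ModuleCat.{u} k)).map
      (K.d_comp_d 2 1 0)) y
    rwa [Functor.map_comp, Functor.map_zero] at this
  have comp₃ : ∀ G (y : (N.syz.tensorFunctor (ModuleCat.{u} k)).obj G),
      N.coverHom.tensor.app G (N.syzHom.tensor.app G y) = 0 := fun G y =>
    ConcreteCategory.congr_hom (N.syzHom_coverHom G) y
  -- Lift `x` to `y` over `K₀`. Its image in `cover N ⊗ K₀` dies over `F`, so right exactness makes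
  -- it the boundary of some `z` over `K₁`.
  obtain ⟨y, rfl⟩ := (ModuleCat.epi_iff_surjective _).1 (N.syz.epi_tensor_map ε) x
  obtain ⟨z, hz⟩ := hcov (N.syzHom.tensor.app (K.X 0) y) ((nat₁ ε y).symm.trans hx)
  -- The image of `z` in `N ⊗ K₁` is a cycle, hence a boundary. Lifting the bounding element to
  -- `cover N ⊗ K₂` and subtracting its boundary moves `z` into `syz N ⊗ K₁`.
  obtain ⟨w₁, hw₁⟩ := hTor (N.coverHom.tensor.app (K.X 1) z)
    ((nat₂ (K.d 1 0) z).symm.trans ((congrArg _ hz).trans (comp₃ _ y)))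
  obtain ⟨w₂, rfl⟩ : ∃ w₂, N.coverHom.tensor.app (K.X 2) w₂ = w₁ := hsurj 2 w₁
  obtain ⟨v, hv⟩ := hex 1 (z - (N.cover.tensorFunctor _).map (K.d 2 1) w₂) (by
    rw [map_sub, sub_eq_zero]
    exact hw₁.symm.trans (nat₂ (K.d 2 1) w₂).symm)
  -- Injectivity over the free functor `K₀` shows that `y` is the boundary of `v`, so `y` maps to
  -- zero over `F`.
  have : (N.syz.tensorFunctor _).map (K.d 1 0) v = y := hinj 0 (by
    refine (nat₁ (K.d 1 0) v).trans ?_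
    rw [hv, map_sub, comp₂, sub_zero]
    exact hz)
  rw [← this]
  exact comp₁ v

end

end RightMod

/-! ### Flat right modules have dual bases -/

section Transpose

variable (k : Type u) [CommRing k] {C : Type w} [Category.{u} C] [Preadditive C] [Linear k C]
variable {m r : ℕ} {p : Fin m → C} {q : Fin r → C} (ω : ∀ j i, q j ⟶ p i)

/-- The map `⨁ᵢ C(pᵢ, c) ⟶ ⨁ⱼ C(qⱼ, c)` given by precomposition with a matrix. -/
def matrixPre (c : C) : (∀ i, p i ⟶ c) →ₗ[k] (∀ j, q j ⟶ c) :=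
  LinearMap.pi fun j => ∑ i, Linear.leftComp k c (ω j i) ∘ₗ LinearMap.proj i

lemma matrixPre_apply {c : C} (f : ∀ i, p i ⟶ c) (j : Fin r) :
    matrixPre k ω c f j = ∑ i, ω j i ≫ f i := by
  simp [matrixPre]

/-- The left module presented by a matrix. -/
def transpose : LinFun k C (ModuleCat.{u} k) where
  obj :=
    { obj := fun c => ModuleCat.of k ((∀ j, q j ⟶ c) ⧸ LinearMap.range (matrixPre k ω c))
      map := fun {c d} g => ModuleCat.ofHom (Submodule.mapQ _ _
        (LinearMap.pi fun j => Linear.rightComp k (q j) g ∘ₗ LinearMap.proj j) (by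
          rintro _ ⟨f, rfl⟩
          refine ⟨fun i => f i ≫ g, funext fun j => ?_⟩
          simp only [matrixPre_apply, LinearMap.pi_apply, LinearMap.comp_apply,
            LinearMap.proj_apply, Linear.rightComp_apply, Preadditive.sum_comp, Category.assoc]))
      map_id := fun c => ModuleCat.hom_ext (Submodule.linearMap_qext _ (LinearMap.ext fun x =>
        congrArg (Submodule.mkQ _) (funext fun j => Category.comp_id (x j))))
      map_comp := fun f g => ModuleCat.hom_ext (Submodule.linearMap_qext _ (LinearMap.ext fun x =>
        congrArg (Submodule.mkQ _) (funext fun j => (Category.assoc (x j) f g).symm))) }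
  property := ⟨⟨fun {_ _ f g} => ModuleCat.hom_ext (Submodule.linearMap_qext _
      (LinearMap.ext fun x => congrArg (Submodule.mkQ _)
        (funext fun j => Preadditive.comp_add _ _ _ (x j) f g)))⟩,
    ⟨fun f t => ModuleCat.hom_ext (Submodule.linearMap_qext _
      (LinearMap.ext fun x => congrArg (Submodule.mkQ _)
        (funext fun j => Linear.comp_smul _ _ _ (x j) t f)))⟩⟩

variable {k} in
/-- The element of the transpose given by a family of morphisms. -/
def transposeMk (c : C) : (∀ j, q j ⟶ c) →ₗ[k] (transpose k ω).obj.obj c :=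
  Submodule.mkQ (LinearMap.range (matrixPre k ω c))

lemma transpose_map_mk {c d : C} (g : c ⟶ d) (x : ∀ j, q j ⟶ c) :
    (transpose k ω).obj.map g (transposeMk ω c x) =
      transposeMk (k := k) ω d (fun j => x j ≫ g) := rfl

lemma transposeMk_surjective (c : C) : Function.Surjective (transposeMk (k := k) ω c) :=
  Submodule.mkQ_surjective _

/-- Column `i` of the matrix is the image under `matrixPre` of the basis vector with entry `𝟙 (p
i)`. -/
lemma transposeMk_matrix (i : Fin m) : transposeMk (k := k) ω (p i) (fun j => ω j i) = 0 := by
  refine (Submodule.Quotient.mk_eq_zero _).2 ⟨Pi.single i (𝟙 (p i)), funext fun j => ?_⟩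
  rw [matrixPre_apply, Finset.sum_eq_single i]
  · simp
  · intro l _ hl
    simp [hl]
  · intro h; exact absurd (Finset.mem_univ _) h

end Transpose

/-! ### Tensoring with the transpose, and splitting of flat modules -/

namespace RightMod

variable {k : Type u} [CommRing k] {C : Type w} [Category.{u} C] [Preadditive C] [Linear k C]
section

variable (M : RightMod k C) {m r : ℕ} {p : Fin m → C} {q : Fin r → C} (ω : ∀ j i, q j ⟶ p i)

/-- The map `⨁ᵢ M(pᵢ) ⟶ ⨁ⱼ M(qⱼ)` given by the action of a matrix. -/
def matrixAct : (∀ i, M (p i)) →ₗ[k] (∀ j, M (q j)) :=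
  LinearMap.pi fun j => ∑ i, M.act (ω j i) ∘ₗ LinearMap.proj i

lemma matrixAct_apply (x : ∀ i, M (p i)) (j : Fin r) :
    M.matrixAct ω x j = ∑ i, M.act (ω j i) (x i) := by
  simp [matrixAct]

/-- The evaluation `M(c) ⊗ (⨁ⱼ C(qⱼ, c)) ⟶ ⨁ⱼ M(qⱼ)` on the cokernels. -/
def transposeEval (c : C) : M c →ₗ[k] ((transpose k ω).obj.obj c ⟶
    ModuleCat.of k ((∀ j, M (q j)) ⧸ LinearMap.range (M.matrixAct ω))) where
  toFun x := ModuleCat.ofHom (Submodule.mapQ _ _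
    (LinearMap.pi fun j => M.act.flip x ∘ₗ LinearMap.proj j) (by
      rintro _ ⟨f, rfl⟩
      refine ⟨fun i => M.act (f i) x, funext fun j => ?_⟩
      simp [matrixPre_apply, matrixAct_apply, act_comp]))
  map_add' x y := by
    refine ModuleCat.hom_ext (LinearMap.ext fun t => ?_)
    obtain ⟨t, rfl⟩ := transposeMk_surjective k ω c t
    refine (congrArg (Submodule.mkQ (LinearMap.range (M.matrixAct ω)))
      (funext fun j => map_add (M.act (t j)) x y : _ = _ + _)).trans (map_add _ _ _)
  map_smul' s x := by
    refine ModuleCat.hom_ext (LinearMap.ext fun t => ?_)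
    obtain ⟨t, rfl⟩ := transposeMk_surjective k ω c t
    refine (congrArg (Submodule.mkQ (LinearMap.range (M.matrixAct ω)))
      (funext fun j => LinearMap.map_smul (M.act (t j)) s x : _ = s • _)).trans
        (LinearMap.map_smul _ _ _)

lemma transposeEval_mk {c : C} (x : M c) (t : ∀ j, q j ⟶ c) :
    M.transposeEval ω c x (transposeMk ω c t) =
      Submodule.mkQ (LinearMap.range (M.matrixAct ω)) (fun j => M.act (t j) x) := rfl

variable [IsLocallyBounded C] [IsHomFinite k C]

/-- The map from `M ⊗ transpose ω` to the cokernel of `matrixAct ω`. -/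
def tensorTransposeDesc : (M.tensorFunctor (ModuleCat.{u} k)).obj (transpose k ω) ⟶
    ModuleCat.of k ((∀ j, M (q j)) ⧸ LinearMap.range (M.matrixAct ω)) :=
  M.tDesc _ (M.transposeEval ω) (fun c d f x => by
    refine ModuleCat.hom_ext (LinearMap.ext fun t => ?_)
    obtain ⟨t, rfl⟩ := transposeMk_surjective k ω c t
    refine congrArg (Submodule.mkQ (LinearMap.range (M.matrixAct ω))) (funext fun j => ?_)
    exact (M.act_comp (t j) f x).symm)

/-- The elements `∑ⱼ xⱼ ⊗ eⱼ` of `M ⊗ transpose ω`. -/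
def tensorTransposeMk (x : ∀ j, M (q j)) :
    (M.tensorFunctor (ModuleCat.{u} k)).obj (transpose k ω) :=
  ∑ j, M.tι (transpose k ω) (q j) (x j) (transposeMk ω (q j) (Pi.single j (𝟙 (q j))))

/-- By right exactness `M ⊗ transpose ω` is the cokernel of `matrixAct ω`. Only one half is needed:
if `∑ⱼ xⱼ ⊗ eⱼ` vanishes, then `x` lies in the range of `matrixAct ω`. -/
lemma tensorTransposeDesc_mk (x : ∀ j, M (q j)) :
    M.tensorTransposeDesc ω (M.tensorTransposeMk ω x) =
      Submodule.mkQ (LinearMap.range (M.matrixAct ω)) x := by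
  have h : ∀ j, M.tensorTransposeDesc ω
      (M.tι (transpose k ω) (q j) (x j) (transposeMk ω (q j) (Pi.single j (𝟙 (q j))))) =
      Submodule.mkQ (LinearMap.range (M.matrixAct ω)) (Pi.single j (x j)) := fun j => by
    refine (ConcreteCategory.congr_hom (M.tι_desc (transpose k ω) (M.transposeEval ω) _ (q j) (x j))
      _).trans ?_
    refine (M.transposeEval_mk ω _ _).trans (congrArg _ (funext fun l => ?_))
    obtain rfl | hl := eq_or_ne l j
    · simp [act_id]
    · simp [hl]
  rw [tensorTransposeMk, map_sum, Finset.sum_congr rfl fun j _ => h j, ← map_sum]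
  exact congrArg _ (Finset.univ_sum_single x)

end

variable [IsLocallyBounded C] [IsHomFinite k C]
variable (N : RightMod k C)

/-- The matrix of a finite presentation of `N`. -/
def relMatrix (j : Fin N.syz.generators.m) (i : Fin N.generators.m) :
    N.syz.generators.pt j ⟶ N.generators.pt i :=
  N.syzHom.app _ (N.syz.generators.gen j) i

/-- In the cover the `j`-th generator of the syzygy is `∑ᵢ eᵢ · ωⱼᵢ`. Moving `ωⱼᵢ` across the tensor
product turns the element into `∑ᵢ eᵢ ⊗ (column i of ω)`, and these columns are zero in the
transpose. -/
lemma syzHom_tensorTransposeMk :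
    N.syzHom.tensor.app (transpose k N.relMatrix)
      (N.syz.tensorTransposeMk N.relMatrix N.syz.generators.gen) = 0 := by
  let e : ∀ i : Fin N.generators.m, N.cover (N.generators.pt i) :=
    (freeDualBasis N.generators.pt).gen
  have he : ∀ {c} (x : N.cover c), ∑ i, N.cover.act (x i) (e i) = x :=
    (freeDualBasis N.generators.pt).sum_eq
  have h : ∀ j, N.syzHom.tensor.app (transpose k N.relMatrix)
      (N.syz.tι (transpose k N.relMatrix) _ (N.syz.generators.gen j) (transposeMk N.relMatrix _
        (Pi.single j (𝟙 _)))) =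
      ∑ i, N.cover.tι (transpose k N.relMatrix) _ (e i)
        (transposeMk N.relMatrix _ (Pi.single j (N.relMatrix j i))) := fun j => by
    refine (ConcreteCategory.congr_hom (tι_homTensor N.syzHom (transpose k N.relMatrix) _)
      _).trans ?_
    have hj : N.cover.tι (transpose k N.relMatrix) _
        (N.syzHom.app _ (N.syz.generators.gen j)) =
        ∑ i, (transpose k N.relMatrix).obj.map (N.relMatrix j i) ≫
          N.cover.tι (transpose k N.relMatrix) _ (e i) := by
      rw [← he (N.syzHom.app _ (N.syz.generators.gen j)), map_sum]
      exact Finset.sum_congr rfl fun i _ => N.cover.tι_act _ _ _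
    refine (ConcreteCategory.congr_hom hj _).trans ?_
    refine (LinearMap.congr_fun (ModuleCat.hom_sum _ Finset.univ) _).trans ?_
    refine (LinearMap.sum_apply _ _ _).trans (Finset.sum_congr rfl fun i _ => ?_)
    refine congrArg (N.cover.tι (transpose k N.relMatrix) _ (e i)) ?_
    refine (transpose_map_mk k N.relMatrix _ _).trans (congrArg _ (funext fun l => ?_))
    obtain rfl | hl := eq_or_ne l j
    · simp
    · simp [hl]
  -- After the sums are exchanged, the inner sum over `j` assembles a whole column.
  rw [tensorTransposeMk, map_sum, Finset.sum_congr rfl fun j _ => h j, Finset.sum_comm]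
  refine Finset.sum_eq_zero fun i _ => ?_
  rw [← map_sum, ← map_sum, Finset.univ_sum_single, transposeMk_matrix, map_zero]

/-- By flatness the element `∑ⱼ genⱼ ⊗ eⱼ`, which dies in `cover N ⊗ transpose`, is already zero in
`syz N ⊗ transpose`. So the relations `genⱼ = ∑ᵢ gᵢ · ωⱼᵢ` can be solved inside the syzygy. -/
lemma exists_matrixAct_eq (hN : N.TorVanishesAbove (ModuleCat.{u} k) 0) :
    ∃ g, N.syz.matrixAct N.relMatrix g = N.syz.generators.gen := by
  have h := N.syz_tensor_injective hN _ _ N.syzHom_tensorTransposeMk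
  have h' := N.syz.tensorTransposeDesc_mk N.relMatrix N.syz.generators.gen
  rw [h, map_zero] at h'
  exact (Submodule.Quotient.mk_eq_zero _).1 h'.symm

/-- Sending the basis vector `eᵢ` of the cover to `gᵢ` takes `genⱼ = ∑ᵢ eᵢ · ωⱼᵢ` back to `genⱼ`. -/
lemma exists_retraction (hN : N.TorVanishesAbove (ModuleCat.{u} k) 0) :
    ∃ r : Hom N.cover N.syz, ∀ c (x : N.syz c), r.app c (N.syzHom.app c x) = x := by
  obtain ⟨g, hg⟩ := N.exists_matrixAct_eq hN
  refine ⟨freeHom _ _ g, fun c x => ?_⟩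
  obtain ⟨h, rfl⟩ := N.syz.generators.surj c x
  rw [map_sum, map_sum]
  refine Finset.sum_congr rfl fun j _ => ?_
  rw [Hom.map_act, Hom.map_act, freeHom_apply]
  exact congrArg _ ((N.syz.matrixAct_apply N.relMatrix g j).symm.trans (congrFun hg j))

/-- A retraction of the inclusion of the kernel of the cover yields a dual basis. -/
def dualBasisOfRetraction (r : Hom N.cover N.syz)
    (hr : ∀ c (x : N.syz c), r.app c (N.syzHom.app c x) = x) : N.DualBasis where
  m := N.generators.m
  pt := N.generators.pt
  gen := N.generators.gen
  -- Writing `σ` for the `k`-linear section, `ι` for the inclusion of the syzygy and `r` for its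
  -- retraction, the coordinates are those of the corrected section `σ - ι r σ`.
  coord i c := (LinearMap.proj i : (∀ i, c ⟶ N.generators.pt i) →ₗ[k] (c ⟶ N.generators.pt i)) ∘ₗ
    (N.coverSection c - N.syzHom.app c ∘ₗ r.app c ∘ₗ N.coverSection c)
  coord_act i c d f x := by
    -- The defect `σ(x · f) - σ(x) · f` lies in the syzygy, which `id - ι r` kills; so the corrected
    -- section respects the action.
    obtain ⟨y, hy⟩ := N.exists_syzHom_eq
      (x := N.coverSection c (N.act f x) - N.cover.act f (N.coverSection d x)) (by
        rw [map_sub, Hom.map_act, coverHom_coverSection, coverHom_coverSection, sub_self])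
    have h : N.coverSection c (N.act f x) = N.syzHom.app c y + N.cover.act f (N.coverSection d x) :=
      (sub_eq_iff_eq_add.1 hy.symm)
    have h2 : N.coverSection c (N.act f x) -
          N.syzHom.app c (r.app c (N.coverSection c (N.act f x))) =
        N.cover.act f (N.coverSection d x - N.syzHom.app d (r.app d (N.coverSection d x))) := by
      rw [h, map_add, map_add, hr, Hom.map_act, Hom.map_act, map_sub, add_sub_add_left_eq_sub]
    exact congrFun h2 i
  sum_eq {c} x := by
    refine (N.coverHom_apply
      (N.coverSection c x - N.syzHom.app c (r.app c (N.coverSection c x)))).symm.trans ?_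
    rw [map_sub, coverHom_coverSection, coverHom_syzHom, sub_zero]

lemma nonempty_dualBasis (hN : N.TorVanishesAbove (ModuleCat.{u} k) 0) : Nonempty N.DualBasis := by
  obtain ⟨r, hr⟩ := N.exists_retraction hN
  exact ⟨N.dualBasisOfRetraction r hr⟩

variable {N} in
-- Induction on `n` for all modules simultaneously. The dimension shift is applied over `k`-modules
-- in one direction and over `B` in the other; at `n = 0` the dual basis found over `k`-modules
-- serves for `B`.
lemma TorVanishesAbove.of_moduleCat {n : ℕ} (hN : N.TorVanishesAbove (ModuleCat.{u} k) n)
    {B : Type u₂} [Category.{v₂} B] [Abelian B] [Linear k B] : N.TorVanishesAbove B n := by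
  induction n generalizing N with
  | zero => exact (N.nonempty_dualBasis hN).some.torVanishesAbove 0
  | succ n ih => exact (N.torVanishesAbove_succ_iff n).2 (ih ((N.torVanishesAbove_succ_iff n).1 hN))

end RightMod

/-! ### Passage to general coefficients for the left derived functors -/

lemma leftDerived_isZero_of_moduleCat {k : Type u} [CommRing k] {C : Type w} [Category.{u} C]
    [Preadditive C] [Linear k C] [IsLocallyBounded C] [IsHomFinite k C] {n : ℕ}
    (h : ∀ i, n < i → ∀ F, IsZero ((nakayama k C (ModuleCat.{u} k)).leftDerivedObj i F))
    {B : Type u₂} [Category.{v₂} B] [Abelian B] [Linear k B] (i : ℕ) (hi : n < i)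
    (F : LinFun k C B) : IsZero ((nakayama k C B).leftDerivedObj i F) := by
  rw [leftDerived_isZero_iff]
  intro c
  have hc : (RightMod.dual k c).TorVanishesAbove (ModuleCat.{u} k) n := fun G j hj =>
    (leftDerived_isZero_iff k G j).1 (h j hj G) c
  exact hc.of_moduleCat F i hi

/-! ### Left modules over a linear category -/

/-- A left module over `C` (a linear functor `C ⥤ Mod k`) which is finitely generated projective
over `k` and nonzero at only finitely many objects. -/
structure LeftMod (k : Type u) [CommRing k] (C : Type w) [Category.{u} C] [Preadditive C]
    [Linear k C] where
  /-- the underlying family of modules -/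
  carrier : C → Type u
  [addCommGroup : ∀ c, AddCommGroup (carrier c)]
  [module : ∀ c, Module k (carrier c)]
  [finite : ∀ c, Module.Finite k (carrier c)]
  [projective : ∀ c, Module.Projective k (carrier c)]
  [finite_support : Finite {c // Nontrivial (carrier c)}]
  /-- the action `f, x ↦ f · x` -/
  act : ∀ {c d : C}, (c ⟶ d) →ₗ[k] carrier c →ₗ[k] carrier d
  act_id : ∀ {c : C} (x : carrier c), act (𝟙 c) x = x
  act_comp : ∀ {c d e : C} (f : c ⟶ d) (g : d ⟶ e) (x : carrier c),
    act (f ≫ g) x = act g (act f x)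

namespace LeftMod

variable {k : Type u} [CommRing k] {C : Type w} [Category.{u} C] [Preadditive C] [Linear k C]

instance : CoeFun (LeftMod k C) fun _ => C → Type u := ⟨carrier⟩

attribute [instance] addCommGroup module finite projective finite_support

/-- Morphisms of left modules. -/
structure Hom (M N : LeftMod k C) where
  /-- the components -/
  app : ∀ c, M c →ₗ[k] N c
  map_act : ∀ {c d : C} (f : c ⟶ d) (x : M c), app d (M.act f x) = N.act f (app c x)

/-- A finite family of generators of a left module. -/
structure Generators (N : LeftMod k C) where
  /-- the number of generators -/
  m : ℕ
  /-- the objects at which the generators live -/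
  pt : Fin m → C
  /-- the generators -/
  gen : ∀ i, N (pt i)
  surj : ∀ (d : C) (x : N d), ∃ h : ∀ i, pt i ⟶ d, ∑ i, N.act (h i) (gen i) = x

/-- As for right modules, dual bases over `k` at the finitely many objects of the support generate,
with scalar multiples of identities as coefficients. -/
lemma nonempty_generators (N : LeftMod k C) : Nonempty N.Generators := by
  obtain ⟨m, ⟨e⟩⟩ := Finite.exists_equiv_fin
    (Σ c : {c // Nontrivial (N c)}, Fin (finDualBasis k (N c.1)).n)
  refine ⟨⟨m, fun i => (e.symm i).1.1, fun i => (finDualBasis k (N (e.symm i).1.1)).x (e.symm i).2,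
    fun d x => ?_⟩⟩
  by_cases hd : Nontrivial (N d)
  · classical
    have := Fintype.ofFinite {c // Nontrivial (N c)}
    let h : ∀ j : Σ c : {c // Nontrivial (N c)}, Fin (finDualBasis k (N c.1)).n, j.1.1 ⟶ d :=
      fun j => if hj : j.1.1 = d then
        (finDualBasis k (N j.1.1)).ξ j.2 (N.act (eqToHom hj.symm) x) • eqToHom hj else 0
    refine ⟨fun i => h (e.symm i), ?_⟩
    rw [e.symm.sum_comp fun j => N.act (h j) ((finDualBasis k (N j.1.1)).x j.2),
      Fintype.sum_sigma, Finset.sum_eq_single ⟨d, hd⟩]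
    · simpa [h, act_id] using (finDualBasis k (N d)).sum_eq x
    · rintro ⟨c, hc⟩ - hne
      refine Finset.sum_eq_zero fun a _ => ?_
      simp [h, show c ≠ d from fun hcd => hne (Subtype.ext hcd)]
    · intro h'; exact absurd (Finset.mem_univ _) h'
  · have := not_nontrivial_iff_subsingleton.1 hd
    exact ⟨0, Subsingleton.elim _ _⟩

/-- A chosen finite family of generators. -/
def generators (N : LeftMod k C) : N.Generators := N.nonempty_generators.some

variable [IsLocallyBounded C] [IsHomFinite k C]

/-- The left module `D(C(-, c))`. -/
@[simps]
def dual (k : Type u) [CommRing k] {C : Type w} [Category.{u} C] [Preadditive C] [Linear k C]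
    [IsLocallyBounded C] [IsHomFinite k C] (c : C) : LeftMod k C where
  carrier d := Module.Dual k (d ⟶ c)
  act := LinearMap.mk₂ k (fun f ξ => dualPre k f c ξ) (dualPre_add k) (dualPre_smul k)
    (fun _ _ _ => map_add _ _ _) (fun _ _ _ => LinearMap.map_smul _ _ _)
  act_id := dualPre_id k
  act_comp := dualPre_comp k

/-- The left module `⨁ᵢ C(cᵢ, -)`. -/
def free {m : ℕ} (pt : Fin m → C) : LeftMod k C where
  carrier d := ∀ i, pt i ⟶ d
  projective d := projective_pi fun i => (pt i ⟶ d)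
  finite_support := finite_support_pi _ fun i => IsLocallyBounded.finite_out (pt i)
  act := LinearMap.mk₂ k (fun f h i => h i ≫ f)
    (fun _ _ _ => funext fun _ => Preadditive.comp_add _ _ _ _ _ _)
    (fun _ _ _ => funext fun _ => Linear.comp_smul _ _ _ _ _ _)
    (fun _ _ _ => funext fun _ => Preadditive.add_comp _ _ _ _ _ _)
    (fun _ _ _ => funext fun _ => Linear.smul_comp _ _ _ _ _ _)
  act_id _ := funext fun _ => Category.comp_id _
  act_comp _ _ _ := funext fun _ => (Category.assoc _ _ _).symm

/-- The free left module on the chosen generators. -/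
abbrev cover (N : LeftMod k C) : LeftMod k C := free N.generators.pt

/-- The morphism from a free left module given by the images of the generators. -/
def freeHom {m : ℕ} (pt : Fin m → C) (N : LeftMod k C) (g : ∀ i, N (pt i)) :
    Hom (free pt) N where
  app d := ∑ i, (N.act.flip (g i)) ∘ₗ (LinearMap.proj i : (∀ i, pt i ⟶ d) →ₗ[k] (pt i ⟶ d))
  map_act f h := by
    rw [LinearMap.sum_apply, LinearMap.sum_apply, map_sum]
    exact Finset.sum_congr rfl fun i _ => N.act_comp _ _ _

lemma freeHom_apply {m : ℕ} (pt : Fin m → C) (N : LeftMod k C) (g : ∀ i, N (pt i)) {d : C}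
    (h : free (k := k) pt d) : (freeHom pt N g).app d h = ∑ i, N.act (h i) (g i) :=
  LinearMap.sum_apply _ _ _

/-- The projection from the free left module on the chosen generators. -/
def coverHom (N : LeftMod k C) : Hom N.cover N := freeHom _ N N.generators.gen

lemma coverHom_apply (N : LeftMod k C) {d : C} (h : N.cover d) :
    N.coverHom.app d h = ∑ i, N.act (h i) (N.generators.gen i) := freeHom_apply _ _ _ h

lemma coverHom_surjective (N : LeftMod k C) (d : C) : Function.Surjective (N.coverHom.app d) :=
  fun x => by
    obtain ⟨h, hh⟩ := N.generators.surj d x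
    exact ⟨h, (N.coverHom_apply h).trans hh⟩

lemma exists_coverSection (N : LeftMod k C) (d : C) :
    ∃ σ : N d →ₗ[k] N.cover d, N.coverHom.app d ∘ₗ σ = LinearMap.id :=
  Module.projective_lifting_property _ _ (N.coverHom_surjective d)

/-- A `k`-linear section of the cover. -/
def coverSection (N : LeftMod k C) (d : C) : N d →ₗ[k] N.cover d := (N.exists_coverSection d).choose

lemma coverHom_coverSection (N : LeftMod k C) (d : C) (x : N d) :
    N.coverHom.app d (N.coverSection d x) = x :=
  LinearMap.congr_fun (N.exists_coverSection d).choose_spec x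

/-- The `k`-linear projection onto the kernel of the cover. -/
def kerProj (N : LeftMod k C) (d : C) : N.cover d →ₗ[k] LinearMap.ker (N.coverHom.app d) :=
  LinearMap.codRestrict _ (LinearMap.id - N.coverSection d ∘ₗ N.coverHom.app d) fun x => by
    simp only [LinearMap.mem_ker, LinearMap.sub_apply, LinearMap.comp_apply, map_sub,
      coverHom_coverSection, LinearMap.id_apply, sub_self]

lemma kerProj_subtype (N : LeftMod k C) (d : C) (x : LinearMap.ker (N.coverHom.app d)) :
    N.kerProj d x = x :=
  Subtype.ext (by
    have := LinearMap.mem_ker.1 x.2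
    simp [kerProj, this])

lemma kerProj_surjective (N : LeftMod k C) (d : C) : Function.Surjective (N.kerProj d) :=
  fun x => ⟨x, N.kerProj_subtype d x⟩

/-- The kernel of the cover. -/
def syz (N : LeftMod k C) : LeftMod k C where
  carrier d := LinearMap.ker (N.coverHom.app d)
  -- Again a direct summand of the cover over `k`, so the syzygy is of the same kind.
  finite d := Module.Finite.of_surjective (N.kerProj d) (N.kerProj_surjective d)
  projective d := Module.Projective.of_split (Submodule.subtype _) (N.kerProj d)
    (LinearMap.ext (N.kerProj_subtype d))
  finite_support := finite_support_of_surjective N.kerProj N.kerProj_surjective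
  act {c d} := LinearMap.mk₂ k (fun f x => ⟨N.cover.act f x.1, by
      have := LinearMap.mem_ker.1 x.2
      rw [LinearMap.mem_ker, Hom.map_act, this, map_zero]⟩)
    (fun _ _ _ => Subtype.ext (LinearMap.map_add₂ _ _ _ _))
    (fun _ _ _ => Subtype.ext (LinearMap.map_smul₂ _ _ _ _))
    (fun _ _ _ => Subtype.ext (map_add _ _ _))
    (fun _ _ _ => Subtype.ext (LinearMap.map_smul _ _ _))
  act_id _ := Subtype.ext (act_id _ _)
  act_comp _ _ _ := Subtype.ext (act_comp _ _ _ _)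

/-- The inclusion of the kernel of the cover. -/
def syzHom (N : LeftMod k C) : Hom N.syz N.cover where
  app _ := Submodule.subtype _
  map_act _ _ := rfl

/-- The `k`-linear projection onto `syz N`. -/
def syzProj (N : LeftMod k C) (d : C) : N.cover d →ₗ[k] N.syz d := N.kerProj d

lemma syzProj_syzHom (N : LeftMod k C) {d : C} (x : N.syz d) :
    N.syzProj d (N.syzHom.app d x) = x := N.kerProj_subtype d x

lemma syzHom_syzProj (N : LeftMod k C) {d : C} (x : N.cover d) :
    N.syzHom.app d (N.syzProj d x) = x - N.coverSection d (N.coverHom.app d x) := rfl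

lemma coverHom_syzHom (N : LeftMod k C) {d : C} (x : N.syz d) :
    N.coverHom.app d (N.syzHom.app d x) = 0 := x.2

lemma exists_syzHom_eq (N : LeftMod k C) {d : C} {x : N.cover d} (hx : N.coverHom.app d x = 0) :
    ∃ y, N.syzHom.app d y = x := ⟨⟨x, hx⟩, rfl⟩

end LeftMod

/-! ### Objects of morphisms from left modules to functors -/

namespace LeftMod

variable {k : Type u} [CommRing k] {C : Type w} [Category.{u} C] [Preadditive C] [Linear k C]
variable {B : Type u₂} [Category.{v₂} B] [Abelian B] [Linear k B]

/-- The object `Hom_C(N, F)`: maps from `X` correspond to morphisms of left modules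
`N ⟶ B(X, F -)`. -/
structure Cotensor (N : LeftMod k C) (F : LinFun k C B) where
  pt : B
  π : ∀ c : C, N c →ₗ[k] (pt ⟶ F.obj.obj c)
  w : ∀ {c d : C} (f : c ⟶ d) (x : N c), π d (N.act f x) = π c x ≫ F.obj.map f
  lift : ∀ {X : B} (h : ∀ c : C, N c →ₗ[k] (X ⟶ F.obj.obj c))
    (_ : ∀ (c d : C) (f : c ⟶ d) (x : N c), h d (N.act f x) = h c x ≫ F.obj.map f), X ⟶ pt
  fac : ∀ {X : B} (h : ∀ c : C, N c →ₗ[k] (X ⟶ F.obj.obj c))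
    (hw : ∀ (c d : C) (f : c ⟶ d) (x : N c), h d (N.act f x) = h c x ≫ F.obj.map f)
    (c : C) (x : N c), lift h hw ≫ π c x = h c x
  hom_ext : ∀ {X : B} (f g : X ⟶ pt), (∀ c x, f ≫ π c x = g ≫ π c x) → f = g

variable [IsLocallyBounded C] [IsHomFinite k C]

section

variable (N : LeftMod k C) (F : LinFun k C B)

open TensorProduct in
instance : Finite {p : C × C // Nontrivial (N p.1 ⊗[k] (p.1 ⟶ p.2))} := by
  have h : {p : C × C | Nontrivial (N p.1 ⊗[k] (p.1 ⟶ p.2))} ⊆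
      ⋃ c ∈ {c : C | Nontrivial (N c)}, (fun d => (c, d)) '' {d : C | Nontrivial (c ⟶ d)} := by
    rintro ⟨c, d⟩ (h : Nontrivial _)
    simp only [Set.mem_iUnion]
    refine ⟨c, ?_, d, ?_, rfl⟩ <;>
    · by_contra h'
      have := not_nontrivial_iff_subsingleton.1 h'
      exact not_subsingleton (N c ⊗[k] (c ⟶ d)) inferInstance
  exact (Set.Finite.biUnion (s := {c | Nontrivial (N c)}) N.finite_support fun c _ =>
    (IsLocallyBounded.finite_out c).image _).subset h

open TensorProduct in
/-- The relations which present `Hom_C(N, F)`. -/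
def cotensorRel :
    (famCotensor k N.carrier F.obj.obj).pt ⟶
    (famCotensor k (fun p : C × C => N p.1 ⊗[k] (p.1 ⟶ p.2)) (fun p => F.obj.obj p.2)).pt :=
  FamCotensor.lift _ fun p => TensorProduct.lift (LinearMap.mk₂ k
    (fun x f => (famCotensor k N.carrier F.obj.obj).π p.2 (N.act f x) -
      (famCotensor k N.carrier F.obj.obj).π p.1 x ≫ F.obj.map f)
    (fun x x' f => by simp [Preadditive.add_comp]; abel)
    (fun r x f => by simp [smul_sub])
    (fun x f f' => by simp [Preadditive.comp_add]; abel)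
    (fun r x f => by simp [smul_sub]))

lemma cotensorRel_fac {c d : C} (f : c ⟶ d) (x : N c) :
    cotensorRel N F ≫ (famCotensor k (fun p : C × C => TensorProduct k (N p.1) (p.1 ⟶ p.2))
      (fun p => F.obj.obj p.2)).π (c, d) (x ⊗ₜ f) =
    (famCotensor k N.carrier F.obj.obj).π d (N.act f x) -
      (famCotensor k N.carrier F.obj.obj).π c x ≫ F.obj.map f := by
  rw [cotensorRel, FamCotensor.fac]; simp

/-- Existence of `Hom_C(N, F)`. -/
def cotensor : Cotensor N F where
  pt := kernel (cotensorRel N F)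
  π c := Linear.leftComp k _ (kernel.ι (cotensorRel N F)) ∘ₗ
    (famCotensor k N.carrier F.obj.obj).π c
  w {c d} f x := by
    have := kernel.condition (cotensorRel N F) =≫
      (famCotensor k (fun p : C × C => TensorProduct k (N p.1) (p.1 ⟶ p.2))
      (fun p => F.obj.obj p.2)).π (c, d) (x ⊗ₜ f)
    rw [zero_comp, Category.assoc, cotensorRel_fac] at this
    simpa [Preadditive.comp_sub, sub_eq_zero] using this
  lift h hw := kernel.lift _ (FamCotensor.lift _ h) (FamCotensor.hom_ext _ _ _ fun p m => by
    rw [cotensorRel, Category.assoc, FamCotensor.fac, zero_comp]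
    induction m using TensorProduct.induction_on with
    | zero => simp
    | add x y hx hy => simp [Preadditive.comp_add, hx, hy]
    | tmul x f =>
      simp only [TensorProduct.lift.tmul, LinearMap.mk₂_apply, Preadditive.comp_sub,
        FamCotensor.fac, hw, ← Category.assoc, sub_self])
  fac h hw c x := by simp [FamCotensor.fac]
  hom_ext f g hfg := by
    rw [← cancel_mono (kernel.ι _)]
    refine FamCotensor.hom_ext _ _ _ fun c x => ?_
    simpa using hfg c x

attribute [irreducible] cotensor

end

variable (B) in
/-- The functor `Hom_C(N, -)`. -/
def homFunctor (N : LeftMod k C) : LinFun k C B ⥤ B where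
  obj F := (N.cotensor F).pt
  map {F G} α := (N.cotensor G).lift
    (fun c => Linear.rightComp k _ (α.hom.app c) ∘ₗ (N.cotensor F).π c)
    (fun c d f x => by
      simp only [LinearMap.comp_apply, Linear.rightComp_apply, Cotensor.w]
      rw [Category.assoc, Category.assoc, α.hom.naturality])
  map_id F := (N.cotensor F).hom_ext _ _ fun c x => by
    rw [Cotensor.fac]
    simp
  map_comp α β := (N.cotensor _).hom_ext _ _ fun c x => by
    rw [Cotensor.fac, Category.assoc, Cotensor.fac]
    simp only [LinearMap.comp_apply, Linear.rightComp_apply]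
    rw [← Category.assoc, Cotensor.fac]
    simp

section

variable (N : LeftMod k C) (F : LinFun k C B)

/-- The universal family `N c ⟶ B(Hom_C(N, F), F c)`. -/
def hπ (c : C) : N c →ₗ[k] ((N.homFunctor B).obj F ⟶ F.obj.obj c) := (N.cotensor F).π c

lemma hπ_act {c d : C} (f : c ⟶ d) (x : N c) :
    N.hπ F d (N.act f x) = N.hπ F c x ≫ F.obj.map f := (N.cotensor F).w f x

variable {N F} in
lemma hom_hom_ext {X : B} {f g : X ⟶ (N.homFunctor B).obj F}
    (h : ∀ c x, f ≫ N.hπ F c x = g ≫ N.hπ F c x) : f = g := (N.cotensor F).hom_ext f g h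

/-- The map to `Hom_C(N, F)` given by a natural family. -/
def hLift {X : B} (h : ∀ c : C, N c →ₗ[k] (X ⟶ F.obj.obj c))
    (hw : ∀ (c d : C) (f : c ⟶ d) (x : N c), h d (N.act f x) = h c x ≫ F.obj.map f) :
    X ⟶ (N.homFunctor B).obj F := (N.cotensor F).lift h hw

@[simp]
lemma hLift_π {X : B} (h : ∀ c : C, N c →ₗ[k] (X ⟶ F.obj.obj c))
    (hw : ∀ (c d : C) (f : c ⟶ d) (x : N c), h d (N.act f x) = h c x ≫ F.obj.map f)
    (c : C) (x : N c) : N.hLift F h hw ≫ N.hπ F c x = h c x := (N.cotensor F).fac h hw c x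

end

lemma map_hπ (N : LeftMod k C) {F G : LinFun k C B} (α : F ⟶ G) {c : C} (x : N c) :
    (N.homFunctor B).map α ≫ N.hπ G c x = N.hπ F c x ≫ α.hom.app c :=
  (N.cotensor G).fac _ _ _ _

instance (N : LeftMod k C) : (N.homFunctor B).Additive where
  map_add {F G α β} := hom_hom_ext fun c x => by
    rw [Preadditive.add_comp, map_hπ, map_hπ, map_hπ]
    exact Preadditive.comp_add _ _ _ _ _ _

/-- Functoriality of `Hom_C(N, -)` in `N`. -/
@[simps]
def Hom.precomp {M N : LeftMod k C} (φ : Hom M N) : N.homFunctor B ⟶ M.homFunctor B where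
  app F := M.hLift F (fun c => N.hπ F c ∘ₗ φ.app c) (fun c d f x => by
    simp only [LinearMap.comp_apply, φ.map_act, hπ_act])
  naturality F G α := hom_hom_ext fun c x => by
    rw [Category.assoc, hLift_π, Category.assoc, map_hπ, ← Category.assoc, hLift_π]
    simp [map_hπ]

lemma homPrecomp_hπ {M N : LeftMod k C} (φ : Hom M N) (F : LinFun k C B) {c : C} (x : M c) :
    φ.precomp.app F ≫ M.hπ F c x = N.hπ F c (φ.app c x) := by simp

section

variable (c : C) (F : LinFun k C B)

/-- The comparison map from `Hom_C(D(C(-, c)), F)` to `ν⁻(F) c`. -/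
def homToNuMinus : ((dual k c).homFunctor B).obj F ⟶ (nuMinusObj k F).obj.obj c :=
  nuMinusLift k F ((dual k c).hπ F) (fun _ _ f ξ => (dual k c).hπ_act F f ξ)

/-- The comparison map from `ν⁻(F) c` to `Hom_C(D(C(-, c)), F)`. -/
def nuMinusToHom : (nuMinusObj k F).obj.obj c ⟶ ((dual k c).homFunctor B).obj F :=
  (dual k c).hLift F (fun c' => nuMinusπ k F c c') (fun _ _ f ξ => (nuMinusπ_w k F c f ξ).symm)

lemma homToNuMinus_π {c' : C} (ξ : Module.Dual k (c' ⟶ c)) :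
    homToNuMinus c F ≫ nuMinusπ k F c c' ξ = (dual k c).hπ F c' ξ :=
  nuMinusLift_π k F _ _ c' ξ

lemma nuMinusToHom_hπ {c' : C} (ξ : Module.Dual k (c' ⟶ c)) :
    nuMinusToHom c F ≫ (dual k c).hπ F c' ξ = nuMinusπ k F c c' ξ :=
  (dual k c).hLift_π F _ _ c' ξ

end

/-- The functor `ν⁻`, evaluated at `c`, is `Hom_C(D(C(-, c)), -)`. -/
def nuMinusEvIso (c : C) :
    nuMinusFunctor k C B ⋙ (linearFunctor k C B).ι ⋙ (evaluation C B).obj c ≅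
      (dual k c).homFunctor B :=
  NatIso.ofComponents (fun F =>
    { hom := nuMinusToHom c F
      inv := homToNuMinus c F
      hom_inv_id := nuMinus_hom_ext k F _ _ fun _ ξ =>
        (Category.assoc _ _ _).trans ((congrArg (nuMinusToHom c F ≫ ·)
          (homToNuMinus_π c F ξ)).trans ((nuMinusToHom_hπ c F ξ).trans (Category.id_comp _).symm))
      inv_hom_id := hom_hom_ext fun _ ξ =>
        (Category.assoc _ _ _).trans ((congrArg (homToNuMinus c F ≫ ·)
          (nuMinusToHom_hπ c F ξ)).trans ((homToNuMinus_π c F ξ).trans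
            (Category.id_comp _).symm)) })
    fun {F G} α => hom_hom_ext fun c' ξ =>
      (Category.assoc _ _ _).trans ((congrArg ((nuMinusMap k α).hom.app c ≫ ·)
        (nuMinusToHom_hπ c G ξ)).trans ((nuMinusMap_π k α ξ).trans
          ((congrArg (· ≫ α.hom.app c') (nuMinusToHom_hπ c F ξ).symm).trans
            ((Category.assoc _ _ _).trans ((congrArg (nuMinusToHom c F ≫ ·)
              ((dual k c).map_hπ α ξ).symm).trans (Category.assoc _ _ _).symm)))))

end LeftMod

/-! ### Morphisms from left modules to cofree functors -/

namespace LeftMod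

variable {k : Type u} [CommRing k] {C : Type w} [Category.{u} C] [Preadditive C] [Linear k C]
variable {B : Type u₂} [Category.{v₂} B] [Abelian B] [Linear k B]
variable [IsLocallyBounded C] [IsHomFinite k C]

section

variable (N : LeftMod k C) (Y : C → B)

/-- The universal family `N c ⟶ B(Hom_C(N, i_*(Y)), Y c)`. -/
def hCofreeπ (c : C) : N c →ₗ[k] ((N.homFunctor B).obj (nuObj k (freeFunObj k Y)) ⟶ Y c) :=
  Linear.rightComp k _ (starEv k Y c c (𝟙 c)) ∘ₗ N.hπ (nuObj k (freeFunObj k Y)) c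

lemma hπ_starEv {c d : C} (f : c ⟶ d) (x : N c) :
    N.hπ (nuObj k (freeFunObj k Y)) c x ≫ starEv k Y c d f = N.hCofreeπ Y d (N.act f x) := by
  rw [hCofreeπ, LinearMap.comp_apply, Linear.rightComp_apply, hπ_act, Category.assoc, map_starEv,
    Category.comp_id]

variable {N Y} in
-- Together with `hCofreeLift` this identifies `Hom_C(N, i_*(Y))` with `∏_c Hom_k(N c, Y c)`, so on
-- cofree functors only the `k`-module structure of `N` matters.
lemma hom_cofree_hom_ext {X : B} {f g : X ⟶ (N.homFunctor B).obj (nuObj k (freeFunObj k Y))}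
    (h : ∀ c x, f ≫ N.hCofreeπ Y c x = g ≫ N.hCofreeπ Y c x) : f = g :=
  hom_hom_ext fun c x => star_hom_ext' k _ _ _ fun c' m => by
    rw [Category.assoc, Category.assoc, hπ_starEv, h]

/-- The map to `Hom_C(N, i_*(Y))` given by a linear family. -/
def hCofreeLift {X : B} (h : ∀ c, N c →ₗ[k] (X ⟶ Y c)) :
    X ⟶ (N.homFunctor B).obj (nuObj k (freeFunObj k Y)) :=
  N.hLift _ (fun c =>
    { toFun := fun x => starLift k Y fun c' => h c' ∘ₗ N.act.flip x
      map_add' := fun x y => star_hom_ext' k _ _ _ fun c' m => by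
        rw [Preadditive.add_comp, starLift_ev, starLift_ev, starLift_ev]
        simp
      map_smul' := fun r x => star_hom_ext' k _ _ _ fun c' m => by
        rw [RingHom.id_apply, Linear.smul_comp, starLift_ev, starLift_ev]
        simp })
    (fun c d f x => star_hom_ext' k _ _ _ fun c' m => by
      rw [Category.assoc, map_starEv]
      simp [starLift_ev, act_comp])

lemma hCofreeLift_π {X : B} (h : ∀ c, N c →ₗ[k] (X ⟶ Y c)) (c : C) (x : N c) :
    N.hCofreeLift Y h ≫ N.hCofreeπ Y c x = h c x := by
  rw [hCofreeπ, LinearMap.comp_apply, Linear.rightComp_apply, ← Category.assoc, hCofreeLift,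
    hLift_π]
  simp [starLift_ev, act_id]

lemma homPrecomp_hCofreeπ {M : LeftMod k C} (φ : Hom M N) (c : C) (x : M c) :
    φ.precomp.app (nuObj k (freeFunObj k Y)) ≫ M.hCofreeπ Y c x = N.hCofreeπ Y c (φ.app c x) := by
  rw [hCofreeπ, LinearMap.comp_apply, Linear.rightComp_apply, ← Category.assoc, homPrecomp_hπ]
  rfl

end

section

variable (N : LeftMod k C)

lemma coverHom_syzHom_precomp (F : LinFun k C B) :
    N.coverHom.precomp.app F ≫ N.syzHom.precomp.app F = 0 :=
  hom_hom_ext fun c x => by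
    rw [Category.assoc, homPrecomp_hπ, homPrecomp_hπ, zero_comp]
    rw [coverHom_syzHom, map_zero]

/-- The sequence `Hom(N, F) ⟶ Hom(cover N, F) ⟶ Hom(syz N, F)`. -/
abbrev homSeq (F : LinFun k C B) : ShortComplex B :=
  ShortComplex.mk _ _ (N.coverHom_syzHom_precomp F)

/-- The sequence `Hom(N, F) ⟶ Hom(cover N, F) ⟶ Hom(syz N, F)` splits for cofree `F`. -/
def homSeqSplitting (Y : C → B) : (N.homSeq (nuObj k (freeFunObj k Y))).Splitting where
  -- The splitting of the cover over `k` suffices because `F` is cofree; `r` and `s` come from the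
  -- section and the projection by precomposition.
  r := hCofreeLift _ _ fun c => N.cover.hCofreeπ Y c ∘ₗ N.coverSection c
  s := hCofreeLift _ _ fun c => N.syz.hCofreeπ Y c ∘ₗ N.syzProj c
  f_r := hom_cofree_hom_ext fun c x => by
    rw [Category.assoc, hCofreeLift_π, LinearMap.comp_apply, homPrecomp_hCofreeπ, Category.id_comp,
      coverHom_coverSection]
  s_g := hom_cofree_hom_ext fun c x => by
    rw [Category.assoc, homPrecomp_hCofreeπ, hCofreeLift_π, LinearMap.comp_apply, syzProj_syzHom,
      Category.id_comp]
  id := hom_cofree_hom_ext fun c x => by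
    rw [Preadditive.add_comp, Category.assoc, Category.assoc, homPrecomp_hCofreeπ, hCofreeLift_π,
      hCofreeLift_π, LinearMap.comp_apply, LinearMap.comp_apply, homPrecomp_hCofreeπ, ← map_add,
      Category.id_comp, syzHom_syzProj, add_sub_cancel]

lemma homSeq_shortExact {F : LinFun k C B} {Y : C → B} (e : F ≅ nuObj k (freeFunObj k Y)) :
    (N.homSeq F).ShortExact :=
  (ShortComplex.shortExact_iff_of_iso (ShortComplex.isoMk ((N.homFunctor B).mapIso e)
    ((N.cover.homFunctor B).mapIso e) ((N.syz.homFunctor B).mapIso e)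
    (N.coverHom.precomp.naturality _) (N.syzHom.precomp.naturality _))).2
    (N.homSeqSplitting Y).shortExact

end

end LeftMod

/-! ### Dual bases of left modules and exactness of their Hom functors -/

namespace LeftMod

variable {k : Type u} [CommRing k] {C : Type w} [Category.{u} C] [Preadditive C] [Linear k C]
variable {B : Type u₂} [Category.{v₂} B] [Abelian B] [Linear k B]

/-- A finite dual basis of a left module. -/
structure DualBasis (N : LeftMod k C) where
  m : ℕ
  pt : Fin m → C
  gen : ∀ i, N (pt i)
  coord : ∀ i c, N c →ₗ[k] (pt i ⟶ c)
  coord_act : ∀ (i : Fin m) {c d : C} (f : c ⟶ d) (x : N c),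
    coord i d (N.act f x) = coord i c x ≫ f
  sum_eq : ∀ {c : C} (x : N c), ∑ i, N.act (coord i c x) (gen i) = x

variable [IsLocallyBounded C] [IsHomFinite k C]

/-- The dual basis of a free left module. -/
def freeDualBasis {m : ℕ} (pt : Fin m → C) : (free (k := k) pt).DualBasis where
  m := m
  pt := pt
  gen i := Function.update (0 : ∀ j, pt j ⟶ pt i) i (𝟙 (pt i))
  coord i c := (LinearMap.proj i : (∀ i, pt i ⟶ c) →ₗ[k] (pt i ⟶ c))
  coord_act _ _ _ _ _ := rfl
  sum_eq {c} x := funext fun j => by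
    refine (Finset.sum_apply j Finset.univ _).trans ?_
    rw [Finset.sum_eq_single j]
    · exact (congrArg (· ≫ x j) (Function.update_self j (𝟙 (pt j))
        (0 : ∀ l, pt l ⟶ pt j))).trans (Category.id_comp _)
    · intro i _ hij
      exact (congrArg (· ≫ x i) (Function.update_of_ne hij.symm (𝟙 (pt i))
        (0 : ∀ l, pt l ⟶ pt i))).trans zero_comp
    · intro h; exact absurd (Finset.mem_univ _) h

namespace DualBasis

variable {N : LeftMod k C} (b : N.DualBasis)

variable (B) in
/-- The map from `F (pt i)` to `Hom_C(N, F)` given by a coordinate of a dual basis. -/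
def evToHom (i : Fin b.m) : ev k B (b.pt i) ⟶ N.homFunctor B where
  app F := N.hLift F (fun c => F.obj.mapLinearMap k ∘ₗ b.coord i c) (fun c d f x => by
    simp [b.coord_act])
  naturality F G α := hom_hom_ext fun c x => by
    rw [Category.assoc, hLift_π, Category.assoc, map_hπ, ← Category.assoc, hLift_π]
    exact (α.hom.naturality _).symm

variable (B) in
/-- The map from `Hom_C(N, F)` to `F (pt i)` given by an element of a dual basis. -/
def homToEv (i : Fin b.m) : N.homFunctor B ⟶ ev k B (b.pt i) where
  app F := N.hπ F (b.pt i) (b.gen i)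
  naturality _ _ α := N.map_hπ α _

/-- A morphism out of `N` is recovered from its values on the basis elements; hence `Hom_C(N, -)` is
a direct summand of a finite sum of evaluations, over any `B`. -/
lemma sum_homToEv (F : LinFun k C B) :
    ∑ i, (b.homToEv B i).app F ≫ (b.evToHom B i).app F = 𝟙 _ :=
  hom_hom_ext fun c x => by
    rw [Preadditive.sum_comp, Category.id_comp]
    conv_rhs => rw [← b.sum_eq x, map_sum]
    refine Finset.sum_congr rfl fun i _ => ?_
    rw [hπ_act, Category.assoc]
    exact congrArg (N.hπ F (b.pt i) (b.gen i) ≫ ·) (N.hLift_π F _ _ c x)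

lemma exactAt_hom (b : N.DualBasis) {ι : Type*} {s : ComplexShape ι}
    {K : HomologicalComplex (LinFun k C B) s} {i : ι} (h : K.ExactAt i) :
    (((N.homFunctor B).mapHomologicalComplex s).obj K).ExactAt i :=
  exactAt_of_sum_factors K i (fun i => ev k B (b.pt i)) (b.homToEv B) (b.evToHom B)
    b.sum_homToEv fun j => exactAt_ev h (b.pt j)

end DualBasis

end LeftMod

/-! ### Cofree coresolutions and relative Ext -/

section

variable (k : Type u) [CommRing k] {C : Type w} [Category.{u} C] [Preadditive C] [Linear k C]
variable {B : Type u₂} [Category.{v₂} B] [Abelian B] [Linear k B]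
variable [IsLocallyBounded C] [IsHomFinite k C]

/-- The canonical coresolution of `F` by objects in the image of `i_*`. -/
abbrev cofreeCoresolution (F : LinFun k C B) : CochainComplex (LinFun k C B) ℕ :=
  coresolution (evalAll k C B ⋙ freeFun k C B ⋙ nuFunctor k C B) (starAdjunction k C B).unit F

/-- Here `i^*` is the left adjoint, and its faithfulness makes the unit monomorphic. -/
lemma mono_starAdjunction_unit (F : LinFun k C B) : Mono ((starAdjunction k C B).unit.app F) :=
  have := (nakayama k C B).faithful
  inferInstance

lemma cofreeCoresolution_exactAt (F : LinFun k C B) {i : ℕ} (hi : 0 < i) :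
    (cofreeCoresolution k F).ExactAt i := by
  obtain ⟨i, rfl⟩ := Nat.exists_eq_succ_of_ne_zero hi.ne'
  exact coresolution_exactAt_succ _ (mono_starAdjunction_unit k) F i

end

namespace LeftMod

variable {k : Type u} [CommRing k] {C : Type w} [Category.{u} C] [Preadditive C] [Linear k C]
variable {B : Type u₂} [Category.{v₂} B] [Abelian B] [Linear k B]
variable [IsLocallyBounded C] [IsHomFinite k C]

variable (B) in
/-- The relative `Ext^i(N, F)` vanish for all `F : C ⥤ B` and `i > n`. -/
def ExtVanishesAbove (N : LeftMod k C) (n : ℕ) : Prop :=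
  ∀ (F : LinFun k C B) (i : ℕ), n < i →
    (((N.homFunctor B).mapHomologicalComplex _).obj (cofreeCoresolution k F)).ExactAt i

lemma homSeq_cofreeCoresolution_shortExact (N : LeftMod k C) (F : LinFun k C B) (i : ℕ) :
    (N.homSeq ((cofreeCoresolution k F).X i)).ShortExact := by
  obtain ⟨Y, ⟨e⟩⟩ := coresolution_X (evalAll k C B ⋙ freeFun k C B ⋙ nuFunctor k C B)
    (starAdjunction k C B).unit F i
  exact N.homSeq_shortExact (Y := (evalAll k C B).obj Y) e

/-- `Hom_C(-, K)` reverses the syzygy sequence, so the connecting isomorphism raises the degree from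
`Ext^i(syz N, F)` to `Ext^(i+1)(N, F)`. The middle term vanishes for `i > 0` because the cover is
free. -/
lemma extVanishesAbove_succ_iff (N : LeftMod k C) (n : ℕ) :
    N.ExtVanishesAbove B (n + 1) ↔ N.syz.ExtVanishesAbove B n := by
  have key : ∀ (F : LinFun k C B) (i : ℕ), 0 < i →
      ((((N.syz.homFunctor B).mapHomologicalComplex _).obj (cofreeCoresolution k F)).ExactAt i ↔
      (((N.homFunctor B).mapHomologicalComplex _).obj (cofreeCoresolution k F)).ExactAt (i + 1)) :=
    fun F i hi => exactAt_iff_of_shortExact N.coverHom.precomp N.syzHom.precomp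
      (cofreeCoresolution k F) (fun _ => N.coverHom_syzHom_precomp _)
      (N.homSeq_cofreeCoresolution_shortExact F) i (i + 1) rfl
      ((freeDualBasis _).exactAt_hom (cofreeCoresolution_exactAt k F hi))
      ((freeDualBasis _).exactAt_hom (cofreeCoresolution_exactAt k F i.succ_pos))
  constructor
  · intro h F i hi
    exact (key F i (by lia)).2 (h F (i + 1) (by lia))
  · intro h F i hi
    obtain ⟨i, rfl⟩ := Nat.exists_eq_succ_of_ne_zero (by lia : i ≠ 0)
    exact (key F i (by lia)).1 (h F i (by lia))

lemma DualBasis.extVanishesAbove {N : LeftMod k C} (b : N.DualBasis) (n : ℕ) :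
    N.ExtVanishesAbove B n :=
  fun F _ hi => b.exactAt_hom (cofreeCoresolution_exactAt k F (Nat.zero_lt_of_lt hi))

end LeftMod

/-- The vanishing of the `R^i ν⁻` in terms of the left modules `D(C(-, c))`. -/
lemma rightDerived_isZero_iff (k : Type u) [CommRing k] {C : Type w} [Category.{u} C]
    [Preadditive C] [Linear k C] {B : Type u₂} [Category.{v₂} B] [Abelian B] [Linear k B]
    [IsLocallyBounded C] [IsHomFinite k C] (F : LinFun k C B) (i : ℕ) :
    IsZero ((nakayama k C B).rightDerivedObj i F) ↔ ∀ c : C,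
      ((((LeftMod.dual k c).homFunctor B).mapHomologicalComplex _).obj
        (cofreeCoresolution k F)).ExactAt i := by
  refine (HomologicalComplex.exactAt_iff_isZero_homology _ _).symm.trans ?_
  refine (exactAt_iff_ev _ _).trans (forall_congr' fun c => ?_)
  exact exactAt_of_natIso (LeftMod.nuMinusEvIso c) _ _

namespace LeftMod

variable {k : Type u} [CommRing k] {C : Type w} [Category.{u} C] [Preadditive C] [Linear k C]
variable {B : Type u₂} [Category.{v₂} B] [Abelian B] [Linear k B]
variable [IsLocallyBounded C] [IsHomFinite k C]

/-! ### Left exactness -/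

section

variable (N : LeftMod k C)

lemma mono_hom_map {F G : LinFun k C B} (α : F ⟶ G) [Mono α] :
    Mono ((N.homFunctor B).map α) where
  right_cancellation f g h := hom_hom_ext fun c x => by
    have : Mono (α.hom.app c) := inferInstanceAs (Mono ((ev k B c).map α))
    rw [← cancel_mono (α.hom.app c), Category.assoc, Category.assoc, ← map_hπ, ← Category.assoc,
      h, Category.assoc]

/-- Left exactness: a morphism to `Hom_C(N, S.X₂)` is a natural family, which lifts object by object
through the kernels `S.f`; uniqueness of the lifts keeps it linear and natural. -/
lemma hom_map_exact {S : ShortComplex (LinFun k C B)} (hS : S.Exact) [Mono S.f] :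
    (S.map (N.homFunctor B)).Exact := by
  have he : ∀ c, Mono (S.map (ev k B c)).f := fun c => inferInstanceAs (Mono ((ev k B c).map S.f))
  have hx : ∀ c, (S.map (ev k B c)).Exact := fun c => hS.map (ev k B c)
  have key : ∀ {Z : B} (φ : Z ⟶ (N.homFunctor B).obj S.X₂)
      (_ : φ ≫ (N.homFunctor B).map S.g = 0),
      ∃ ψ : Z ⟶ (N.homFunctor B).obj S.X₁, ψ ≫ (N.homFunctor B).map S.f = φ := by
    intro Z φ hφ
    have h0 : ∀ c (x : N c), (φ ≫ N.hπ S.X₂ c x) ≫ (S.map (ev k B c)).g = 0 := fun c x => by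
      refine (Category.assoc _ _ _).trans ?_
      refine (congrArg (φ ≫ ·) (N.map_hπ S.g x).symm).trans ?_
      exact (Category.assoc _ _ _).symm.trans
        ((congrArg (· ≫ N.hπ S.X₃ c x) hφ).trans zero_comp)
    let ψ : ∀ c (x : N c), Z ⟶ S.X₁.obj.obj c := fun c x => (hx c).lift _ (h0 c x)
    have hψ : ∀ c (x : N c), ψ c x ≫ S.f.hom.app c = φ ≫ N.hπ S.X₂ c x := fun c x =>
      (hx c).lift_f _ (h0 c x)
    have ext : ∀ {c} {f g : Z ⟶ S.X₁.obj.obj c}, f ≫ S.f.hom.app c = g ≫ S.f.hom.app c → f = g :=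
      fun {c f g} h => (he c).right_cancellation f g h
    refine ⟨N.hLift S.X₁ (fun c =>
      { toFun := ψ c
        map_add' := fun x y => ext (by simp [hψ, Preadditive.add_comp])
        map_smul' := fun r x => ext (by simp [hψ]) }) (fun c d f x => ext ?_),
      hom_hom_ext fun c x => ?_⟩
    · simp only [LinearMap.coe_mk, AddHom.coe_mk, hψ, hπ_act]
      refine (Category.assoc _ _ _).symm.trans ?_
      refine (congrArg (· ≫ S.X₂.obj.map f) (hψ c x).symm).trans ?_
      exact (Category.assoc _ _ _).trans ((congrArg (ψ c x ≫ ·)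
        (S.f.hom.naturality f).symm).trans (Category.assoc _ _ _).symm)
    · rw [Category.assoc, map_hπ, ← Category.assoc, hLift_π]
      exact hψ c x
  have := N.mono_hom_map S.f
  exact ShortComplex.exact_of_f_is_kernel _ (KernelFork.IsLimit.ofι _ _
    (fun φ hφ => (key φ hφ).choose) (fun φ hφ => (key φ hφ).choose_spec)
    (fun φ hφ _ hψ => (cancel_mono ((N.homFunctor B).map S.f)).1
      (hψ.trans (key φ hφ).choose_spec.symm)))

/-- This is the exact sequence `Hom(cover N, F) ⟶ Hom(syz N, F) ⟶ Ext^1(N, F)`, by a chase through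
the cofree coresolution that uses the vanishing in degree one. -/
lemma syzHom_precomp_surjective (hN : N.ExtVanishesAbove (ModuleCat.{u} k) 0)
    (F : LinFun k C (ModuleCat.{u} k)) (x : (N.syz.homFunctor (ModuleCat.{u} k)).obj F) :
    ∃ y, N.syzHom.precomp.app F y = x := by
  let K := cofreeCoresolution k F
  let η : F ⟶ K.X 0 := coresolutionCoaugmentation _ _ F
  have hη : Mono η := mono_starAdjunction_unit k F
  have w : η ≫ K.d 0 1 = 0 := coaugmentation_comp_coresolution_d _ _ F
  have hK : (ShortComplex.mk _ _ w).Exact :=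
    coresolution_exact_coaugmentation _ (mono_starAdjunction_unit k) F
  have hS := fun i => N.homSeq_cofreeCoresolution_shortExact F i
  have hinj := fun i => (ModuleCat.mono_iff_injective _).1 (hS i).mono_f
  have hsurj := fun i => (ModuleCat.epi_iff_surjective _).1 (hS i).epi_g
  have hex : ∀ i (y : (N.cover.homFunctor (ModuleCat.{u} k)).obj (K.X i)),
      N.syzHom.precomp.app (K.X i) y = 0 → ∃ v, N.coverHom.precomp.app (K.X i) v = y := fun i =>
    (ShortComplex.moduleCat_exact_iff _).1 (hS i).exact
  have hExt : ∀ y : (N.homFunctor (ModuleCat.{u} k)).obj (K.X 1),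
      (N.homFunctor _).map (K.d 1 2) y = 0 → ∃ v, (N.homFunctor _).map (K.d 0 1) v = y := by
    have h1 := hN F 1 Nat.zero_lt_one
    rw [HomologicalComplex.exactAt_iff' _ 0 1 2 (by simp) (by simp),
      ShortComplex.moduleCat_exact_iff] at h1
    exact h1
  have hcov : ∀ y : (N.cover.homFunctor (ModuleCat.{u} k)).obj (K.X 0),
      (N.cover.homFunctor _).map (K.d 0 1) y = 0 →
        ∃ v, (N.cover.homFunctor _).map η v = y :=
    (ShortComplex.moduleCat_exact_iff _).1
      (N.cover.hom_map_exact (S := ShortComplex.mk _ _ w) hK)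
  have nat₁ : ∀ {G H : LinFun k C (ModuleCat.{u} k)} (α : G ⟶ H)
      (y : (N.cover.homFunctor (ModuleCat.{u} k)).obj G),
      N.syzHom.precomp.app H ((N.cover.homFunctor _).map α y) =
        (N.syz.homFunctor _).map α (N.syzHom.precomp.app G y) := fun α y =>
    ConcreteCategory.congr_hom (N.syzHom.precomp.naturality α) y
  have nat₂ : ∀ {G H : LinFun k C (ModuleCat.{u} k)} (α : G ⟶ H)
      (y : (N.homFunctor (ModuleCat.{u} k)).obj G),
      N.coverHom.precomp.app H ((N.homFunctor _).map α y) =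
        (N.cover.homFunctor _).map α (N.coverHom.precomp.app G y) := fun α y =>
    ConcreteCategory.congr_hom (N.coverHom.precomp.naturality α) y
  have comp₁ : (N.syz.homFunctor _).map (K.d 0 1) ((N.syz.homFunctor _).map η x) = 0 := by
    have := ConcreteCategory.congr_hom (congrArg (N.syz.homFunctor (ModuleCat.{u} k)).map w) x
    rwa [Functor.map_comp, Functor.map_zero] at this
  have comp₂ : ∀ y : (N.cover.homFunctor (ModuleCat.{u} k)).obj (K.X 0),
      (N.cover.homFunctor _).map (K.d 1 2) ((N.cover.homFunctor _).map (K.d 0 1) y) = 0 :=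
    fun y => by
    have := ConcreteCategory.congr_hom (congrArg (N.cover.homFunctor (ModuleCat.{u} k)).map
      (K.d_comp_d 0 1 2)) y
    rwa [Functor.map_comp, Functor.map_zero] at this
  have comp₃ : ∀ G (y : (N.homFunctor (ModuleCat.{u} k)).obj G),
      N.syzHom.precomp.app G (N.coverHom.precomp.app G y) = 0 := fun G y =>
    ConcreteCategory.congr_hom (N.coverHom_syzHom_precomp G) y
  -- Over the cofree `K⁰` the image of `x` extends to the cover. The differential of this extension
  -- `z` vanishes on the syzygy, so it comes from some `v` in `Hom(N, K¹)`.
  obtain ⟨z, hz⟩ : ∃ z, N.syzHom.precomp.app (K.X 0) z = (N.syz.homFunctor _).map η x :=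
    hsurj 0 _
  obtain ⟨v, hv⟩ := hex 1 ((N.cover.homFunctor _).map (K.d 0 1) z)
    ((nat₁ (K.d 0 1) z).trans ((congrArg _ hz).trans comp₁))
  -- `v` is a cocycle, as can be checked in `Hom(cover N, K²)`, hence a coboundary. Correcting `z`
  -- by `t` gives a cocycle with the same restriction to the syzygy.
  obtain ⟨t, rfl⟩ := hExt v (hinj 2 (by
    refine (nat₂ (K.d 1 2) v).trans ?_
    rw [hv, comp₂]
    exact (map_zero _).symm))
  obtain ⟨y, hy⟩ := hcov (z - N.coverHom.precomp.app (K.X 0) t) (by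
    rw [map_sub, sub_eq_zero]
    exact hv.symm.trans (nat₂ (K.d 0 1) t))
  -- Equality with `x` may be tested after the injection into `Hom(syz N, K⁰)`.
  refine ⟨y, (ModuleCat.mono_iff_injective _).1 (N.syz.mono_hom_map η) ?_⟩
  refine (nat₁ η y).symm.trans ?_
  rw [hy, map_sub, comp₃, sub_zero]
  exact hz

end

/-! ### Left modules with vanishing `Ext` have dual bases -/

/-- A left module, viewed as a linear functor to `k`-modules. -/
def toLinFun (N : LeftMod k C) : LinFun k C (ModuleCat.{u} k) where
  obj :=
    { obj := fun c => ModuleCat.of k (N c)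
      map := fun f => ModuleCat.ofHom (N.act f)
      map_id := fun _ => ModuleCat.hom_ext (LinearMap.ext N.act_id)
      map_comp := fun f g => ModuleCat.hom_ext (LinearMap.ext (N.act_comp f g)) }
  property := ⟨⟨fun {_ _ f g} => ModuleCat.hom_ext (map_add N.act f g)⟩,
    ⟨fun f r => ModuleCat.hom_ext (LinearMap.map_smul N.act r f)⟩⟩

/-- The map from `k` to `Hom_C(N, N)` given by the identity. -/
def idMap (N : LeftMod k C) :
    ModuleCat.of k k ⟶ (N.homFunctor (ModuleCat.{u} k)).obj N.toLinFun :=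
  N.hLift N.toLinFun (fun c =>
    { toFun := fun x => ModuleCat.ofHom (LinearMap.toSpanSingleton k (N c) x)
      map_add' := fun x y => ModuleCat.hom_ext (LinearMap.toSpanSingleton_add x y)
      map_smul' := fun r x => ModuleCat.hom_ext (LinearMap.toSpanSingleton_smul r x) })
    (fun _ _ f x => ModuleCat.hom_ext (LinearMap.ext fun t =>
      ((N.act f).map_smul t x).symm))

/-- The element of `Hom_C(N, N)` given by the identity. -/
def idElement (N : LeftMod k C) : (N.homFunctor (ModuleCat.{u} k)).obj N.toLinFun :=
  N.idMap (1 : k)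

lemma hπ_idElement (N : LeftMod k C) {c : C} (x : N c) : N.hπ N.toLinFun c x N.idElement = x := by
  have h : N.idMap ≫ N.hπ N.toLinFun c x = ModuleCat.ofHom (LinearMap.toSpanSingleton k (N c) x) :=
    N.hLift_π N.toLinFun _ _ c x
  exact (ConcreteCategory.congr_hom h (1 : k)).trans (one_smul k x)

/-- The morphism of left modules given by an element of `Hom_C(M, N)`. -/
def homOfElement {M N : LeftMod k C} (z : (M.homFunctor (ModuleCat.{u} k)).obj N.toLinFun) :
    Hom M N where
  app c :=
    { toFun := fun x => M.hπ N.toLinFun c x z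
      map_add' := fun x y => by rw [map_add]; rfl
      map_smul' := fun r x => by rw [LinearMap.map_smul]; rfl }
  map_act f x := ConcreteCategory.congr_hom (M.hπ_act N.toLinFun f x) z

variable (N : LeftMod k C)

/-- The coefficient functor is `syz N` itself: its identity extends to the cover. No transpose is
needed on this side. -/
lemma exists_retraction (hN : N.ExtVanishesAbove (ModuleCat.{u} k) 0) :
    ∃ r : Hom N.cover N.syz, ∀ c (x : N.syz c), r.app c (N.syzHom.app c x) = x := by
  obtain ⟨z, hz⟩ := N.syzHom_precomp_surjective hN _ N.syz.idElement
  refine ⟨homOfElement z, fun c x => ?_⟩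
  refine (ConcreteCategory.congr_hom (homPrecomp_hπ N.syzHom N.syz.toLinFun x) z).symm.trans ?_
  exact (congrArg (N.syz.hπ N.syz.toLinFun c x) hz).trans (N.syz.hπ_idElement x)

/-- A retraction of the inclusion of the kernel of the cover yields a dual basis. -/
def dualBasisOfRetraction (r : Hom N.cover N.syz)
    (hr : ∀ c (x : N.syz c), r.app c (N.syzHom.app c x) = x) : N.DualBasis where
  m := N.generators.m
  pt := N.generators.pt
  gen := N.generators.gen
  coord i c := (LinearMap.proj i : (∀ i, N.generators.pt i ⟶ c) →ₗ[k] (N.generators.pt i ⟶ c)) ∘ₗ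
    (N.coverSection c - N.syzHom.app c ∘ₗ r.app c ∘ₗ N.coverSection c)
  coord_act i c d f x := by
    -- The failure of the `k`-linear section to respect the action lies in the syzygy, where the
    -- correction by `r` cancels it.
    obtain ⟨y, hy⟩ := N.exists_syzHom_eq
      (x := N.coverSection d (N.act f x) - N.cover.act f (N.coverSection c x)) (by
        rw [map_sub, Hom.map_act, coverHom_coverSection, coverHom_coverSection, sub_self])
    have h : N.coverSection d (N.act f x) = N.syzHom.app d y + N.cover.act f (N.coverSection c x) :=
      (sub_eq_iff_eq_add.1 hy.symm)
    have h2 : N.coverSection d (N.act f x) -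
          N.syzHom.app d (r.app d (N.coverSection d (N.act f x))) =
        N.cover.act f (N.coverSection c x - N.syzHom.app c (r.app c (N.coverSection c x))) := by
      rw [h, map_add, map_add, hr, Hom.map_act, Hom.map_act, map_sub, add_sub_add_left_eq_sub]
    exact congrFun h2 i
  sum_eq {c} x := by
    refine (N.coverHom_apply
      (N.coverSection c x - N.syzHom.app c (r.app c (N.coverSection c x)))).symm.trans ?_
    rw [map_sub, coverHom_coverSection, coverHom_syzHom, sub_zero]

lemma nonempty_dualBasis (hN : N.ExtVanishesAbove (ModuleCat.{u} k) 0) : Nonempty N.DualBasis := by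
  obtain ⟨r, hr⟩ := N.exists_retraction hN
  exact ⟨N.dualBasisOfRetraction r hr⟩

variable {N} in
-- Dimension shift down over `k`-modules and back up over `B`; the dual basis obtained at `n = 0`
-- does not involve the coefficients.
lemma ExtVanishesAbove.of_moduleCat {n : ℕ} (hN : N.ExtVanishesAbove (ModuleCat.{u} k) n)
    {B : Type u₂} [Category.{v₂} B] [Abelian B] [Linear k B] : N.ExtVanishesAbove B n := by
  induction n generalizing N with
  | zero => exact (N.nonempty_dualBasis hN).some.extVanishesAbove 0
  | succ n ih => exact (N.extVanishesAbove_succ_iff n).2 (ih ((N.extVanishesAbove_succ_iff n).1 hN))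

end LeftMod

/-! ### Passage to general coefficients for the right derived functors -/

lemma rightDerived_isZero_of_moduleCat {k : Type u} [CommRing k] {C : Type w} [Category.{u} C]
    [Preadditive C] [Linear k C] [IsLocallyBounded C] [IsHomFinite k C] {n : ℕ}
    (h : ∀ i, n < i → ∀ F, IsZero ((nakayama k C (ModuleCat.{u} k)).rightDerivedObj i F))
    {B : Type u₂} [Category.{v₂} B] [Abelian B] [Linear k B] (i : ℕ) (hi : n < i)
    (F : LinFun k C B) : IsZero ((nakayama k C B).rightDerivedObj i F) := by
  rw [rightDerived_isZero_iff]
  intro c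
  have hc : (LeftMod.dual k c).ExtVanishesAbove (ModuleCat.{u} k) n := fun G j hj =>
    (rightDerived_isZero_iff k G j).1 (h j hj G) c
  exact hc.of_moduleCat F i hi

lemma vanishesAbove_of_moduleCat {k : Type u} [CommRing k] {C : Type w} [Category.{u} C]
    [Preadditive C] [Linear k C] [IsLocallyBounded C] [IsHomFinite k C] {n : ℕ}
    (h : (nakayama k C (ModuleCat.{u} k)).VanishesAbove n)
    (B : Type u₂) [Category.{v₂} B] [Abelian B] [Linear k B] :
    (nakayama k C B).VanishesAbove n := fun i hi =>
  ⟨leftDerived_isZero_of_moduleCat (fun j hj => (h j hj).1) i hi,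
    rightDerived_isZero_of_moduleCat (fun j hj => (h j hj).2) i hi⟩

end RelGorenstein

end

theorem lemma24 {k : Type u} [CommRing k]
    {C : Type w} [Category.{u} C] [Preadditive C] [Linear k C]
    [RelGorenstein.IsLocallyBounded C] [RelGorenstein.IsHomFinite k C]
    {B : Type u₂} [Category.{v₂} B] [Abelian B] [Linear k B] (n : ℕ)
    (h : (RelGorenstein.nakayama k C (ModuleCat.{u} k)).IsGorensteinOfDim n) :
    ∃ m ≤ n, (RelGorenstein.nakayama k C B).IsGorensteinOfDim m := by
  classical
  have hB := RelGorenstein.vanishesAbove_of_moduleCat h.1 B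
  -- The bound `n` carries over to `B` but its minimality may not: for `B = 0` the dimension is `0`.
  -- So `m` is taken to be the least bound over `B`.
  exact ⟨Nat.find ⟨n, hB⟩, Nat.find_min' _ hB, Nat.find_spec ⟨n, hB⟩,
    fun r hr => Nat.find_min' _ hr⟩
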